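/- **Network.** Let $I$ resources with capacities $C=(C_i)$ serve $J$ job types. Job type $j$ uses a non-empty set $N_j$ of resources, $K_{ij}=1$ if $i\in N_j$ and $K_{ij}=0$ otherwise. The sets $N_j$ are pairwise distinct, and every resource $i$ has a job type $j$ with $N_j=\{i\}$. Let $\mathcal S^1=\{j:|N_j|=1\}$, and let $\hat\imath(j)$ be the only resource used by $j\in\mathcal S^1$. The holding cost vector $h\in\mathbb R^J$ is strictly positive. For each real $r>0$ the $r$-th network has arrival rates $\lambda^r_j>0$ and work rates $\mu^r_j>0$; $\varrho^r_j=\lambda^r_j/\mu^r_j$ and $K\varrho^r<C$. As $r\to\infty$, $\lambda^r_j\to\lambda_j\in(0,\infty)$, $\mu^r_j\to\mu_j\in(0,\infty)$ and, with $\varrho_j=\lambda_j/\mu_j$, $K\varrho=C$, $r(\varrho-\varrho^r)\to\beta^*$ and $K\beta^*>0$ (componentwise). **Workload cost.** Let $M=\mathrm{diag}(1/\mu_j)$, $G=KM$ with columns $g_j$, and $\mathcal C(w)=\inf\{h\cdot q:q\in\mathbb R_+^J,\ Gq=w\}$ for $w\in\mathbb R_+^I$. Let $\mathcal S^p=\{j:\mathcal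 C(g_j)<h_j\}$, $\mathcal S^m=\{1,\dots,J\}\setminus(\mathcal S^p\cup\mathcal S^1)$ and $m=|\mathcal S^m|$. **Viable ranking.** Say that a set $M$ of job types covers $k$ if $N_k\subseteq\bigcup_{j\in M}N_j$. Assume that a viable ranking exists, and fix one: a bijection $\rho:\{1,\dots,m\}\to\mathcal S^m$ such that for every $k$, with $F_k=\{\rho(1),\dots,\rho(k-1)\}$, $E_k=\mathcal S^m\setminus F_k$ and $j'=\rho(k)$, $$\mu_{j'}h_{j'}+\mathcal C\Big(\sum_{j\in M}K_j-K_{j'}\Big)\le\mathcal C\Big(\sum_{j\in M}K_j\Big)$$ ($K_j$ is the $j$-th column of $K$) for every set $M\subseteq(E_k\cup\mathcal S^1)\setminus\{j'\}$ that covers $j'$, has no subset $M\setminus\{l\}$, $l\in M$, that covers $j'$, and covers no element of $F_k$. **Policy.** Fix $0<\alpha<1/2$, $0<c_1<c_2$ and let $\delta=\min_j\varrho_j/(2J)$. Given queue lengths $Q^r_j(t)$, let $\sigma=\{j:Q^r_j(t)\ge c_2r^\alpha\}$ and $\zeta^k_i=\{j:i\in N_j\}\setminus\{\rho(1),\dots,\rho(k)\}$.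 Define $y(t)$ as follows. - For $j\in\mathcal S^p$: $y_j=\varrho_j+\delta$ if $j\in\sigma$, and $y_j=\varrho_j-\delta/(J2^{m+3})$ otherwise. - For $j=\rho(k)$: $y_j=\varrho_j-2^{k-m-2}\delta$ if $\zeta^k_i\cap\sigma\ne\emptyset$ for all $i\in N_j$; otherwise $y_j=\varrho_j+2^{k-m-2}\delta$ if $j\in\sigma$ and $y_j=\varrho_j-2^{-k-m-2}\delta$ if $j\notin\sigma$. - For $j\in\mathcal S^1$ with $i=\hat\imath(j)$: $y_j=C_i-\sum_{l\ne j,\,i\in N_l}y_l$ if $i\in\bigcup_{l\in\sigma}N_l$, and $y_j=\varrho_j-\delta$ otherwise. Let $\mathcal E^r_j(t)\in\{0,1\}$ be $1$ from each time when $Q^r_j$ falls below $c_1r^\alpha$ until the next time when $Q^r_j\ge c_2r^\alpha$, and $0$ otherwise; an initial mark $z_j=1$ means that queue $j$ starts out suspended ($\mathcal E^r_j=1$) until $Q^r_j\ge c_2r^\alpha$, whereas with $z_j=0$ it is suspended from the first time $t\ge0$ at which $Q^r_j(t)<c_1r^\alpha$. The allocated rates are $x_j(t)=y_j(t)1_{\{\mathcal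 E^r_j(t)=0\}}$, and $B^r_j(t)=\int_0^tx_j(s)\,ds$. **Processes.** Let $A^r_j$, $S^r_j$, $j=1,\dots,J$, be independent Poisson processes with rates $\lambda^r_j$, $\mu^r_j$, the counting processes of i.i.d. exponential interarrival times and amounts of work. For $x=(q,z)\in\mathcal S^r=(\tfrac1r\mathbb N_0)^J\times\{0,1\}^J$, under $E_x$ the queue lengths solve $Q^r_j(t)=rq_j+A^r_j(t)-S^r_j(B^r_j(t))$ with initial marks $z$. Put $\hat Q^r(t)=Q^r(r^2t)/r$ and $\tilde W^r(t)=G\hat Q^r(t)$. **Theorem.** There are constants $B,R\in(0,\infty)$ such that for all $r\ge R$, all $x=(q,z)\in\mathcal S^r$, all $\theta>0$ and all $T\ge1$, the integrands below are integrable and $$\left|E_x\Big[\int_0^\infty e^{-\theta t}\,h\cdot\hat Q^r(t)\,dt\Big]-E_x\Big[\int_0^\infty e^{-\theta t}\,\mathcal C(\tilde W^r(t))\,dt\Big]\right|\le Br^{\alpha-1/2}\,\frac{1+|q|^2}{1-e^{-\theta}}$$ and $$\left|E_x\Big[\frac1T\int_0^Th\cdot\hat Q^r(t)\,dt\Big]-E_x\Big[\frac1T\int_0^T\mathcal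 C(\tilde W^r(t))\,dt\Big]\right|\le Br^{\alpha-1/2}(1+|q|^2).$$ -/

import Mathlib

open MeasureTheory ProbabilityTheory Filter Topology Matrix

noncomputable section

/-- Static data of a resource sharing network with `I` resources and `J` job types (in the heavy
traffic limit): the set `N j` of resources needed by job type `j`, the capacities `C`, the holding
cost vector `h`, and the limiting arrival and work rates `lam`, `mu`. -/
structure Network (I J : ℕ) where
  N : Fin J → Finset (Fin I)
  C : Fin I → ℝ
  h : Fin J → ℝ
  lam : Fin J → ℝ
  mu : Fin J → ℝ

namespace Network

variable {I J : ℕ} (net : Network I J)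

/-- The incidence matrix: `K i j = 1` if resource `i` works on job type `j`, and `0` otherwise. -/
def K : Matrix (Fin I) (Fin J) ℝ := fun i j => if i ∈ net.N j then 1 else 0

/-- The limiting traffic intensities `ϱ j = lam j / mu j`. -/
def load (j : Fin J) : ℝ := net.lam j / net.mu j

/-- The matrix `G = K M`, where `M` is diagonal with entries `1 / mu j`. -/
def G : Matrix (Fin I) (Fin J) ℝ := net.K * Matrix.diagonal (fun j => 1 / net.mu j)

/-- The queue lengths `q ≥ 0` which produce the workload `w`. -/
def queuesOf (w : Fin I → ℝ) : Set (Fin J → ℝ) := {q | 0 ≤ q ∧ net.G *ᵥ q = w}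

/-- The workload cost `𝒞(w) = inf {h ⬝ q : q ≥ 0, G q = w}`. -/
def workloadCost (w : Fin I → ℝ) : ℝ := sInf ((fun q => net.h ⬝ᵥ q) '' net.queuesOf w)

/-- The job types that use exactly one resource. -/
def single : Set (Fin J) := {j | (net.N j).card = 1}

/-- The unique resource used by a job type in `single`. -/
def soleResource (j : Fin J) (hj : j ∈ net.single) : Fin I :=
  (Finset.card_eq_one.mp hj).choose

/-- The primary job types: the `j` with `𝒞(g_j) < h_j`, with `g_j` the `j`-th column of `G`. -/
def primary : Set (Fin J) := {j | net.workloadCost (fun i => net.G i j) < net.h j}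

/-- The secondary (that is, not primary) job types that use several resources. -/
def multi : Set (Fin J) := (net.primary)ᶜ \ net.single

/-- `M` covers `N k`: every resource used by `k` is used by some job type in `M`. -/
def Covers (M : Finset (Fin J)) (k : Fin J) : Prop := net.N k ⊆ M.biUnion net.N

/-- The minimal covering sets of `k`, consisting of job types in `E` other than `k`, which
cover no job type in `F`. -/
def minCovers (E F : Set (Fin J)) (k : Fin J) : Set (Finset (Fin J)) :=
  {M | (∀ j ∈ M, j ∈ E ∧ j ≠ k) ∧ net.Covers M k ∧ (∀ l ∈ M, ¬ net.Covers (M.erase l) k) ∧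
    ∀ l ∈ F, ¬ net.Covers M l}

/-- The set `𝒪_F^E` of those `j' ∈ E` for which
`mu j' * h j' + 𝒞(∑_{j ∈ M} K_j - K_{j'}) ≤ 𝒞(∑_{j ∈ M} K_j)` for every minimal covering set `M`
of `j'` in `E ∪ single` which covers no job type in `F`. -/
def optJobs (E F : Set (Fin J)) : Set (Fin J) :=
  {j' | j' ∈ E ∧ ∀ M ∈ net.minCovers (E ∪ net.single) F j',
    net.mu j' * net.h j' + net.workloadCost (fun i => ∑ j ∈ M, net.K i j - net.K i j')
      ≤ net.workloadCost (fun i => ∑ j ∈ M, net.K i j)}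

/-- A viable ranking of the job types in `multi`. The index `k : Fin m` stands for the rank
`k + 1`, and `ρ '' {l | l < k}` is the set of job types of smaller rank. -/
structure IsViableRanking {m : ℕ} (ρ : Fin m → Fin J) : Prop where
  injective : Function.Injective ρ
  range_eq : Set.range ρ = net.multi
  optimal : ∀ k : Fin m,
    ρ k ∈ net.optJobs (net.multi \ (ρ '' {l | l < k})) (ρ '' {l | l < k})

/-- The standing assumptions on the network: every job type uses some resource, no two job types
use the same set of resources, every resource has a job type that uses only this resource, and the
holding costs are positive. -/
structure IsLocalTraffic : Prop where
  nonempty : ∀ j, (net.N j).Nonempty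
  injective : Function.Injective net.N
  local_traffic : ∀ i, ∃ j ∈ net.single, i ∈ net.N j
  cost_pos : ∀ j, 0 < net.h j

/-- The heavy traffic condition on the arrival rates `lamR r j` and the work rates `muR r j`
of the `r`-th network, `r > 0`. -/
structure IsHeavyTraffic (lamR muR : ℝ → Fin J → ℝ) (β : Fin J → ℝ) : Prop where
  lam_pos : ∀ j, 0 < net.lam j
  mu_pos : ∀ j, 0 < net.mu j
  lamR_pos : ∀ r > 0, ∀ j, 0 < lamR r j
  muR_pos : ∀ r > 0, ∀ j, 0 < muR r j
  under_capacity : ∀ r > 0, ∀ i, (net.K *ᵥ fun j => lamR r j / muR r j) i < net.C i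
  tendsto_lam : ∀ j, Tendsto (fun r => lamR r j) atTop (𝓝 (net.lam j))
  tendsto_mu : ∀ j, Tendsto (fun r => muR r j) atTop (𝓝 (net.mu j))
  capacity_eq : net.C = net.K *ᵥ net.load
  tendsto_load : ∀ j, Tendsto (fun r => r * (net.load j - lamR r j / muR r j)) atTop (𝓝 (β j))
  drift_pos : ∀ i, 0 < (net.K *ᵥ β) i

/-! The rate allocation policy. Below `σ` is the set of stocked job types (those with queue length
at least the upper threshold), and the ranking `ρ` is indexed by `Fin m`. -/

/-- `δ = min_j ϱ_j / (2 J)`. -/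
def delta : ℝ := (⨅ j, net.load j) / (2 * J)

/-- The set `ζ_i^k` of job types which use resource `i` and are not among the `ρ l`, `l ≤ k`. -/
def zeta {m : ℕ} (ρ : Fin m → Fin J) (i : Fin I) (k : Fin m) : Set (Fin J) :=
  {j | i ∈ net.N j ∧ j ∉ ρ '' {l | l ≤ k}}

/-- The resources used by some stocked job type. -/
def busy (σ : Set (Fin J)) : Set (Fin I) := {i | ∃ j ∈ σ, i ∈ net.N j}

open Classical in
/-- The nominal flow rate for a primary job type. -/
def flowPrimary (m : ℕ) (σ : Set (Fin J)) (j : Fin J) : ℝ :=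
  if j ∈ σ then net.load j + net.delta else net.load j - net.delta / (J * 2 ^ (m + 3))

open Classical in
/-- The nominal flow rate for the job type `ρ k` of `multi`. The rank of `ρ k` is `k + 1`. -/
def flowMulti {m : ℕ} (ρ : Fin m → Fin J) (σ : Set (Fin J)) (k : Fin m) : ℝ :=
  if ∀ i ∈ net.N (ρ k), (net.zeta ρ i k ∩ σ).Nonempty then
    net.load (ρ k) - (2 : ℝ) ^ (((k : ℕ) + 1 : ℤ) - m - 2) * net.delta
  else if ρ k ∈ σ then
    net.load (ρ k) + (2 : ℝ) ^ (((k : ℕ) + 1 : ℤ) - m - 2) * net.delta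
  else
    net.load (ρ k) - (2 : ℝ) ^ (-((k : ℕ) + 1 : ℤ) - m - 2) * net.delta

open Classical in
/-- The nominal flow rate for a job type which is primary or in `multi`. -/
def flowShared {m : ℕ} (ρ : Fin m → Fin J) (σ : Set (Fin J)) (j : Fin J) : ℝ :=
  if hk : ∃ k, ρ k = j then net.flowMulti ρ σ hk.choose else net.flowPrimary m σ j

open Classical in
/-- The nominal flow rates `y j`. A job type in `single` whose resource `i` is used by a stocked
job type gets the capacity of `i` that is left over by the other job types using `i` (none of which
is in `single`, as distinct job types use distinct sets of resources). -/
def flow {m : ℕ} (ρ : Fin m → Fin J) (σ : Set (Fin J)) (j : Fin J) : ℝ :=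
  if hj : j ∈ net.single then
    if net.soleResource j hj ∈ net.busy σ then
      net.C (net.soleResource j hj) -
        ∑ l with l ≠ j ∧ net.soleResource j hj ∈ net.N l, net.flowShared ρ σ l
    else net.load j - net.delta
  else net.flowShared ρ σ j

end Network

/-- The first time `u ≥ s` at which `p u` holds, `⊤` if there is none. -/
def firstTime (s : EReal) (p : ℝ → Prop) : EReal :=
  sInf ((fun u : ℝ => (u : EReal)) '' {u : ℝ | s ≤ u ∧ p u})

open Classical in
/-- The successive depletion and restocking times of a queue with length `f t` at time `t`, for the
lower threshold `a` and the upper threshold `b`. The value at `l` is `τ_{l+1}`; thus the values at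
even `l` are depletion times and those at odd `l` are restocking times. If the queue is already
suspended initially (`z = true`), the first depletion time is `0`. -/
def switchTime (a b : ℝ) (z : Bool) (f : ℝ → ℝ) : ℕ → EReal
  | 0 => if z = true then 0 else firstTime 0 (fun u => f u < a)
  | l + 1 =>
    if Even l then firstTime (switchTime a b z f l) (fun u => b ≤ f u)
    else firstTime (switchTime a b z f l) (fun u => f u < a)

/-- The queue is suspended (`ℰ_j(t) = 1`) at time `t`: it has been depleted and since then it has
not been stocked again. -/
def Suspended (a b : ℝ) (z : Bool) (f : ℝ → ℝ) (t : ℝ) : Prop :=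
  ∃ l : ℕ, switchTime a b z f (2 * l) ≤ t ∧ (t : EReal) < switchTime a b z f (2 * l + 1)

/-- The renewal counting process `max {k : ξ 1 + ... + ξ k ≤ t}` (with `ξ` indexed from `0`). -/
def countingProcess (ξ : ℕ → ℝ) (t : ℝ) : ℕ :=
  sSup {k : ℕ | ∑ i ∈ Finset.range k, ξ i ≤ t}

namespace Network

variable {I J : ℕ} (net : Network I J)

open Classical in
/-- The rates `x j` allocated at time `t` by the policy with thresholds `a < b`, when `path` is the
trajectory of the queue length vector and `z` marks the initially suspended queues. -/
def allocation {m : ℕ} (ρ : Fin m → Fin J) (a b : ℝ) (z : Fin J → Bool) (path : ℝ → Fin J → ℝ)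
    (t : ℝ) (j : Fin J) : ℝ :=
  if Suspended a b (z j) (fun s => path s j) t then 0
  else net.flow ρ {l | b ≤ path t l} j

end Network

/-- `η j k` and `Δ j k` are mutually independent, exponentially distributed with rates `lam j` and
`mu j` respectively: the interarrival times and the amounts of work of the jobs. -/
structure IsPrimitiveData {J : ℕ} {Ω : Type*} [MeasurableSpace Ω] (P : Measure Ω)
    (lam mu : Fin J → ℝ) (η Δ : Fin J → ℕ → Ω → ℝ) : Prop where
  measurable_arrival : ∀ j k, Measurable (η j k)
  measurable_work : ∀ j k, Measurable (Δ j k)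
  law_arrival : ∀ j k, P.map (η j k) = expMeasure (lam j)
  law_work : ∀ j k, P.map (Δ j k) = expMeasure (mu j)
  indep : iIndepFun (fun p : (Fin J × ℕ) ⊕ (Fin J × ℕ) =>
    Sum.elim (fun u => η u.1 u.2) (fun u => Δ u.1 u.2) p) P

/-- `Q` is the queue length process under the policy with thresholds `a < b`, with initial queue
length vector `q₀` and initial suspension marks `z`: almost surely, for all `t ≥ 0`,
`Q_j(t) = q₀_j + A_j(t) - S_j(B_j(t))` with `B_j(t) = ∫_0^t x_j(s) ds`. -/
structure IsQueueProcess {I J m : ℕ} (net : Network I J) (ρ : Fin m → Fin J) (a b : ℝ)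
    (q₀ : Fin J → ℝ) (z : Fin J → Bool) {Ω : Type*} [MeasurableSpace Ω] (P : Measure Ω)
    (η Δ : Fin J → ℕ → Ω → ℝ) (Q : ℝ → Ω → Fin J → ℝ) : Prop where
  measurable : ∀ t, 0 ≤ t → Measurable (Q t)
  integrable : ∀ᵐ ω ∂P, ∀ t, 0 ≤ t → ∀ j, IntervalIntegrable
    (fun s => net.allocation ρ a b z (fun u => Q u ω) s j) volume 0 t
  queue_eq : ∀ᵐ ω ∂P, ∀ t, 0 ≤ t → ∀ j,
    Q t ω j = q₀ j + countingProcess (fun k => η j k ω) t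
      - countingProcess (fun k => Δ j k ω)
          (∫ s in (0 : ℝ)..t, net.allocation ρ a b z (fun u => Q u ω) s j)

/-- The diffusion scaled queue length process `Q(r² t) / r`. -/
def scaledQueue {J : ℕ} {Ω : Type*} (r : ℝ) (Q : ℝ → Ω → Fin J → ℝ) (t : ℝ) (ω : Ω) :
    Fin J → ℝ := fun j => Q (r ^ 2 * t) ω j / r

/-- The state space: pairs of a vector in `(r⁻¹ ℕ)^J` and a vector in `{0, 1}^J`. -/
def stateSpace (J : ℕ) (r : ℝ) : Set ((Fin J → ℝ) × (Fin J → Bool)) :=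
  {x | ∀ j, ∃ n : ℕ, x.1 j = n / r}

end

/-! In terms of the workloads `p j = q j / mu j` of the job types, the workload cost is the value of
a linear program, and the gap between holding cost and workload cost is controlled by a few queues.
Call `p` greedy if no primary job type is present and each `ρ k` uses a resource `i` at which no job
type of `ζ_i^k` is present. A greedy vector is determined by its workload (`IsGreedy.eq`): at such
resources the components can be read off rank by rank. Every workload also has a cheapest producer
that is greedy (`exists_isGreedy`): among the cheapest ones take a maximizer of `∑ 2 ^ (-k) p (ρ
k)`. If it failed at `ρ k`, the job types present would contain a minimal cover of `ρ k`, which by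
viability could be exchanged for `ρ k` at no extra cost, and the gain at rank `k` would exceed the
losses at all later ranks. So every greedy vector is optimal. Deleting the offending queues makes
any vector greedy, whence the gap is at most a constant times the primary queues plus, for every
`k`, the least over `i ∈ N (ρ k)` of the total queue in `ζ_i^k` (`exists_cost_gap_le`).

The policy drains exactly these pools. The deviations of the flow rates from the traffic intensities
are multiples of one unit by powers of two, so that one term decides the sign of a sum. A stocked
primary job type has a surplus; if all pools `ζ_i^k`, `i ∈ N (ρ k)`, are stocked, each has a surplus
(`rateUnit_le_sum_zeta`); a job type that is not stocked always has a deficit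
(`exists_flow_le_of_notMem`). Hence the smallest pool work `Φ` has negative drift, except while `Φ`
is of order `r ^ α` or some queue is suspended. Suspensions are rare, because a queue below the
upper threshold drifts upwards and its descent to the lower one is exponentially unlikely. This is
encoded in a bounded mark cost `Ψ`, on which the generator is at most minus the number of suspended
queues plus an exponentially small error. The generator then maps `Φ ^ 2 + 2 M Φ Ψ` to at most `-d Φ
+ O(r ^ α)` (`lyapunov_generator_le`), and Dynkin's inequality bounds the expected integral of `Φ`
up to time `t` by a constant times `S ^ 2 + r ^ (2 α) + r ^ α t`, with `S` the initial total queue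
length. Diffusion scaling turns this into a bound of the required order.

Dynkin's inequality is proved for jump chains driven by competing exponential clocks, by first-jump
analysis and Fatou's lemma (`lintegral_chainPath_le`). The queue length process solves an implicit
equation, since the allocation depends on its trajectory; `path_eq_chainPath` identifies each
solution with the chain. -/

open scoped ENNReal

/-! ### The workload cost as the value of a linear program -/

namespace Network

variable {I J : ℕ} (net : Network I J)

/-- The holding cost in terms of the workloads `p j = q j / mu j` of the job types. -/
noncomputable def cost (p : Fin J → ℝ) : ℝ := ∑ j, net.mu j * net.h j * p j

lemma cost_add (p p' : Fin J → ℝ) : net.cost (p + p') = net.cost p + net.cost p' := by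
  simp [cost, mul_add, Finset.sum_add_distrib]

lemma cost_sub (p p' : Fin J → ℝ) : net.cost (p - p') = net.cost p - net.cost p' := by
  simp [cost, mul_sub, Finset.sum_sub_distrib]

lemma cost_smul (a : ℝ) (p : Fin J → ℝ) : net.cost (a • p) = a * net.cost p := by
  simp only [cost, Finset.mul_sum, Pi.smul_apply, smul_eq_mul]
  exact Finset.sum_congr rfl fun j _ => by ring

lemma G_mulVec (q : Fin J → ℝ) : net.G *ᵥ q = net.K *ᵥ fun j => q j / net.mu j := by
  rw [G, ← Matrix.mulVec_mulVec]
  congr 1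
  ext j
  simp [Matrix.mulVec_diagonal, div_eq_inv_mul]

lemma G_col (j : Fin J) : (fun i => net.G i j) = net.K *ᵥ Pi.single j (1 / net.mu j) := by
  ext i
  simp [G, Matrix.mul_diagonal]

lemma K_nonneg (i : Fin I) (j : Fin J) : 0 ≤ net.K i j := by
  unfold K; split_ifs <;> norm_num

lemma K_le_one (i : Fin I) (j : Fin J) : net.K i j ≤ 1 := by
  unfold K; split_ifs <;> norm_num

lemma K_mulVec_apply (p : Fin J → ℝ) (i : Fin I) :
    (net.K *ᵥ p) i = ∑ j, net.K i j * p j := rfl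

lemma K_mulVec_nonneg {p : Fin J → ℝ} (hp : 0 ≤ p) : 0 ≤ net.K *ᵥ p := fun i =>
  (Finset.sum_nonneg fun j _ => mul_nonneg (net.K_nonneg i j) (hp j) :
    0 ≤ ∑ j, net.K i j * p j)

section Positive

variable {net}

lemma cost_nonneg (hmu : ∀ j, 0 < net.mu j) (hh : ∀ j, 0 < net.h j)
    {p : Fin J → ℝ} (hp : 0 ≤ p) : 0 ≤ net.cost p :=
  Finset.sum_nonneg fun j _ => mul_nonneg (mul_pos (hmu j) (hh j)).le (hp j)

/-- The substitution `p j = q j / mu j` replaces `G` by the incidence matrix `K`, so that covers of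
resources and exchanges of job types become statements about columns with entries `0` and `1`. -/
lemma image_queuesOf (hmu : ∀ j, 0 < net.mu j) (w : Fin I → ℝ) :
    (fun q => net.h ⬝ᵥ q) '' net.queuesOf w = net.cost '' {p | 0 ≤ p ∧ net.K *ᵥ p = w} := by
  ext x
  constructor
  · rintro ⟨q, ⟨hq, rfl⟩, rfl⟩
    refine ⟨fun j => q j / net.mu j, ⟨fun j => div_nonneg (hq j) (hmu j).le,
      (net.G_mulVec q).symm⟩, Finset.sum_congr rfl fun j _ => ?_⟩
    have := (hmu j).ne'
    field_simp
  · rintro ⟨p, ⟨hp, rfl⟩, rfl⟩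
    refine ⟨fun j => net.mu j * p j, ⟨fun j => mul_nonneg (hmu j).le (hp j), ?_⟩,
      Finset.sum_congr rfl fun j _ => by ring⟩
    rw [G_mulVec]
    congr 1
    ext j
    have := (hmu j).ne'
    field_simp

lemma workloadCost_le (hmu : ∀ j, 0 < net.mu j) (hh : ∀ j, 0 < net.h j)
    {p : Fin J → ℝ} (hp : 0 ≤ p) :
    net.workloadCost (net.K *ᵥ p) ≤ net.cost p := by
  rw [workloadCost, image_queuesOf hmu]
  refine csInf_le ⟨0, ?_⟩ ⟨p, ⟨hp, rfl⟩, rfl⟩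
  rintro _ ⟨p', hp', rfl⟩
  exact cost_nonneg hmu hh hp'.1

lemma workloadCost_nonneg (hmu : ∀ j, 0 < net.mu j) (hh : ∀ j, 0 < net.h j)
    (w : Fin I → ℝ) : 0 ≤ net.workloadCost w := by
  rw [workloadCost, image_queuesOf hmu]
  refine Real.sInf_nonneg ?_
  rintro _ ⟨p', hp', rfl⟩
  exact cost_nonneg hmu hh hp'.1

/-- Among the cheapest ways to produce the workload of `p`, there is one which maximizes a
given continuous function. -/
lemma exists_optimal (hmu : ∀ j, 0 < net.mu j) (hh : ∀ j, 0 < net.h j)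
    (hN : ∀ j, (net.N j).Nonempty) {Ψ : (Fin J → ℝ) → ℝ} (hΨ : Continuous Ψ)
    {p : Fin J → ℝ} (hp : 0 ≤ p) :
    ∃ o : Fin J → ℝ, 0 ≤ o ∧ net.K *ᵥ o = net.K *ᵥ p ∧
      net.cost o = net.workloadCost (net.K *ᵥ p) ∧
      ∀ p', 0 ≤ p' → net.K *ᵥ p' = net.K *ᵥ p → net.cost p' = net.workloadCost (net.K *ᵥ p) →
        Ψ p' ≤ Ψ o := by
  have hcK : Continuous fun p : Fin J → ℝ => net.K *ᵥ p := by fun_prop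
  have hcc : Continuous net.cost := by unfold cost; fun_prop
  set F := {p' : Fin J → ℝ | 0 ≤ p' ∧ net.K *ᵥ p' = net.K *ᵥ p} with hF
  have hcl : IsClosed F :=
    (isClosed_Ici (a := (0 : Fin J → ℝ))).inter (isClosed_eq hcK continuous_const)
  have hFc : IsCompact F := by
    -- Every job type uses some resource, whose workload bounds its component; so the feasible set
    -- is bounded.
    refine (isCompact_Icc (a := (0 : Fin J → ℝ))
      (b := fun _ => ∑ i, (net.K *ᵥ p) i)).of_isClosed_subset hcl ?_
    rintro p' ⟨h0, h1⟩
    refine ⟨h0, fun j => ?_⟩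
    obtain ⟨i, hi⟩ := hN j
    have hK : ∀ i, 0 ≤ (net.K *ᵥ p) i := net.K_mulVec_nonneg hp
    calc p' j = net.K i j * p' j := by simp [K, hi]
      _ ≤ (net.K *ᵥ p') i := Finset.single_le_sum (f := fun j => net.K i j * p' j)
          (fun l _ => mul_nonneg (net.K_nonneg i l) (h0 l)) (Finset.mem_univ j)
      _ = (net.K *ᵥ p) i := by rw [h1]
      _ ≤ _ := Finset.single_le_sum (fun i _ => hK i) (Finset.mem_univ i)
  obtain ⟨o, hoF, ho⟩ := hFc.exists_isMinOn ⟨p, hp, rfl⟩ hcc.continuousOn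
  have hval : net.cost o = net.workloadCost (net.K *ᵥ p) := by
    refine le_antisymm ?_ (hoF.2 ▸ workloadCost_le hmu hh hoF.1)
    rw [workloadCost, image_queuesOf hmu]
    refine le_csInf ⟨_, p, ⟨hp, rfl⟩, rfl⟩ ?_
    rintro _ ⟨p', hp', rfl⟩
    exact ho hp'
  -- The set of cheapest vectors is compact as well, so the tie-breaking function `Ψ` attains its
  -- maximum there.
  have hOc : IsCompact (F ∩ {p' | net.cost p' = net.workloadCost (net.K *ᵥ p)}) :=
    hFc.inter_right (isClosed_eq hcc continuous_const)
  obtain ⟨o', ho'F, ho'⟩ := hOc.exists_isMaxOn ⟨o, hoF, hval⟩ hΨ.continuousOn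
  exact ⟨o', ho'F.1.1, ho'F.1.2, ho'F.2, fun p' h0 h1 h2 => ho' ⟨⟨h0, h1⟩, h2⟩⟩

end Positive

/-- The workload `w ≥ 0` can be produced by the job types which use one resource. -/
lemma exists_singles (hnet : net.IsLocalTraffic) (hmu : ∀ j, 0 < net.mu j) {w : Fin I → ℝ}
    (hw : 0 ≤ w) :
    ∃ p : Fin J → ℝ, 0 ≤ p ∧ net.K *ᵥ p = w ∧
      net.cost p ≤ (∑ j, net.mu j * net.h j) * ∑ i, w i := by
  choose s hs using hnet.local_traffic
  have hN : ∀ i, net.N (s i) = {i} := fun i => by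
    obtain ⟨a, ha⟩ := Finset.card_eq_one.mp (hs i).1
    have := (hs i).2
    rw [ha] at this ⊢
    rw [Finset.mem_singleton.mp this]
  refine ⟨fun j => ∑ i, if s i = j then w i else 0, fun j => Finset.sum_nonneg fun i _ => ?_, ?_,
    ?_⟩
  · split_ifs
    exacts [hw i, le_rfl]
  · ext i
    simp only [Matrix.mulVec, dotProduct, Finset.mul_sum]
    rw [Finset.sum_comm]
    simp [K, hN, Finset.sum_ite_eq]
  · rw [cost, Finset.sum_mul]
    refine Finset.sum_le_sum fun j _ =>
      mul_le_mul_of_nonneg_left (Finset.sum_le_sum fun i _ => ?_)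
        (mul_pos (hmu j) (hnet.cost_pos j)).le
    split_ifs
    exacts [le_rfl, hw i]

/-- Producing less workload costs at most a little more. -/
lemma exists_reduced (hnet : net.IsLocalTraffic) (hmu : ∀ j, 0 < net.mu j) {p : Fin J → ℝ}
    (hp : 0 ≤ p) {w : Fin I → ℝ} (hw : 0 ≤ w) (hwp : w ≤ net.K *ᵥ p) :
    ∃ p' : Fin J → ℝ, 0 ≤ p' ∧ net.K *ᵥ p' = w ∧
      net.cost p' ≤ net.cost p
        + (∑ j, net.mu j * net.h j) * (I * ∑ i, ((net.K *ᵥ p) i - w i)) := by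
  have hv0 : 0 ≤ net.K *ᵥ p := net.K_mulVec_nonneg hp
  have hv := net.K_mulVec_apply p
  generalize net.K *ᵥ p = v at hwp hv0 hv ⊢
  have hd : ∀ i, 0 ≤ (v i - w i) / v i := fun i => div_nonneg (sub_nonneg.2 (hwp i)) (hv0 i)
  -- If `v i = 0` then `w i = 0` too, so the convention `x / 0 = 0` does no harm.
  have hdv : ∀ i, (v i - w i) / v i * v i = v i - w i := fun i => by
    rcases eq_or_ne (v i) 0 with h | h
    · have h1 := hwp i
      have h2 : (0 : ℝ) ≤ w i := hw i
      rw [h] at h1 ⊢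
      have : w i = 0 := le_antisymm h1 h2
      simp [this]
    · field_simp
  -- Job type `j` is cut by the sum of the relative reductions wanted at its resources, capped at
  -- `1`. Each resource then loses at least what it must lose, while the total cut is at most the
  -- total reduction.
  set f : Fin J → ℝ := fun j => min 1 (∑ i, net.K i j * ((v i - w i) / v i)) with hf
  have hf0 : ∀ j, 0 ≤ f j := fun j => le_min zero_le_one
    (Finset.sum_nonneg fun i _ => mul_nonneg (net.K_nonneg i j) (hd i))
  set d : Fin J → ℝ := fun j => p j * f j with hdd
  have hd0 : 0 ≤ d := fun j => mul_nonneg (hp j) (hf0 j)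
  have hdp : d ≤ p := fun j => mul_le_of_le_one_right (hp j) (min_le_left _ _)
  have hKd : ∀ i, v i - w i ≤ (net.K *ᵥ d) i := fun i => by
    rw [← hdv i, K_mulVec_apply]
    nth_rewrite 3 [hv i]
    rw [Finset.mul_sum]
    refine Finset.sum_le_sum fun j _ => ?_
    by_cases hij : i ∈ net.N j
    · have h1 : (v i - w i) / v i ≤ f j := by
        refine le_min ?_ ?_
        · exact div_le_one_of_le₀ (by linarith [show (0:ℝ) ≤ w i from hw i]) (hv0 i)
        · have := Finset.single_le_sum (f := fun i => net.K i j * ((v i - w i) / v i))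
            (fun i _ => mul_nonneg (net.K_nonneg i j) (hd i)) (Finset.mem_univ i)
          simpa [K, hij] using this
      have h2 := mul_le_mul_of_nonneg_right h1 (hp j)
      simp only [K, hij, if_true, one_mul, hdd]
      linarith
    · simp [K, hij]
  have hsum : ∑ i, (net.K *ᵥ d) i ≤ I * ∑ i, (v i - w i) := by
    have h1 : ∑ j, d j ≤ ∑ i, (v i - w i) := by
      calc ∑ j, d j ≤ ∑ j, p j * ∑ i, net.K i j * ((v i - w i) / v i) :=
            Finset.sum_le_sum fun j _ => mul_le_mul_of_nonneg_left (min_le_right _ _) (hp j)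
        _ = ∑ i, (v i - w i) / v i * v i := by
            simp only [Finset.mul_sum]
            rw [Finset.sum_comm]
            refine Finset.sum_congr rfl fun i _ => ?_
            have e : ∀ a, ∑ j, p j * (net.K i j * a) = a * v i := fun a => by
              rw [hv i, Finset.mul_sum]
              exact Finset.sum_congr rfl fun j _ => by ring
            exact e _
        _ = _ := Finset.sum_congr rfl fun i _ => hdv i
    calc ∑ i, (net.K *ᵥ d) i ≤ ∑ _i : Fin I, ∑ j, d j := by
          refine Finset.sum_le_sum fun i _ => ?_
          rw [K_mulVec_apply]
          refine Finset.sum_le_sum fun j _ => ?_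
          exact mul_le_of_le_one_left (hd0 j) (net.K_le_one i j)
      _ = I * ∑ j, d j := by simp
      _ ≤ _ := by gcongr
  -- Resources that lost too much are refilled by job types that use one resource.
  obtain ⟨s, hs0, hsK, hsc⟩ := net.exists_singles hnet hmu
    (w := fun i => (net.K *ᵥ d) i - (v i - w i)) (fun i => sub_nonneg.2 (hKd i))
  refine ⟨p - d + s, add_nonneg (sub_nonneg.2 hdp) hs0, ?_, ?_⟩
  · rw [Matrix.mulVec_add, Matrix.mulVec_sub, hsK]
    ext i
    simp [hv i, K_mulVec_apply]
  · rw [cost_add, cost_sub]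
    have h1 := cost_nonneg (net := net) hmu hnet.cost_pos hd0
    have hL : 0 ≤ ∑ j, net.mu j * net.h j :=
      Finset.sum_nonneg fun j _ => (mul_pos (hmu j) (hnet.cost_pos j)).le
    have h2 : ∑ i, ((net.K *ᵥ d) i - (v i - w i)) ≤ I * ∑ i, (v i - w i) := by
      refine (Finset.sum_le_sum fun i _ => ?_).trans hsum
      linarith [hwp i]
    have h3 := mul_le_mul_of_nonneg_left h2 hL
    linarith

end Network

/-! ### Greedy vectors and the exchange argument -/

lemma Fin.sum_Ioi_two_inv_pow_lt {m : ℕ} (k : Fin m) :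
    ∑ l ∈ Finset.Ioi k, ((1 : ℝ) / 2) ^ (l : ℕ) < (1 / 2) ^ (k : ℕ) := by
  have h : ∀ n : ℕ, ∑ l ∈ Finset.Ioc (k : ℕ) (k + n), ((1 : ℝ) / 2) ^ l
      = (1 / 2) ^ (k : ℕ) - (1 / 2) ^ (k + n : ℕ) := by
    intro n
    induction n with
    | zero => simp
    | succ n ih =>
      rw [← add_assoc, Finset.sum_Ioc_succ_top (by omega), ih, pow_succ]
      ring
  have h2 : ∑ l ∈ Finset.Ioi k, ((1 : ℝ) / 2) ^ (l : ℕ)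
      ≤ ∑ l ∈ Finset.Ioc (k : ℕ) (k + m), ((1 : ℝ) / 2) ^ l := by
    have e := Finset.sum_map (Finset.Ioi k) Fin.valEmbedding (fun l => ((1 : ℝ) / 2) ^ l)
    simp only [Fin.valEmbedding_apply] at e
    rw [← e]
    refine Finset.sum_le_sum_of_subset_of_nonneg ?_ fun _ _ _ => by positivity
    intro x hx
    simp only [Finset.mem_map, Finset.mem_Ioi, Fin.valEmbedding_apply, Finset.mem_Ioc] at hx ⊢
    obtain ⟨a, ha, rfl⟩ := hx
    have := a.2
    exact ⟨ha, by omega⟩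
  refine h2.trans_lt ?_
  rw [h]
  have : (0 : ℝ) < (1 / 2) ^ (k + m : ℕ) := by positivity
  linarith

namespace Network

variable {I J : ℕ} {net : Network I J}

lemma not_mem_single_of_mem_range {m : ℕ} {ρ : Fin m → Fin J} (hρ : net.IsViableRanking ρ)
    (k : Fin m) : ρ k ∉ net.single ∧ ρ k ∉ net.primary := by
  have : ρ k ∈ net.multi := hρ.range_eq ▸ Set.mem_range_self k
  exact ⟨this.2, this.1⟩

lemma single_or_primary_or_mem_range {m : ℕ} {ρ : Fin m → Fin J} (hρ : net.IsViableRanking ρ)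
    (j : Fin J) : j ∈ net.single ∨ j ∈ net.primary ∨ j ∈ Set.range ρ := by
  rw [hρ.range_eq, multi]
  by_cases h1 : j ∈ net.single <;> by_cases h2 : j ∈ net.primary <;> simp [h1, h2]

lemma eq_of_mem_single (hnet : net.IsLocalTraffic) {i : Fin I} {j l : Fin J}
    (hj : j ∈ net.single) (hl : l ∈ net.single) (hij : i ∈ net.N j) (hil : i ∈ net.N l) :
    j = l := by
  obtain ⟨a, ha⟩ := Finset.card_eq_one.mp hj
  obtain ⟨b, hb⟩ := Finset.card_eq_one.mp hl
  rw [ha, Finset.mem_singleton] at hij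
  rw [hb, Finset.mem_singleton] at hil
  exact hnet.injective (by rw [ha, hb, ← hij, ← hil])

/-- In the vector `p`, no primary job type is present, and each `ρ k` uses a resource `i` such that
no job type of `ζ_i^k` is present. -/
structure IsGreedy (net : Network I J) {m : ℕ} (ρ : Fin m → Fin J) (p : Fin J → ℝ) : Prop where
  nonneg : 0 ≤ p
  primary : ∀ j ∈ net.primary, p j = 0
  multi : ∀ k, ∃ i ∈ net.N (ρ k), ∀ j ∈ net.zeta ρ i k, p j = 0

/-- At the resource where `p` contains nothing from `ζ_i^k`, the workload of `p` comes from `ρ 0,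
..., ρ k` alone, whereas `p'` may use further job types. The parts of smaller rank cancel. -/
lemma IsGreedy.le_of_eq {m : ℕ} {ρ : Fin m → Fin J} {p p' : Fin J → ℝ}
    (hp : net.IsGreedy ρ p) (hp' : net.IsGreedy ρ p') (h : net.K *ᵥ p = net.K *ᵥ p') (k : Fin m)
    (hk : ∀ l < k, p (ρ l) = p' (ρ l)) : p' (ρ k) ≤ p (ρ k) := by
  obtain ⟨i, hi, hz⟩ := hp.multi k
  have h0 : ∑ j, net.K i j * (p j - p' j) = 0 := by
    have := congrFun h i
    rw [K_mulVec_apply, K_mulVec_apply] at this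
    simp [mul_sub, this]
  have h1 : ∑ j, net.K i j * (p j - p' j) ≤ ∑ j, if j = ρ k then p j - p' j else 0 := by
    refine Finset.sum_le_sum fun j _ => ?_
    by_cases hij : i ∈ net.N j
    · simp only [K, hij, if_true, one_mul]
      split_ifs with hjk
      · exact le_rfl
      · by_cases hj : ∃ l < k, ρ l = j
        · obtain ⟨l, hl, rfl⟩ := hj
          simp [hk l hl]
        · rw [hz j ⟨hij, ?_⟩]
          · linarith [show (0 : ℝ) ≤ p' j from hp'.nonneg j]
          · rintro ⟨l, hl, rfl⟩
            rcases lt_or_eq_of_le (show l ≤ k from hl) with h | rfl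
            exacts [hj ⟨l, h, rfl⟩, hjk rfl]
    · have : j ≠ ρ k := fun h => hij (h ▸ hi)
      simp [K, hij, this]
  rw [h0] at h1
  simp only [Finset.sum_ite_eq', Finset.mem_univ, if_true] at h1
  linarith

/-- The ranks are settled one after the other by `le_of_eq` in both directions, and primary
components vanish. The job types that use one resource are then determined by what is left of the
workload, because each resource has only one of them. -/
lemma IsGreedy.eq {m : ℕ} {ρ : Fin m → Fin J} (hnet : net.IsLocalTraffic)
    (hρ : net.IsViableRanking ρ) {p p' : Fin J → ℝ}
    (hp : net.IsGreedy ρ p) (hp' : net.IsGreedy ρ p') (h : net.K *ᵥ p = net.K *ᵥ p') :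
    p = p' := by
  have hm : ∀ k : Fin m, p (ρ k) = p' (ρ k) := by
    intro k
    induction k using WellFoundedLT.induction with
    | ind k ih =>
      exact le_antisymm (hp'.le_of_eq hp h.symm k fun l hl => (ih l hl).symm)
        (hp.le_of_eq hp' h k ih)
  have hns : ∀ j ∉ net.single, p j = p' j := by
    intro j hj
    rcases single_or_primary_or_mem_range hρ j with h1 | h1 | ⟨k, rfl⟩
    · exact absurd h1 hj
    · rw [hp.primary j h1, hp'.primary j h1]
    · exact hm k
  ext j
  by_cases hj : j ∈ net.single
  · obtain ⟨i, hi⟩ := hnet.nonempty j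
    have h0 : ∑ l, net.K i l * (p l - p' l) = 0 := by
      have := congrFun h i
      rw [K_mulVec_apply, K_mulVec_apply] at this
      simp [mul_sub, this]
    rw [Finset.sum_eq_single j] at h0
    · simp only [K, hi, if_true, one_mul] at h0
      linarith
    · intro l _ hlj
      by_cases hl : l ∈ net.single
      · have : i ∉ net.N l := fun hil => hlj (eq_of_mem_single hnet hl hj hil hi)
        simp [K, this]
      · simp [hns l hl]
    · simp
  · exact hns j hj

open Classical in
/-- There is a greedy cheapest way to produce a given workload. -/
lemma exists_isGreedy {m : ℕ} {ρ : Fin m → Fin J} (hnet : net.IsLocalTraffic)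
    (hmu : ∀ j, 0 < net.mu j) (hρ : net.IsViableRanking ρ) {p : Fin J → ℝ} (hp : 0 ≤ p) :
    ∃ o, net.IsGreedy ρ o ∧ net.K *ᵥ o = net.K *ᵥ p ∧
      net.cost o = net.workloadCost (net.K *ᵥ p) := by
  have hh := hnet.cost_pos
  -- With the weights `2 ^ (-k)` a gain at rank `k` outweighs equal losses at all later ranks.
  obtain ⟨o, ho0, hoK, hoc, hmax⟩ := exists_optimal hmu hh hnet.nonempty
    (Ψ := fun p => ∑ k : Fin m, (1 / 2 : ℝ) ^ (k : ℕ) * p (ρ k)) (by fun_prop) hp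
  -- Exchanging a part `d` of `o` for another producer `a` of the same workload cannot lower the
  -- cost and, if it does not raise the cost, cannot raise the weighted sum.
  have exch : ∀ d a : Fin J → ℝ, d ≤ o → 0 ≤ a → net.K *ᵥ a = net.K *ᵥ d →
      net.cost d ≤ net.cost a ∧ (net.cost a ≤ net.cost d →
        ∑ k : Fin m, (1 / 2 : ℝ) ^ (k : ℕ) * a (ρ k)
          ≤ ∑ k : Fin m, (1 / 2 : ℝ) ^ (k : ℕ) * d (ρ k)) := by
    intro d a hd ha hK
    have h0 : 0 ≤ o - d + a := add_nonneg (sub_nonneg.2 hd) ha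
    have h1 : net.K *ᵥ (o - d + a) = net.K *ᵥ p := by
      rw [Matrix.mulVec_add, Matrix.mulVec_sub, hK, hoK]; simp
    have h2 := workloadCost_le hmu hh h0
    rw [h1, ← hoc, cost_add, cost_sub] at h2
    refine ⟨by linarith, fun h => ?_⟩
    have h3 := hmax _ h0 h1 (by rw [← hoc, cost_add, cost_sub]; linarith)
    simp only [Pi.add_apply, Pi.sub_apply, mul_add, mul_sub, Finset.sum_add_distrib,
      Finset.sum_sub_distrib] at h3
    linarith
  have hprim : ∀ j ∈ net.primary, o j = 0 := by
    intro j hj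
    by_contra hne
    have hpos : 0 < o j := lt_of_le_of_ne (ho0 j) (Ne.symm hne)
    have he : (0 : Fin J → ℝ) ≤ Pi.single j (1 / net.mu j) := by
      rw [Pi.single_nonneg]; exact (one_div_pos.2 (hmu j)).le
    obtain ⟨a, ha0, haK, hac, -⟩ := exists_optimal hmu hh hnet.nonempty
      (Ψ := fun _ => 0) continuous_const he
    have hlt : net.cost a < net.h j := by
      rw [hac, ← G_col]; exact hj
    -- A primary job type that is present could be exchanged for the strictly cheaper producer of
    -- its column.
    have h1 := (exch (Pi.single j (o j)) ((net.mu j * o j) • a) ?_ ?_ ?_).1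
    · rw [cost_smul] at h1
      have h2 : net.cost (Pi.single j (o j)) = net.mu j * net.h j * o j := by
        simp [cost, Pi.single_apply]
      rw [h2] at h1
      have := mul_lt_mul_of_pos_left hlt (mul_pos (hmu j) hpos)
      linarith
    · intro l
      rcases eq_or_ne l j with rfl | h
      · simp
      · simpa [h] using ho0 l
    · exact smul_nonneg (mul_pos (hmu j) hpos).le ha0
    · rw [Matrix.mulVec_smul, haK, ← Matrix.mulVec_smul, ← Pi.single_smul]
      congr 2
      have := (hmu j).ne'
      simp; field_simp
  refine ⟨o, ⟨ho0, hprim, ?_⟩, hoK, hoc⟩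
  intro k
  induction k using WellFoundedLT.induction with
  | ind k ih =>
  by_contra! hfail
  have : Nonempty (Fin J) := ⟨ρ k⟩
  choose! s hs using hfail
  -- If the claim fails for `ρ k`, the job types that are present outside `ρ 0, ..., ρ k` cover it.
  -- A minimal cover among them is the candidate for an exchange.
  set M₀ : Finset (Fin J) := {j | j ∉ ρ '' {l | l ≤ k} ∧ o j ≠ 0} with hM₀
  have hcov : net.Covers M₀ (ρ k) := by
    intro i hi
    rw [Finset.mem_biUnion]
    refine ⟨s i, ?_, (hs i hi).1.1⟩
    simp only [hM₀, Finset.mem_filter, Finset.mem_univ, true_and]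
    exact ⟨(hs i hi).1.2, (hs i hi).2⟩
  obtain ⟨M, hMM₀, hMin⟩ := exists_minimal_le_of_wellFoundedLT
    (fun M : Finset (Fin J) => net.Covers M (ρ k)) M₀ hcov
  have hMmem : ∀ j ∈ M, j ∉ ρ '' {l | l ≤ k} ∧ 0 < o j := fun j hj => by
    have := hMM₀ hj
    simp only [hM₀, Finset.mem_filter, Finset.mem_univ, true_and] at this
    exact ⟨this.1, lt_of_le_of_ne (ho0 j) (Ne.symm this.2)⟩
  have hmin : M ∈ net.minCovers (net.multi \ (ρ '' {l | l < k}) ∪ net.single)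
      (ρ '' {l | l < k}) (ρ k) := by
    refine ⟨fun j hj => ⟨?_, ?_⟩, hMin.1, fun l hl hc => ?_, ?_⟩
    · obtain ⟨h1, h2⟩ := hMmem j hj
      by_cases hsj : j ∈ net.single
      · exact Or.inr hsj
      · refine Or.inl ⟨⟨fun h => h2.ne' (hprim j h), hsj⟩, ?_⟩
        rintro ⟨l, hl, rfl⟩
        exact h1 ⟨l, le_of_lt (show l < k from hl), rfl⟩
    · rintro rfl
      exact (hMmem _ hj).1 ⟨k, le_refl k, rfl⟩
    · exact Finset.notMem_erase l M (hMin.2 hc (Finset.erase_subset l M) hl)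
    -- By induction `ρ l` uses a resource without job types of `ζ_i^l` present. Members of `M` are
    -- present and not among `ρ 0, ..., ρ k`, so none of them uses this resource.
    · rintro _ ⟨l, hl, rfl⟩ hc
      obtain ⟨i, hi, hz⟩ := ih l hl
      obtain ⟨j, hj, hij⟩ := Finset.mem_biUnion.1 (hc hi)
      obtain ⟨h1, h2⟩ := hMmem j hj
      refine h2.ne' (hz j ⟨hij, ?_⟩)
      rintro ⟨l', hl', rfl⟩
      exact h1 ⟨l', le_trans (show l' ≤ l from hl') (le_of_lt (show l < k from hl)), rfl⟩
  have hopt := (hρ.optimal k).2 M hmin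
  have hMK : (fun i => ∑ j ∈ M, net.K i j) = net.K *ᵥ (fun j => if j ∈ M then 1 else 0) := by
    ext i
    simp [K_mulVec_apply, Finset.sum_ite_mem]
  have hkK : ∀ i, net.K i (ρ k) ≤ ∑ j ∈ M, net.K i j := by
    intro i
    by_cases hi : i ∈ net.N (ρ k)
    · obtain ⟨j, hj, hij⟩ := Finset.mem_biUnion.1 (hMin.1 hi)
      calc net.K i (ρ k) ≤ net.K i j := by simp [K, hi, hij]
        _ ≤ _ := Finset.single_le_sum (f := fun j => net.K i j)
          (fun l _ => net.K_nonneg i l) hj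
    · simp [K, hi]
  obtain ⟨p₁, hp₁, hp₁K, -⟩ := net.exists_singles hnet hmu
    (w := fun i => ∑ j ∈ M, net.K i j - net.K i (ρ k)) (fun i => sub_nonneg.2 (hkK i))
  obtain ⟨a, ha0, haK, hac, -⟩ := exists_optimal hmu hh hnet.nonempty
      (Ψ := fun _ => 0) continuous_const hp₁
  rw [hp₁K] at haK hac
  rw [← hac] at hopt
  have hM1 := workloadCost_le (net := net) hmu hh
    (p := fun j => if j ∈ M then 1 else 0) (fun j => by dsimp; split_ifs <;> norm_num)
  rw [← hMK] at hM1
  obtain ⟨ε, hε, hεo⟩ : ∃ ε > 0, ∀ j ∈ M, ε ≤ o j := by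
    rcases M.eq_empty_or_nonempty with rfl | hne
    · exact ⟨1, one_pos, by simp⟩
    · obtain ⟨j, hj, hjm⟩ := M.exists_min_image o hne
      exact ⟨o j, (hMmem j hj).2, hjm⟩
  -- By viability, `ρ k` together with the cheapest producer `a` of the remaining workload costs no
  -- more than `M`. The exchange gains at least `ε 2 ^ (-k)` in the weighted sum and loses at most
  -- `ε ∑ 2 ^ (-l)` over `l > k`, a contradiction.
  have h1 := (exch (ε • fun j => if j ∈ M then 1 else 0) (ε • (Pi.single (ρ k) 1 + a))
    ?_ ?_ ?_).2 ?_
  · simp only [Pi.smul_apply, Pi.add_apply, smul_eq_mul] at h1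
    have h2 : ε * (1 / 2 : ℝ) ^ (k : ℕ)
        ≤ ∑ l : Fin m, (1 / 2 : ℝ) ^ (l : ℕ)
          * (ε * ((Pi.single (ρ k) 1 : Fin J → ℝ) (ρ l) + a (ρ l))) := by
      have hnn : ∀ l ∈ (Finset.univ : Finset (Fin m)), 0 ≤ (1 / 2 : ℝ) ^ (l : ℕ)
          * (ε * ((Pi.single (ρ k) 1 : Fin J → ℝ) (ρ l) + a (ρ l))) := by
        intro l _
        have : (0 : ℝ) ≤ (Pi.single (ρ k) 1 : Fin J → ℝ) (ρ l) := by
          rw [Pi.single_apply]; split_ifs <;> norm_num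
        have := ha0 (ρ l)
        simp only [Pi.zero_apply] at this
        positivity
      refine le_trans ?_ (Finset.single_le_sum hnn (Finset.mem_univ k))
      have := ha0 (ρ k)
      simp only [Pi.zero_apply, Pi.single_eq_same] at this ⊢
      have : 0 ≤ (1 / 2 : ℝ) ^ (k : ℕ) * ε * a (ρ k) := by positivity
      linarith
    have h3 : ∑ l : Fin m, (1 / 2 : ℝ) ^ (l : ℕ) * (ε * if ρ l ∈ M then 1 else 0)
        ≤ ε * ∑ l ∈ Finset.Ioi k, (1 / 2 : ℝ) ^ (l : ℕ) := by
      rw [Finset.mul_sum, ← Finset.sum_subset (Finset.subset_univ (Finset.Ioi k))]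
      · refine Finset.sum_le_sum fun l _ => ?_
        split_ifs
        · linarith
        · have : 0 ≤ ε * (1 / 2 : ℝ) ^ (l : ℕ) := by positivity
          simpa using this
      · intro l _ hl
        have : ρ l ∉ M := fun h => (hMmem _ h).1 ⟨l, not_lt.1 (by simpa using hl), rfl⟩
        simp [this]
    have h4 := mul_lt_mul_of_pos_left (Fin.sum_Ioi_two_inv_pow_lt k) hε
    linarith
  · intro j
    by_cases hj : j ∈ M
    · simpa [hj] using hεo j hj
    · simpa [hj] using ho0 j
  · exact smul_nonneg hε.le (add_nonneg (by rw [Pi.single_nonneg]; norm_num) ha0)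
  · rw [Matrix.mulVec_smul, Matrix.mulVec_smul, Matrix.mulVec_add, haK, ← hMK]
    congr 1
    ext i
    simp
  · rw [cost_smul, cost_smul, cost_add]
    refine mul_le_mul_of_nonneg_left ?_ hε.le
    have h2 : net.cost (Pi.single (ρ k) 1) = net.mu (ρ k) * net.h (ρ k) := by
      simp [cost, Pi.single_apply]
    rw [h2]
    exact hopt.trans hM1

open Classical in
/-- The cost of a queue length vector exceeds the workload cost by at most a multiple of the total
length of the queues which a greedy vector would keep empty. -/
lemma exists_cost_gap_le {m : ℕ} {ρ : Fin m → Fin J} (hnet : net.IsLocalTraffic)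
    (hmu : ∀ j, 0 < net.mu j) (hρ : net.IsViableRanking ρ) :
    ∃ L > 0, ∀ q : Fin J → ℝ, 0 ≤ q → ∀ s : Fin m → Fin I, (∀ k, s k ∈ net.N (ρ k)) →
      net.h ⬝ᵥ q - net.workloadCost (net.G *ᵥ q)
        ≤ L * (∑ j with j ∈ net.primary, q j
          + ∑ k, ∑ j with j ∈ net.zeta ρ (s k) k, q j) := by
  have hh := hnet.cost_pos
  set H := ∑ j, net.mu j * net.h j with hH
  have hH0 : 0 ≤ H := Finset.sum_nonneg fun j _ => (mul_pos (hmu j) (hh j)).le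
  set A := ∑ j, 1 / net.mu j with hA
  have hA0 : 0 ≤ A := Finset.sum_nonneg fun j _ => (one_div_pos.2 (hmu j)).le
  refine ⟨(H + H * (I * I)) * A + 1, by positivity, fun q hq s hs => ?_⟩
  set p : Fin J → ℝ := fun j => q j / net.mu j with hp
  have hp0 : 0 ≤ p := fun j => div_nonneg (hq j) (hmu j).le
  -- Deleting these queues leaves a greedy vector, whichever resources `s k` are selected.
  set Z : Finset (Fin J) :=
    {j | j ∈ net.primary ∨ ∃ k, j ∈ net.zeta ρ (s k) k} with hZ
  set d : Fin J → ℝ := fun j => if j ∈ Z then p j else 0 with hd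
  have hd0 : 0 ≤ d := fun j => by simp only [hd]; split_ifs; exacts [hp0 j, le_rfl]
  have hdp : d ≤ p := fun j => by simp only [hd]; split_ifs; exacts [le_rfl, hp0 j]
  have hpd : 0 ≤ p - d := sub_nonneg.2 hdp
  have hgr : net.IsGreedy ρ (p - d) := by
    refine ⟨hpd, fun j hj => ?_, fun k => ⟨s k, hs k, fun j hj => ?_⟩⟩
    · have : j ∈ Z := by simp [hZ, hj]
      simp [hd, this]
    · have : j ∈ Z := by
        simp only [hZ, Finset.mem_filter, Finset.mem_univ, true_and]
        exact Or.inr ⟨k, hj⟩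
      simp [hd, this]
  obtain ⟨o, ho, hoK, hoc⟩ := exists_isGreedy hnet hmu hρ hpd
  -- A greedy vector is determined by its workload, so the remainder `p - d` coincides with a
  -- cheapest producer.
  obtain rfl := ho.eq hnet hρ hgr hoK
  obtain ⟨a, ha0, haK, hac, -⟩ := exists_optimal hmu hh hnet.nonempty
      (Ψ := fun _ => 0) continuous_const hp0
  -- A cheapest producer `a` of the full workload is thinned to the workload of `p - d`. As `p - d`
  -- is optimal, it costs at most as much as `a` plus a multiple of `∑ j, d j`.
  obtain ⟨b, hb0, hbK, hbc⟩ := net.exists_reduced hnet hmu ha0 (net.K_mulVec_nonneg hpd) (by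
    rw [haK, Matrix.mulVec_sub]
    intro i
    have := net.K_mulVec_nonneg hd0 i
    simp only [Pi.zero_apply, Pi.sub_apply] at this ⊢
    linarith)
  have h1 : net.cost (p - d) ≤ net.cost b := by
    rw [hoc, ← hbK]; exact workloadCost_le hmu hh hb0
  have hdsum : ∀ i, (net.K *ᵥ d) i ≤ ∑ j, d j := fun i => by
    rw [K_mulVec_apply]
    exact Finset.sum_le_sum fun j _ => mul_le_of_le_one_left (hd0 j) (net.K_le_one i j)
  have h2 : ∑ i, ((net.K *ᵥ a) i - (net.K *ᵥ (p - d)) i) ≤ I * ∑ j, d j := by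
    calc _ = ∑ i, (net.K *ᵥ d) i := by
          refine Finset.sum_congr rfl fun i _ => ?_
          rw [haK, Matrix.mulVec_sub]; simp
      _ ≤ ∑ _i : Fin I, ∑ j, d j := Finset.sum_le_sum fun i _ => hdsum i
      _ = _ := by simp
  have h3 : net.cost d ≤ H * ∑ j, d j := by
    rw [hH, Finset.sum_mul]
    exact Finset.sum_le_sum fun j _ => mul_le_mul_of_nonneg_left
      (Finset.single_le_sum (fun l _ => hd0 l) (Finset.mem_univ j)) (mul_pos (hmu j) (hh j)).le
  have h4 : H * (I * ∑ i, ((net.K *ᵥ a) i - (net.K *ᵥ (p - d)) i))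
      ≤ H * (I * (I * ∑ j, d j)) := by gcongr
  have h5 : net.h ⬝ᵥ q = net.cost p := by
    refine Finset.sum_congr rfl fun j _ => ?_
    have := (hmu j).ne'
    simp only [hp]; field_simp
  have h6 : ∑ j, d j ≤ A * ∑ j ∈ Z, q j := by
    simp only [hd, Finset.sum_ite_mem, Finset.univ_inter, Finset.mul_sum]
    refine Finset.sum_le_sum fun j _ => ?_
    simp only [hp]
    rw [div_eq_mul_one_div, mul_comm]
    exact mul_le_mul_of_nonneg_right (Finset.single_le_sum (f := fun j => 1 / net.mu j)
      (fun l _ => (one_div_pos.2 (hmu l)).le) (Finset.mem_univ j)) (hq j)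
  have h7 : ∑ j ∈ Z, q j ≤ ∑ j with j ∈ net.primary, q j
      + ∑ k, ∑ j with j ∈ net.zeta ρ (s k) k, q j := by
    have hq' : ∀ j, 0 ≤ q j := hq
    simp only [Finset.sum_filter, hZ]
    rw [Finset.sum_comm, ← Finset.sum_add_distrib]
    refine Finset.sum_le_sum fun j _ => ?_
    have hsn : 0 ≤ ∑ k, if j ∈ net.zeta ρ (s k) k then q j else 0 :=
      Finset.sum_nonneg fun k _ => by split_ifs; exacts [hq' j, le_rfl]
    split_ifs with hz hpj hpj
    · linarith
    · obtain ⟨k, hk⟩ := hz.resolve_left hpj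
      have := Finset.single_le_sum (f := fun k => if j ∈ net.zeta ρ (s k) k then q j else 0)
        (fun k _ => by split_ifs; exacts [hq' j, le_rfl]) (Finset.mem_univ k)
      simp only [hk, if_true] at this
      linarith
    · exact absurd (Or.inl hpj) hz
    · linarith
  have h8 : net.cost p = net.cost (p - d) + net.cost d := by rw [cost_sub]; ring
  rw [G_mulVec, ← hac, h5, h8]
  have hR0 : 0 ≤ ∑ j ∈ Z, q j := Finset.sum_nonneg fun j _ => hq j
  have h9 : (H + H * (I * I)) * ∑ j, d j ≤ (H + H * (I * I)) * (A * ∑ j ∈ Z, q j) := by gcongr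
  have h10 := mul_le_mul_of_nonneg_left h7
    (show 0 ≤ (H + H * (I * I)) * A + 1 by positivity)
  linarith

end Network

/-! ### Deviations of the flow rates from the traffic intensities -/

lemma sum_range_two_pow_succ (n : ℕ) :
    ∑ l ∈ Finset.range n, (2 : ℝ) ^ (l + 1) = 2 ^ (n + 1) - 2 := by
  induction n with
  | zero => simp
  | succ n ih => rw [Finset.sum_range_succ, ih]; ring

lemma Fin.sum_Iio_two_pow_succ {m : ℕ} (k : Fin m) :
    ∑ l ∈ Finset.Iio k, (2 : ℝ) ^ ((l : ℕ) + 1) = 2 ^ ((k : ℕ) + 1) - 2 := by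
  have e := Finset.sum_map (Finset.Iio k) Fin.valEmbedding (fun l => (2 : ℝ) ^ (l + 1))
  simp only [Fin.valEmbedding_apply, Fin.map_valEmbedding_Iio] at e
  rw [← e, Nat.Iio_eq_range, sum_range_two_pow_succ]

namespace Network

variable {I J : ℕ} {net : Network I J}

/-- The unit `δ / 2 ^ (m + 2)` of the deviations of the flow rates from the traffic intensities. -/
noncomputable def rateUnit (net : Network I J) (m : ℕ) : ℝ := net.delta / 2 ^ (m + 2)

section Flow

lemma delta_pos (j₀ : Fin J) (hl : ∀ j, 0 < net.load j) : 0 < net.delta := by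
  have : Nonempty (Fin J) := ⟨j₀⟩
  obtain ⟨i, hi⟩ := exists_eq_ciInf_of_finite (f := net.load)
  have hJ : 0 < J := j₀.pos
  rw [delta, ← hi]
  have := hl i
  positivity

/-- The deviations are at most `J δ`, so the choice of `δ` keeps every flow rate between one half
and three halves of the traffic intensity. -/
lemma two_mul_delta_le (j : Fin J) : 2 * (J * net.delta) ≤ net.load j := by
  have hJ : (0 : ℝ) < J := by exact_mod_cast j.pos
  have : ⨅ j, net.load j ≤ net.load j := ciInf_le (Set.finite_range _).bddBelow j
  rw [delta]
  calc _ = ⨅ j, net.load j := by field_simp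
    _ ≤ _ := this

lemma rateUnit_pos (j₀ : Fin J) (hl : ∀ j, 0 < net.load j) (m : ℕ) : 0 < net.rateUnit m :=
  div_pos (delta_pos j₀ hl) (by positivity)

lemma delta_eq (m : ℕ) : net.delta = 2 ^ (m + 2) * net.rateUnit m := by
  rw [rateUnit]; field_simp

variable {m : ℕ} {ρ : Fin m → Fin J} (σ : Set (Fin J))

lemma flow_of_notMem_single {j : Fin J} (hj : j ∉ net.single) :
    net.flow ρ σ j = net.flowShared ρ σ j := by
  rw [flow, dif_neg hj]

lemma flow_rank (hρ : net.IsViableRanking ρ) (k : Fin m) :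
    net.flow ρ σ (ρ k) = net.flowMulti ρ σ k := by
  rw [flow_of_notMem_single σ (not_mem_single_of_mem_range hρ k).1, flowShared,
    dif_pos ⟨k, rfl⟩]
  congr 1
  exact hρ.injective (Exists.choose_spec (⟨k, rfl⟩ : ∃ l, ρ l = ρ k))

lemma flow_primary (hρ : net.IsViableRanking ρ) {j : Fin J} (hj : j ∈ net.primary)
    (hs : j ∉ net.single) : net.flow ρ σ j = net.flowPrimary m σ j := by
  rw [flow_of_notMem_single σ hs, flowShared, dif_neg]
  rintro ⟨k, rfl⟩
  exact (not_mem_single_of_mem_range hρ k).2 hj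

lemma zpow_up (k : Fin m) :
    (2 : ℝ) ^ (((k : ℕ) + 1 : ℤ) - m - 2) * net.delta = 2 ^ ((k : ℕ) + 1) * net.rateUnit m := by
  have h : (((k : ℕ) + 1 : ℤ) - m - 2) = (((k : ℕ) + 1 : ℕ) : ℤ) - ((m + 2 : ℕ) : ℤ) := by
    push_cast; ring
  rw [h, zpow_sub₀ two_ne_zero, zpow_natCast, zpow_natCast, rateUnit]
  ring

lemma zpow_down (k : Fin m) :
    (2 : ℝ) ^ (-((k : ℕ) + 1 : ℤ) - m - 2) * net.delta
      = (1 / 2) ^ ((k : ℕ) + 1) * net.rateUnit m := by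
  have h : (-((k : ℕ) + 1 : ℤ) - m - 2) = -(((k : ℕ) + 1 : ℕ) : ℤ) - ((m + 2 : ℕ) : ℤ) := by
    push_cast; ring
  rw [h, zpow_sub₀ two_ne_zero, _root_.zpow_neg, zpow_natCast, zpow_natCast, rateUnit,
    one_div, inv_pow]
  ring

lemma flow_rank_of_forall (hρ : net.IsViableRanking ρ) {k : Fin m}
    (h : ∀ i ∈ net.N (ρ k), (net.zeta ρ i k ∩ σ).Nonempty) :
    net.flow ρ σ (ρ k) = net.load (ρ k) - 2 ^ ((k : ℕ) + 1) * net.rateUnit m := by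
  rw [flow_rank σ hρ, flowMulti, if_pos h, zpow_up]

lemma flow_rank_of_mem (hρ : net.IsViableRanking ρ) {k : Fin m}
    (h : ¬ ∀ i ∈ net.N (ρ k), (net.zeta ρ i k ∩ σ).Nonempty) (hk : ρ k ∈ σ) :
    net.flow ρ σ (ρ k) = net.load (ρ k) + 2 ^ ((k : ℕ) + 1) * net.rateUnit m := by
  rw [flow_rank σ hρ, flowMulti, if_neg h, if_pos hk, zpow_up]

lemma flow_rank_of_notMem (hρ : net.IsViableRanking ρ) {k : Fin m}
    (h : ¬ ∀ i ∈ net.N (ρ k), (net.zeta ρ i k ∩ σ).Nonempty) (hk : ρ k ∉ σ) :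
    net.flow ρ σ (ρ k) = net.load (ρ k) - (1 / 2) ^ ((k : ℕ) + 1) * net.rateUnit m := by
  rw [flow_rank σ hρ, flowMulti, if_neg h, if_neg hk, zpow_down]

lemma half_pow_le_two_pow (n : ℕ) : (1 / 2 : ℝ) ^ n ≤ 2 ^ n :=
  pow_le_pow_left₀ (by norm_num) (by norm_num) n

lemma abs_flow_rank_sub_le (hl : ∀ j, 0 < net.load j) (hρ : net.IsViableRanking ρ)
    (k : Fin m) :
    |net.flow ρ σ (ρ k) - net.load (ρ k)| ≤ 2 ^ ((k : ℕ) + 1) * net.rateUnit m := by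
  have hu := rateUnit_pos (ρ k) hl m
  have h2 := mul_le_mul_of_nonneg_right (half_pow_le_two_pow ((k : ℕ) + 1)) hu.le
  have h3 : 0 < (1 / 2) ^ ((k : ℕ) + 1) * net.rateUnit m := by positivity
  rw [abs_le]
  by_cases h : ∀ i ∈ net.N (ρ k), (net.zeta ρ i k ∩ σ).Nonempty
  · rw [flow_rank_of_forall σ hρ h]; constructor <;> linarith
  · by_cases hk : ρ k ∈ σ
    · rw [flow_rank_of_mem σ hρ h hk]; constructor <;> linarith
    · rw [flow_rank_of_notMem σ hρ h hk]; constructor <;> linarith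

lemma flow_rank_le_of_notMem (hl : ∀ j, 0 < net.load j) (hρ : net.IsViableRanking ρ)
    {k : Fin m} (hk : ρ k ∉ σ) :
    net.flow ρ σ (ρ k) ≤ net.load (ρ k) - (1 / 2) ^ (m + 1) * net.rateUnit m := by
  have hu := rateUnit_pos (ρ k) hl m
  have h1 : (1 / 2 : ℝ) ^ (m + 1) ≤ (1 / 2) ^ ((k : ℕ) + 1) :=
    pow_le_pow_of_le_one (by norm_num) (by norm_num) (by have := k.2; omega)
  have h1' := mul_le_mul_of_nonneg_right h1 hu.le
  have h2 := mul_le_mul_of_nonneg_right (half_pow_le_two_pow ((k : ℕ) + 1)) hu.le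
  by_cases h : ∀ i ∈ net.N (ρ k), (net.zeta ρ i k ∩ σ).Nonempty
  · rw [flow_rank_of_forall σ hρ h]; linarith
  · rw [flow_rank_of_notMem σ hρ h hk]; linarith

lemma flow_primary_of_mem (hρ : net.IsViableRanking ρ) {j : Fin J} (hj : j ∈ net.primary)
    (hs : j ∉ net.single) (hσ : j ∈ σ) :
    net.flow ρ σ j = net.load j + 2 ^ (m + 2) * net.rateUnit m := by
  rw [flow_primary σ hρ hj hs, flowPrimary, if_pos hσ, ← delta_eq]

lemma flow_primary_of_notMem (hρ : net.IsViableRanking ρ) {j : Fin J} (hj : j ∈ net.primary)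
    (hs : j ∉ net.single) (hσ : j ∉ σ) :
    net.flow ρ σ j = net.load j - net.rateUnit m / (2 * J) := by
  rw [flow_primary σ hρ hj hs, flowPrimary, if_neg hσ, rateUnit]
  congr 1
  have : (J : ℝ) ≠ 0 := by exact_mod_cast j.pos.ne'
  field_simp
  ring

lemma abs_flow_sub_le_of_notMem_single (hl : ∀ j, 0 < net.load j) (hρ : net.IsViableRanking ρ)
    {j : Fin J} (hs : j ∉ net.single) : |net.flow ρ σ j - net.load j| ≤ net.delta := by
  have hu := rateUnit_pos j hl m
  have hJ : (1 : ℝ) ≤ J := by exact_mod_cast j.pos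
  rw [delta_eq m]
  rcases (single_or_primary_or_mem_range hρ j).resolve_left hs with hj | ⟨k, rfl⟩
  · by_cases hσ : j ∈ σ
    · rw [flow_primary_of_mem σ hρ hj hs hσ, add_sub_cancel_left, abs_of_pos (by positivity)]
    · rw [flow_primary_of_notMem σ hρ hj hs hσ, sub_sub_cancel_left, abs_neg,
        abs_of_pos (by positivity)]
      calc net.rateUnit m / (2 * J) ≤ net.rateUnit m := div_le_self hu.le (by linarith)
        _ ≤ _ := le_mul_of_one_le_left hu.le (one_le_pow₀ (by norm_num))
  · refine (abs_flow_rank_sub_le σ hl hρ k).trans ?_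
    exact mul_le_mul_of_nonneg_right
      (pow_le_pow_right₀ (by norm_num) (by have := k.2; omega)) hu.le

lemma soleResource_mem {j : Fin J} (hj : j ∈ net.single) :
    net.N j = {net.soleResource j hj} :=
  (Finset.card_eq_one.mp hj).choose_spec

open Classical in
/-- At a resource used by a stocked job type, the flow rates add up to the capacity. -/
lemma sum_flow_sub_load_eq_zero (hnet : net.IsLocalTraffic) (hcap : net.C = net.K *ᵥ net.load)
    {i : Fin I} (hi : i ∈ net.busy σ) :
    ∑ j with i ∈ net.N j, (net.flow ρ σ j - net.load j) = 0 := by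
  obtain ⟨j, hj, hij⟩ := hnet.local_traffic i
  have hi' : net.soleResource j hj = i := by
    have := soleResource_mem hj
    rw [this, Finset.mem_singleton] at hij
    exact hij.symm
  have hC : net.C i = ∑ l with i ∈ net.N l, net.load l := by
    rw [hcap, K_mulVec_apply, Finset.sum_filter]
    exact Finset.sum_congr rfl fun l _ => by simp [K]
  have hsplit : (Finset.univ.filter fun l => i ∈ net.N l)
      = insert j (Finset.univ.filter fun l => l ≠ j ∧ i ∈ net.N l) := by
    ext l
    by_cases h : l = j <;> simp [h, hij]
  rw [Finset.sum_sub_distrib, ← hC, hsplit, Finset.sum_insert (by simp), flow, dif_pos hj, hi',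
    if_pos hi]
  have : ∑ l with l ≠ j ∧ i ∈ net.N l, net.flow ρ σ l
      = ∑ l with l ≠ j ∧ i ∈ net.N l, net.flowShared ρ σ l := by
    refine Finset.sum_congr rfl fun l hl => flow_of_notMem_single σ fun hls => ?_
    simp only [Finset.mem_filter, Finset.mem_univ, true_and] at hl
    exact hl.1 (eq_of_mem_single hnet hls hj hl.2 hij)
  rw [this]
  ring

open Classical in
lemma flow_single_of_mem_busy (hnet : net.IsLocalTraffic) (hcap : net.C = net.K *ᵥ net.load)
    {j : Fin J} {i : Fin I} (hij : i ∈ net.N j) (hi : i ∈ net.busy σ) :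
    net.flow ρ σ j = net.load j
      - ∑ l with l ≠ j ∧ i ∈ net.N l, (net.flow ρ σ l - net.load l) := by
  have h := sum_flow_sub_load_eq_zero (ρ := ρ) σ hnet hcap hi
  have hsplit : (Finset.univ.filter fun l => i ∈ net.N l)
      = insert j (Finset.univ.filter fun l => l ≠ j ∧ i ∈ net.N l) := by
    ext l
    by_cases h : l = j <;> simp [h, hij]
  rw [hsplit, Finset.sum_insert (by simp)] at h
  linarith

lemma flow_single_of_notMem_busy {j : Fin J} (hj : j ∈ net.single) {i : Fin I}
    (hij : i ∈ net.N j) (hi : i ∉ net.busy σ) : net.flow ρ σ j = net.load j - net.delta := by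
  have hi' : net.soleResource j hj = i := by
    have := soleResource_mem hj
    rw [this, Finset.mem_singleton] at hij
    exact hij.symm
  rw [flow, dif_pos hj, hi', if_neg hi]

/-- A job type in `single` at a busy resource compensates at most `J` other deviations, each of size
at most `δ`. -/
lemma abs_flow_sub_le (hnet : net.IsLocalTraffic) (hl : ∀ j, 0 < net.load j)
    (hcap : net.C = net.K *ᵥ net.load) (hρ : net.IsViableRanking ρ) (j : Fin J) :
    |net.flow ρ σ j - net.load j| ≤ J * net.delta := by
  classical
  have hJ : (1 : ℝ) ≤ J := by exact_mod_cast j.pos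
  have hd := delta_pos j hl
  by_cases hs : j ∈ net.single
  · obtain ⟨i, hij⟩ := hnet.nonempty j
    by_cases hi : i ∈ net.busy σ
    · rw [flow_single_of_mem_busy σ hnet hcap hij hi, sub_sub_cancel_left, abs_neg]
      refine (Finset.abs_sum_le_sum_abs _ _).trans ?_
      have h1 : ∀ l ∈ Finset.univ.filter (fun l => l ≠ j ∧ i ∈ net.N l),
          |net.flow ρ σ l - net.load l| ≤ net.delta := by
        intro l hl'
        simp only [Finset.mem_filter, Finset.mem_univ, true_and] at hl'
        exact abs_flow_sub_le_of_notMem_single σ hl hρ fun hls =>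
          hl'.1 (eq_of_mem_single hnet hls hs hl'.2 hij)
      refine (Finset.sum_le_card_nsmul _ _ _ h1).trans ?_
      rw [nsmul_eq_mul]
      gcongr
      simpa using Finset.card_le_univ (Finset.univ.filter fun l => l ≠ j ∧ i ∈ net.N l)
    · rw [flow_single_of_notMem_busy σ hs hij hi, sub_sub_cancel_left, abs_neg, abs_of_pos hd]
      exact le_mul_of_one_le_left hd.le hJ
  · exact (abs_flow_sub_le_of_notMem_single σ hl hρ hs).trans
      (le_mul_of_one_le_left hd.le hJ)

lemma flow_nonneg (hnet : net.IsLocalTraffic) (hl : ∀ j, 0 < net.load j)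
    (hcap : net.C = net.K *ᵥ net.load) (hρ : net.IsViableRanking ρ) (j : Fin J) :
    0 ≤ net.flow ρ σ j := by
  have h1 := (abs_le.1 (abs_flow_sub_le σ hnet hl hcap hρ j)).1
  have h2 := two_mul_delta_le (net := net) j
  have := hl j
  linarith

lemma flow_le (hnet : net.IsLocalTraffic) (hl : ∀ j, 0 < net.load j)
    (hcap : net.C = net.K *ᵥ net.load) (hρ : net.IsViableRanking ρ) (j : Fin J) :
    net.flow ρ σ j ≤ 2 * net.load j := by
  have h1 := (abs_le.1 (abs_flow_sub_le σ hnet hl hcap hρ j)).2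
  have h2 := two_mul_delta_le (net := net) j
  have := hl j
  linarith

open Classical in
lemma sum_eq_sum_primary_add_sum_rank (hρ : net.IsViableRanking ρ) {f : Fin J → ℝ}
    (hf : ∀ j ∈ net.single, f j = 0) :
    ∑ j, f j = ∑ j with j ∈ net.primary, f j + ∑ k, f (ρ k) := by
  rw [← Finset.sum_filter_add_sum_filter_not Finset.univ (fun j => j ∈ net.primary)]
  congr 1
  rw [← Finset.sum_image (s := Finset.univ) (g := ρ) (fun a _ b _ h => hρ.injective h)]
  symm
  refine Finset.sum_subset ?_ ?_
  · intro j hj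
    obtain ⟨k, -, rfl⟩ := Finset.mem_image.1 hj
    simpa using (not_mem_single_of_mem_range hρ k).2
  · intro j hj hj'
    simp only [Finset.mem_filter, Finset.mem_univ, true_and, Finset.mem_image, not_exists] at hj hj'
    rcases single_or_primary_or_mem_range hρ j with h | h | ⟨k, hk⟩
    exacts [hf j h, absurd h hj, absurd hk (hj' k)]

open Classical in
/-- At a busy resource, the job types using several resources get together more than their traffic
intensities if the job type in `single` is not stocked. -/
lemma rateUnit_le_sum_flow_sub_load (hnet : net.IsLocalTraffic) (hl : ∀ j, 0 < net.load j)
    (hρ : net.IsViableRanking ρ)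
    {j : Fin J} (hj : j ∈ net.single) (hjσ : j ∉ σ) {i : Fin I} (hij : i ∈ net.N j)
    (hi : i ∈ net.busy σ) :
    net.rateUnit m ≤ ∑ l with l ≠ j ∧ i ∈ net.N l, (net.flow ρ σ l - net.load l) := by
  have hu := rateUnit_pos j hl m
  set u := net.rateUnit m with hu_def
  have hJ : (0 : ℝ) < J := by exact_mod_cast j.pos
  have hns : ∀ l, l ≠ j → i ∈ net.N l → l ∉ net.single := fun l h1 h2 h3 =>
    h1 (eq_of_mem_single hnet h3 hj h2 hij)
  set f : Fin J → ℝ := fun l => if l ≠ j ∧ i ∈ net.N l then net.flow ρ σ l - net.load l else 0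
    with hf
  have hprim : ∀ l ∈ net.primary, -(u / (2 * J)) ≤ f l := by
    intro l hlp
    simp only [hf]
    split_ifs with h
    · by_cases hlσ : l ∈ σ
      · rw [flow_primary_of_mem σ hρ hlp (hns l h.1 h.2) hlσ, ← hu_def, add_sub_cancel_left]
        have : 0 < 2 ^ (m + 2) * u := by positivity
        have : 0 < u / (2 * J) := by positivity
        linarith
      · rw [flow_primary_of_notMem σ hρ hlp (hns l h.1 h.2) hlσ]
        linarith
    · have : 0 < u / (2 * J) := by positivity
      linarith
  -- The deficits of all primary job types that are not stocked add up to at most half a unit,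
  -- thanks to the divisor `2 J`.
  have hcard : ∀ s : Finset (Fin J), -(u / 2) ≤ ∑ _l ∈ s, -(u / (2 * J)) := by
    intro s
    rw [Finset.sum_const, nsmul_eq_mul]
    have h1 : (s.card : ℝ) ≤ J := by exact_mod_cast (by simpa using Finset.card_le_univ s)
    have h2 : (s.card : ℝ) * (u / (2 * J)) ≤ J * (u / (2 * J)) := by gcongr
    have h3 : (J : ℝ) * (u / (2 * J)) = u / 2 := by field_simp
    linarith
  have hrank : ∀ k : Fin m, -(2 ^ ((k : ℕ) + 1) * u) ≤ f (ρ k) := by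
    intro k
    simp only [hf]
    split_ifs
    · exact (abs_le.1 (abs_flow_rank_sub_le σ hl hρ k)).1
    · have : 0 < 2 ^ ((k : ℕ) + 1) * u := by positivity
      linarith
  rw [Finset.sum_filter, sum_eq_sum_primary_add_sum_rank hρ (f := f)]
  swap
  · intro l hls
    simp only [hf]
    rw [if_neg]
    exact fun h => hns l h.1 h.2 hls
  obtain ⟨l₀, hl₀σ, hil₀⟩ := hi
  have hl₀j : l₀ ≠ j := fun h => hjσ (h ▸ hl₀σ)
  -- A stocked primary job type gains `2 ^ (m + 2)` units. The ranked job types lose at most `2 ^ (m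
  -- + 1) - 2` units and the other primary ones half a unit.
  by_cases hA : ∃ l ∈ net.primary, l ∈ σ ∧ i ∈ net.N l
  · obtain ⟨l, hlp, hlσ, hil⟩ := hA
    have hlj : l ≠ j := fun h => hjσ (h ▸ hlσ)
    have h1 : 2 ^ (m + 2) * u - u / 2 ≤ ∑ l with l ∈ net.primary, f l := by
      rw [← Finset.add_sum_erase _ f (show l ∈ Finset.univ.filter (· ∈ net.primary) by simpa)]
      have h2 : f l = 2 ^ (m + 2) * u := by
        simp only [hf]
        rw [if_pos ⟨hlj, hil⟩, flow_primary_of_mem σ hρ hlp (hns l hlj hil) hlσ,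
          add_sub_cancel_left]
      have h3 := hcard ((Finset.univ.filter (· ∈ net.primary)).erase l)
      have h4 : ∑ _l ∈ (Finset.univ.filter (· ∈ net.primary)).erase l, -(u / (2 * J))
          ≤ ∑ l ∈ (Finset.univ.filter (· ∈ net.primary)).erase l, f l :=
        Finset.sum_le_sum fun l' hl' => hprim l' (by simpa using (Finset.mem_of_mem_erase hl'))
      linarith
    have h2 : -((2 ^ (m + 1) - 2) * u) ≤ ∑ k, f (ρ k) := by
      have h3 : ∑ k : Fin m, (2 : ℝ) ^ ((k : ℕ) + 1) = 2 ^ (m + 1) - 2 := by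
        rw [Fin.sum_univ_eq_sum_range (fun k => (2 : ℝ) ^ (k + 1)) m]
        exact sum_range_two_pow_succ m
      rw [← h3, Finset.sum_mul, ← Finset.sum_neg_distrib]
      exact Finset.sum_le_sum fun k _ => hrank k
    have h3 : (2 : ℝ) ^ (m + 2) * u = 2 * (2 ^ (m + 1) * u) := by ring
    have h4 : 0 < 2 ^ (m + 1) * u := by positivity
    linarith
  · push Not at hA
    have hne : (Finset.univ.filter fun k => ρ k ∈ σ ∧ i ∈ net.N (ρ k)).Nonempty := by
      rcases (single_or_primary_or_mem_range hρ l₀).resolve_left (hns l₀ hl₀j hil₀) with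
        h | ⟨k, rfl⟩
      · exact absurd hil₀ (hA l₀ h hl₀σ)
      · exact ⟨k, by simp [hl₀σ, hil₀]⟩
    -- Let `ρ k` be the stocked job type of largest rank at `i`. It gains `2 ^ (k + 1)` units; the
    -- smaller ranks lose at most `2 ^ (k + 1) - 2`, the larger ranks, not being stocked, at most
    -- one half, and the primary job types at most one half. At least one unit is left.
    obtain ⟨k, hk, hkmax⟩ := Finset.exists_max_image _ id hne
    simp only [Finset.mem_filter, Finset.mem_univ, true_and, id] at hk hkmax
    have hzeta : ∀ l, k ≤ l → ¬ (net.zeta ρ i l ∩ σ).Nonempty := by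
      rintro l hkl ⟨l', ⟨hil', hl'ρ⟩, hl'σ⟩
      rcases single_or_primary_or_mem_range hρ l' with h | h | ⟨n, rfl⟩
      · exact hjσ (eq_of_mem_single hnet h hj hil' hij ▸ hl'σ)
      · exact hA l' h hl'σ hil'
      · exact hl'ρ ⟨n, (hkmax n ⟨hl'σ, hil'⟩).trans hkl, rfl⟩
    have hkf : f (ρ k) = 2 ^ ((k : ℕ) + 1) * u := by
      simp only [hf]
      rw [if_pos ⟨fun h => hjσ (h ▸ hk.1), hk.2⟩, flow_rank_of_mem σ hρ
        (fun h => hzeta k le_rfl (h i hk.2)) hk.1, add_sub_cancel_left]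
    have hgt : ∀ l, k < l → -((1 / 2) ^ ((l : ℕ) + 1) * u) ≤ f (ρ l) := by
      intro l hkl
      simp only [hf]
      split_ifs with h
      · rw [flow_rank_of_notMem σ hρ (fun h' => hzeta l hkl.le (h' i h.2))
          (fun h' => absurd (hkmax l ⟨h', h.2⟩) (not_le.2 hkl))]
        linarith
      · have : 0 < (1 / 2) ^ ((l : ℕ) + 1) * u := by positivity
        linarith
    have hsplit : ∑ l, f (ρ l)
        = ∑ l ∈ Finset.Iio k, f (ρ l) + (f (ρ k) + ∑ l ∈ Finset.Ioi k, f (ρ l)) := by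
      rw [← Finset.sum_filter_add_sum_filter_not Finset.univ (fun l => l < k)]
      congr 1
      · exact Finset.sum_congr (by ext; simp) fun _ _ => rfl
      · rw [← Finset.sum_insert (s := Finset.Ioi k) (a := k) (f := fun l => f (ρ l)) (by simp)]
        refine Finset.sum_congr ?_ fun _ _ => rfl
        ext l
        simp [le_iff_eq_or_lt]
    have h1 : -((2 ^ ((k : ℕ) + 1) - 2) * u) ≤ ∑ l ∈ Finset.Iio k, f (ρ l) := by
      rw [← Fin.sum_Iio_two_pow_succ k, Finset.sum_mul, ← Finset.sum_neg_distrib]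
      exact Finset.sum_le_sum fun l _ => hrank l
    have h2 : -(u / 2) ≤ ∑ l ∈ Finset.Ioi k, f (ρ l) := by
      have h3 : ∑ l ∈ Finset.Ioi k, -((1 / 2 : ℝ) ^ ((l : ℕ) + 1) * u)
          ≤ ∑ l ∈ Finset.Ioi k, f (ρ l) :=
        Finset.sum_le_sum fun l hkl => hgt l (by simpa using hkl)
      rw [Finset.sum_neg_distrib, ← Finset.sum_mul] at h3
      have h4 := (Fin.sum_Ioi_two_inv_pow_lt k).le.trans
        (pow_le_one₀ (by norm_num : (0 : ℝ) ≤ 1 / 2) (by norm_num))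
      have h5 : ∑ l ∈ Finset.Ioi k, (1 / 2 : ℝ) ^ ((l : ℕ) + 1)
          = (∑ l ∈ Finset.Ioi k, (1 / 2 : ℝ) ^ (l : ℕ)) / 2 := by
        rw [Finset.sum_div]
        exact Finset.sum_congr rfl fun l _ => by ring
      rw [h5] at h3
      have h6 := mul_le_mul_of_nonneg_right h4 hu.le
      linarith
    have h3 : -(u / 2) ≤ ∑ l with l ∈ net.primary, f l :=
      (hcard _).trans (Finset.sum_le_sum fun l hl' => hprim l (by simpa using hl'))
    rw [hsplit, hkf]
    linarith

/-- A job type that is not stocked gets less than its traffic intensity. -/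
lemma exists_flow_le_of_notMem (hnet : net.IsLocalTraffic) (hl : ∀ j, 0 < net.load j)
    (hcap : net.C = net.K *ᵥ net.load) (hρ : net.IsViableRanking ρ) :
    ∃ c > 0, ∀ (σ : Set (Fin J)) (j : Fin J), j ∉ σ → net.flow ρ σ j ≤ net.load j - c := by
  classical
  rcases J.eq_zero_or_pos with rfl | hJ
  · exact ⟨1, one_pos, fun _ j => j.elim0⟩
  have hu := rateUnit_pos (net := net) ⟨0, hJ⟩ hl m
  have hJ' : (1 : ℝ) ≤ J := by exact_mod_cast hJ
  have hle : ∀ n, (1 / 2 : ℝ) ^ n * net.rateUnit m ≤ net.rateUnit m := fun n =>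
    mul_le_of_le_one_left hu.le (pow_le_one₀ (by norm_num) (by norm_num))
  -- This is below all possible deficits: at least one unit in `single`, `1 / (2 J)` units for
  -- primary and at least `(1 / 2) ^ (m + 1)` units for ranked job types.
  refine ⟨(1 / 2) ^ (m + 1) * net.rateUnit m / (2 * J), by positivity, fun σ j hj => ?_⟩
  have h1 : (1 / 2) ^ (m + 1) * net.rateUnit m / (2 * J) ≤ (1 / 2) ^ (m + 1) * net.rateUnit m :=
    div_le_self (by positivity) (by linarith)
  have h2 : (1 / 2) ^ (m + 1) * net.rateUnit m / (2 * J) ≤ net.rateUnit m / (2 * J) :=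
    div_le_div_of_nonneg_right (hle _) (by positivity)
  have h3 := hle (m + 1)
  by_cases hs : j ∈ net.single
  · obtain ⟨i, hij⟩ := hnet.nonempty j
    by_cases hi : i ∈ net.busy σ
    · rw [flow_single_of_mem_busy σ hnet hcap hij hi]
      have := rateUnit_le_sum_flow_sub_load σ hnet hl hρ hs hj hij hi
      linarith
    · rw [flow_single_of_notMem_busy σ hs hij hi]
      have : net.rateUnit m ≤ net.delta := by
        rw [delta_eq m]; exact le_mul_of_one_le_left hu.le (one_le_pow₀ (by norm_num))
      linarith
  · rcases (single_or_primary_or_mem_range hρ j).resolve_left hs with hp | ⟨k, rfl⟩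
    · rw [flow_primary_of_notMem σ hρ hp hs hj]
      linarith
    · have := flow_rank_le_of_notMem σ hl hρ hj
      linarith

open Classical in
/-- If every resource of `ρ k` has a stocked job type outside `ρ 0, ..., ρ k`, then at each of these
resources such job types get together more than their traffic intensities. -/
lemma rateUnit_le_sum_zeta (hnet : net.IsLocalTraffic) (hl : ∀ j, 0 < net.load j)
    (hcap : net.C = net.K *ᵥ net.load) (hρ : net.IsViableRanking ρ) {k : Fin m}
    (h : ∀ i ∈ net.N (ρ k), (net.zeta ρ i k ∩ σ).Nonempty) {i : Fin I} (hi : i ∈ net.N (ρ k)) :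
    net.rateUnit m ≤ ∑ j with j ∈ net.zeta ρ i k, (net.flow ρ σ j - net.load j) := by
  have hu := rateUnit_pos (ρ k) hl m
  have hbusy : i ∈ net.busy σ := by
    obtain ⟨j, hj, hjσ⟩ := h i hi
    exact ⟨j, hjσ, hj.1⟩
  -- At a busy resource the deviations cancel. Here `ρ k` loses `2 ^ (k + 1)` units and the smaller
  -- ranks gain at most `2 ^ (k + 1) - 2`, which leaves at least two units to `ζ_i^k`.
  have h0 := sum_flow_sub_load_eq_zero (ρ := ρ) σ hnet hcap hbusy
  set D : Fin J → ℝ := fun j => net.flow ρ σ j - net.load j with hD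
  have h1 : ∑ j with i ∈ net.N j, D j = ∑ j with j ∈ net.zeta ρ i k, D j
      + ∑ l ∈ Finset.Iic k, if i ∈ net.N (ρ l) then D (ρ l) else 0 := by
    rw [← Finset.sum_filter_add_sum_filter_not (Finset.univ.filter fun j => i ∈ net.N j)
      (fun j => j ∉ ρ '' {l | l ≤ k}), Finset.filter_filter, Finset.filter_filter]
    congr 1
    · exact Finset.sum_congr (by ext; simp [zeta]) fun _ _ => rfl
    rw [← Finset.sum_image (s := Finset.Iic k) (g := ρ)
      (f := fun j => if i ∈ net.N j then D j else 0) (fun a _ b _ h => hρ.injective h),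
      ← Finset.sum_filter]
    refine Finset.sum_congr ?_ fun _ _ => rfl
    ext j
    simp only [Finset.mem_filter, Finset.mem_univ, true_and, Finset.mem_image, Finset.mem_Iic,
      not_not, Set.mem_image, Set.mem_ofPred_eq]
    exact and_comm
  have h2 : ∑ l ∈ Finset.Iic k, (if i ∈ net.N (ρ l) then D (ρ l) else 0) ≤
      -(2 * net.rateUnit m) := by
    rw [← Finset.Iio_insert, Finset.sum_insert (by simp), if_pos hi]
    have h3 : D (ρ k) = -(2 ^ ((k : ℕ) + 1) * net.rateUnit m) := by
      simp only [hD]; rw [flow_rank_of_forall σ hρ h]; ring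
    have h4 : ∑ l ∈ Finset.Iio k, (if i ∈ net.N (ρ l) then D (ρ l) else 0)
        ≤ (2 ^ ((k : ℕ) + 1) - 2) * net.rateUnit m := by
      rw [← Fin.sum_Iio_two_pow_succ k, Finset.sum_mul]
      refine Finset.sum_le_sum fun l _ => ?_
      split_ifs
      · exact (abs_le.1 (abs_flow_rank_sub_le σ hl hρ l)).2
      · positivity
    rw [h3]
    linarith
  linarith

end Flow

end Network

/-! ### Sequences of exponential waiting times and memorylessness -/

section SingleClock

/-- The sequence with first entry `x` and further entries `y`. -/
def consSeq (x : ℝ) (y : ℕ → ℝ) : ℕ → ℝ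
  | 0 => x
  | n + 1 => y n

/-- The sequence without its first entry. -/
def shiftSeq (y : ℕ → ℝ) (n : ℕ) : ℝ := y (n + 1)

/-- The sequence with `a` subtracted from its first entry. -/
def ageSeq (a : ℝ) (y : ℕ → ℝ) : ℕ → ℝ := consSeq (y 0 - a) (shiftSeq y)

lemma measurable_consSeq : Measurable fun p : ℝ × (ℕ → ℝ) => consSeq p.1 p.2 := by
  refine measurable_pi_iff.2 fun n => ?_
  cases n with
  | zero => exact measurable_fst
  | succ n => exact (measurable_pi_apply n).comp measurable_snd

lemma measurable_shiftSeq : Measurable shiftSeq :=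
  measurable_pi_iff.2 fun n => measurable_pi_apply (n + 1)

lemma measurable_ageSeq : Measurable fun p : ℝ × (ℕ → ℝ) => ageSeq p.1 p.2 := by
  refine measurable_consSeq.comp (Measurable.prodMk ?_ (measurable_shiftSeq.comp measurable_snd))
  exact ((measurable_pi_apply 0).comp measurable_snd).sub measurable_fst

lemma consSeq_shiftSeq (y : ℕ → ℝ) : consSeq (y 0) (shiftSeq y) = y := by
  ext n; cases n <;> rfl

/-- The law of a sequence of independent exponential random variables. -/
noncomputable def expSeq (θ : ℝ) : Measure (ℕ → ℝ) := Measure.infinitePi fun _ => expMeasure θ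

variable {θ : ℝ}

lemma isProbabilityMeasure_expSeq (hθ : 0 < θ) : IsProbabilityMeasure (expSeq θ) := by
  have := isProbabilityMeasure_expMeasure hθ
  unfold expSeq
  infer_instance

/-- A cylinder set may be described by conditions on an initial segment of indices; prepending an
entry splits off the factor at index `0`. -/
lemma map_consSeq (hθ : 0 < θ) :
    ((expMeasure θ).prod (expSeq θ)).map (fun p => consSeq p.1 p.2) = expSeq θ := by
  have := isProbabilityMeasure_expMeasure hθ
  have := isProbabilityMeasure_expSeq hθ
  refine Measure.eq_infinitePi _ fun s t ht => ?_
  classical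
  obtain ⟨n, hn⟩ : ∃ n, s ⊆ Finset.range (n + 1) :=
    ⟨s.sup id, fun i hi => Finset.mem_range.2 (Nat.lt_succ_of_le (Finset.le_sup (f := id) hi))⟩
  set t' : ℕ → Set ℝ := fun i => if i ∈ s then t i else Set.univ with ht'
  have ht'm : ∀ i, MeasurableSet (t' i) := fun i => by
    simp only [ht']; split_ifs; exacts [ht i, .univ]
  have h1 : Set.pi (s : Set ℕ) t = Set.pi (Finset.range (n + 1) : Set ℕ) t' := by
    ext x
    simp only [Set.mem_pi, Finset.mem_coe, ht']
    constructor
    · intro h i _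
      split_ifs with hi
      exacts [h i hi, trivial]
    · intro h i hi
      simpa [hi] using h i (hn hi)
  have h2 : ∏ i ∈ s, expMeasure θ (t i) = ∏ i ∈ Finset.range (n + 1), expMeasure θ (t' i) := by
    refine (Finset.prod_congr rfl fun i hi => ?_).trans (Finset.prod_subset hn fun i _ hi => ?_)
    · simp [ht', hi]
    · simp [ht', hi]
  rw [h1, h2, Measure.map_apply measurable_consSeq
    (.pi (Finset.countable_toSet _) fun i _ => ht'm i)]
  have h3 : (fun p : ℝ × (ℕ → ℝ) => consSeq p.1 p.2) ⁻¹'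
      (Set.pi (Finset.range (n + 1) : Set ℕ) t')
      = t' 0 ×ˢ Set.pi (Finset.range n : Set ℕ) fun i => t' (i + 1) := by
    ext ⟨x, y⟩
    simp only [Set.mem_preimage, Set.mem_pi, Finset.mem_coe, Finset.mem_range, Set.mem_prod]
    constructor
    · exact fun h => ⟨h 0 (by omega), fun i hi => h (i + 1) (by omega)⟩
    · rintro ⟨h0, h⟩ i hi
      cases i with
      | zero => exact h0
      | succ i => exact h i (by omega)
  rw [h3, Measure.prod_prod, expSeq, Measure.infinitePi_pi _ fun i _ => ht'm (i + 1),
    Finset.prod_range_succ', mul_comm]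

lemma lintegral_expSeq (hθ : 0 < θ) {F : ℝ → (ℕ → ℝ) → ℝ≥0∞}
    (hF : Measurable (Function.uncurry F)) :
    ∫⁻ y, F (y 0) (shiftSeq y) ∂expSeq θ = ∫⁻ x, ∫⁻ y, F x y ∂expSeq θ ∂expMeasure θ := by
  have := isProbabilityMeasure_expMeasure hθ
  have := isProbabilityMeasure_expSeq hθ
  have hm : Measurable fun y : ℕ → ℝ => F (y 0) (shiftSeq y) :=
    hF.comp ((measurable_pi_apply 0).prodMk measurable_shiftSeq)
  conv_lhs => rw [← map_consSeq hθ]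
  rw [lintegral_map hm measurable_consSeq]
  exact lintegral_prod _ hF.aemeasurable

lemma lintegral_expMeasure {f : ℝ → ℝ≥0∞} (hf : Measurable f) :
    ∫⁻ x, f x ∂expMeasure θ
      = ∫⁻ x in Set.Ioi 0, ENNReal.ofReal (θ * Real.exp (-(θ * x))) * f x := by
  have hm : Measurable (exponentialPDF θ) := (measurable_exponentialPDFReal θ).ennreal_ofReal
  have h : expMeasure θ = volume.withDensity (exponentialPDF θ) := rfl
  rw [h, lintegral_withDensity_eq_lintegral_mul _ hm hf, ← lintegral_indicator measurableSet_Ioi]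
  refine lintegral_congr_ae ?_
  filter_upwards [Measure.ae_ne volume (0 : ℝ)] with x hx
  rcases lt_or_gt_of_ne hx with h | h
  · simp [exponentialPDF_of_neg h, not_lt.2 h.le]
  · simp [exponentialPDF_of_nonneg h.le, Set.indicator_of_mem (Set.mem_Ioi.2 h)]

lemma setLIntegral_Ioi_comp_add (a : ℝ) (f : ℝ → ℝ≥0∞) :
    ∫⁻ x in Set.Ioi 0, f (x + a) = ∫⁻ x in Set.Ioi a, f x := by
  rw [← lintegral_indicator measurableSet_Ioi, ← lintegral_indicator measurableSet_Ioi,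
    ← lintegral_add_right_eq_self ((Set.Ioi a).indicator f) a]
  refine lintegral_congr fun x => ?_
  by_cases h : 0 < x <;> simp [Set.indicator, h]

lemma setLIntegral_Ioi_comp_div {v : ℝ} (hv : 0 < v) (f : ℝ → ℝ≥0∞) :
    ∫⁻ x in Set.Ioi 0, f (x / v) = ∫⁻ x in Set.Ioi 0, ENNReal.ofReal v * f x := by
  have h1 : Set.Ioi (0 : ℝ) = (fun x => v * x) '' Set.Ioi 0 := by
    rw [Set.image_mul_left_Ioi hv, mul_zero]
  conv_lhs => rw [h1]
  rw [lintegral_image_eq_lintegral_abs_deriv_mul measurableSet_Ioi (f' := fun _ => v)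
    (fun x _ => by simpa using ((hasDerivAt_id x).const_mul v).hasDerivWithinAt)
    (fun x _ y _ h => mul_left_cancel₀ hv.ne' h)]
  simp [abs_of_pos hv, hv.ne']

/-- Memorylessness: on the event that the first waiting time exceeds `a`, the density shifted by `a`
is `exp (-θ a)` times itself, and the later waiting times are not affected. -/
lemma map_ageSeq (hθ : 0 < θ) {a : ℝ} (ha : 0 ≤ a) :
    ((expSeq θ).restrict {y | a < y 0}).map (ageSeq a)
      = ENNReal.ofReal (Real.exp (-(θ * a))) • expSeq θ := by
  have := isProbabilityMeasure_expMeasure hθ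
  have := isProbabilityMeasure_expSeq hθ
  have hage : Measurable (ageSeq a) := measurable_ageSeq.comp (measurable_const.prodMk measurable_id)
  have hset : MeasurableSet {y : ℕ → ℝ | a < y 0} :=
    measurableSet_lt measurable_const (measurable_pi_apply 0)
  ext s hs
  rw [Measure.map_apply hage hs, Measure.restrict_apply (hage hs), Measure.smul_apply,
    smul_eq_mul, ← lintegral_indicator_one ((hage hs).inter hset), ← lintegral_indicator_one hs]
  set g : ℝ → ℝ≥0∞ := fun x => ∫⁻ y, s.indicator 1 (consSeq x y) ∂expSeq θ with hg
  have hind : Measurable (s.indicator (1 : (ℕ → ℝ) → ℝ≥0∞)) := measurable_one.indicator hs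
  have hgm : Measurable g := (hind.comp measurable_consSeq).lintegral_prod_right'
  have h1 : ∫⁻ y, (ageSeq a ⁻¹' s ∩ {y | a < y 0}).indicator 1 y ∂expSeq θ
      = ∫⁻ y, (fun x y => (Set.Ioi a).indicator 1 x * s.indicator 1 (consSeq (x - a) y))
          (y 0) (shiftSeq y) ∂expSeq θ := by
    refine lintegral_congr fun y => ?_
    by_cases h1 : a < y 0 <;> by_cases h2 : consSeq (y 0 - a) (shiftSeq y) ∈ s <;>
      simp [Set.indicator, h1, h2, ageSeq]
  rw [h1, lintegral_expSeq hθ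
    (F := fun x y => (Set.Ioi a).indicator 1 x * s.indicator 1 (consSeq (x - a) y))]
  swap
  · refine Measurable.mul ?_ ?_
    · exact (measurable_one.indicator measurableSet_Ioi).comp measurable_fst
    · exact hind.comp (measurable_consSeq.comp ((measurable_fst.sub_const a).prodMk measurable_snd))
  have h2 : ∀ x, ∫⁻ y, (Set.Ioi a).indicator 1 x * s.indicator 1 (consSeq (x - a) y) ∂expSeq θ
      = (Set.Ioi a).indicator 1 x * g (x - a) := fun x =>
    lintegral_const_mul _ (hind.comp (measurable_consSeq.comp measurable_prodMk_left))
  simp only [h2]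
  have hR : ∫⁻ y, s.indicator 1 y ∂expSeq θ = ∫⁻ x, g x ∂expMeasure θ := by
    rw [← lintegral_expSeq hθ (F := fun x y => s.indicator 1 (consSeq x y))
      (hind.comp measurable_consSeq)]
    simp only [consSeq_shiftSeq]
  rw [hR, lintegral_expMeasure hgm,
    lintegral_expMeasure (f := fun x => (Set.Ioi a).indicator 1 x * g (x - a)) ((measurable_one.indicator measurableSet_Ioi).mul (hgm.comp (measurable_id.sub_const a))),
    ← lintegral_const_mul _ (by fun_prop)]
  calc ∫⁻ x in Set.Ioi 0, ENNReal.ofReal (θ * Real.exp (-(θ * x)))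
        * ((Set.Ioi a).indicator 1 x * g (x - a))
      = ∫⁻ x in Set.Ioi a, ENNReal.ofReal (θ * Real.exp (-(θ * x))) * g (x - a) := by
        rw [← lintegral_indicator measurableSet_Ioi, ← lintegral_indicator measurableSet_Ioi]
        refine lintegral_congr fun x => ?_
        by_cases h : a < x
        · simp [Set.indicator, h, ha.trans_lt h]
        · simp [Set.indicator, h]
    _ = ∫⁻ x in Set.Ioi 0, ENNReal.ofReal (θ * Real.exp (-(θ * (x + a)))) * g (x + a - a) :=
        (setLIntegral_Ioi_comp_add a
          (fun x => ENNReal.ofReal (θ * Real.exp (-(θ * x))) * g (x - a))).symm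
    _ = _ := by
        refine lintegral_congr fun x => ?_
        rw [add_sub_cancel_right, ← mul_assoc, ← ENNReal.ofReal_mul (Real.exp_pos _).le]
        congr 2
        rw [mul_left_comm, ← Real.exp_add]
        congr 2
        ring

end SingleClock

section Product

variable {κ : Type*} [Fintype κ] {Y : Type*} [MeasurableSpace Y]
  {μ : κ → Measure Y}

/-- Resampling one coordinate preserves a product measure. This separates the winning clock from the
others in `lintegral_isWinner`. -/
lemma lintegral_pi_update [DecidableEq κ] [∀ c, IsProbabilityMeasure (μ c)] (c : κ) {F : (κ → Y) → ℝ≥0∞}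
    (hF : Measurable F) :
    ∫⁻ x, ∫⁻ y, F (Function.update x c y) ∂μ c ∂Measure.pi μ = ∫⁻ x, F x ∂Measure.pi μ := by
  have hm : Measurable fun p : (κ → Y) × Y => Function.update p.1 c p.2 := by
    refine measurable_pi_iff.2 fun l => ?_
    rcases eq_or_ne l c with rfl | h
    · simpa using measurable_snd
    · simp only [Function.update_of_ne h]
      exact (measurable_pi_apply l).comp measurable_fst
  have h : ((Measure.pi μ).prod (μ c)).map (fun p => Function.update p.1 c p.2)
      = Measure.pi μ := by
    refine (Measure.pi_eq fun s hs => ?_).symm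
    rw [Measure.map_apply hm (.univ_pi hs)]
    have h3 : (fun p : (κ → Y) × Y => Function.update p.1 c p.2) ⁻¹' Set.univ.pi s
        = (Set.univ.pi (Function.update s c Set.univ)) ×ˢ s c := by
      ext ⟨x, y⟩
      simp only [Set.mem_preimage, Set.mem_pi, Set.mem_univ, true_implies, Set.mem_prod]
      constructor
      · refine fun h => ⟨fun l => ?_, by simpa using h c⟩
        rcases eq_or_ne l c with rfl | hl
        · simp
        · simpa [hl] using h l
      · rintro ⟨h1, h2⟩ l
        rcases eq_or_ne l c with rfl | hl
        · simpa using h2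
        · simpa [hl] using h1 l
    rw [h3, Measure.prod_prod, Measure.pi_pi, ← Finset.mul_prod_erase _ _ (Finset.mem_univ c),
      ← Finset.mul_prod_erase _ (fun i => μ i (s i)) (Finset.mem_univ c)]
    simp only [Function.update_self, measure_univ, one_mul]
    rw [mul_comm]
    congr 1
    exact Finset.prod_congr rfl fun l hl => by simp [Finset.ne_of_mem_erase hl]
  conv_rhs => rw [← h]
  rw [lintegral_map hF hm, lintegral_prod (fun p => F (Function.update p.1 c p.2)) (hF.comp hm).aemeasurable]

/-- For the losing clocks, `s l` is survival up to a given time, `f l` is ageing, and `k l` is the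
survival probability. -/
lemma lintegral_pi_restrict_map [∀ c, IsProbabilityMeasure (μ c)] {s : κ → Set Y}
    (hs : ∀ l, MeasurableSet (s l)) {f : κ → Y → Y} (hf : ∀ l, Measurable (f l)) {k : κ → ℝ≥0∞}
    (hk : ∀ l, k l ≠ ∞) (h : ∀ l, ((μ l).restrict (s l)).map (f l) = k l • μ l)
    {G : (κ → Y) → ℝ≥0∞} (hG : Measurable G) :
    ∫⁻ x, (Set.univ.pi s).indicator (fun x => G fun l => f l (x l)) x ∂Measure.pi μ
      = (∏ l, k l) * ∫⁻ x, G x ∂Measure.pi μ := by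
  have hfin : ∀ l, IsFiniteMeasure (k l • μ l) := fun l => by
    refine ⟨?_⟩
    simpa using (hk l).lt_top
  have hfin' : ∀ l, IsFiniteMeasure (((μ l).restrict (s l)).map (f l)) := fun l => by
    rw [h l]; exact hfin l
  have hm : Measurable fun (x : κ → Y) l => f l (x l) :=
    measurable_pi_iff.2 fun l => (hf l).comp (measurable_pi_apply l)
  rw [lintegral_indicator (.univ_pi hs), Measure.restrict_pi_pi, ← lintegral_map hG hm,
    Measure.pi_map_pi fun l => (hf l).aemeasurable]
  simp only [h]
  have : Measure.pi (fun l => k l • μ l) = (∏ l, k l) • Measure.pi μ := by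
    refine Measure.pi_eq fun s _ => ?_
    simp [Measure.pi_pi, Finset.prod_mul_distrib]
  rw [this, lintegral_smul_measure, smul_eq_mul]

end Product

/-! ### Competing exponential clocks -/

section Clocks

variable {κ : Type*}

/-- The law of a family of independent Poisson clocks with rates `θ`, each given by the remaining
time until it rings and the further waiting times. -/
noncomputable def clockLaw [Fintype κ] (θ : κ → ℝ) : Measure (κ → ℕ → ℝ) := Measure.pi fun c => expSeq (θ c)

/-- If clock `l` runs at speed `v l`, then `c` is the first clock that rings. -/
def IsWinner (v : κ → ℝ) (y : κ → ℕ → ℝ) (c : κ) : Prop :=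
  0 < v c ∧ ∀ l, l ≠ c → v l * (y c 0 / v c) < y l 0

open Classical in
/-- The clocks after clock `c` has rung. -/
noncomputable def advance (v : κ → ℝ) (y : κ → ℕ → ℝ) (c : κ) : κ → ℕ → ℝ := fun l =>
  if l = c then shiftSeq (y c) else ageSeq (v l * (y c 0 / v c)) (y l)

/-- The inequalities are strict, so each of two winners would ring before the other. -/
lemma IsWinner.unique {v : κ → ℝ} {y : κ → ℕ → ℝ} {c c' : κ} (h : IsWinner v y c)
    (h' : IsWinner v y c') : c = c' := by
  by_contra hne
  have h1 := h.2 c' (Ne.symm hne)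
  have h2 := h'.2 c hne
  have h3 : y c' 0 = v c' * (y c' 0 / v c') := by field_simp [h'.1.ne']
  have h4 : y c 0 = v c * (y c 0 / v c) := by field_simp [h.1.ne']
  rw [h3] at h1
  rw [h4] at h2
  have h5 := lt_of_mul_lt_mul_left h1 h'.1.le
  have h6 := lt_of_mul_lt_mul_left h2 h.1.le
  exact lt_asymm h5 h6

lemma measurableSet_isWinner [Fintype κ] (v : κ → ℝ) (c : κ) : MeasurableSet {y | IsWinner v y c} := by
  have h : ∀ l, Measurable fun y : κ → ℕ → ℝ => y l 0 := fun l =>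
    (measurable_pi_apply 0).comp (measurable_pi_apply l)
  simp only [IsWinner, Set.ofPred_and, Set.ofPred_forall]
  refine MeasurableSet.inter (by simp) (MeasurableSet.iInter fun l => MeasurableSet.iInter fun _ =>
    measurableSet_lt (((h c).div_const _).const_mul _) (h l))

lemma measurable_advance (v : κ → ℝ) (c : κ) : Measurable fun y => advance v y c := by
  classical
  have h : ∀ l, Measurable fun y : κ → ℕ → ℝ => y l 0 := fun l =>
    (measurable_pi_apply 0).comp (measurable_pi_apply l)
  refine measurable_pi_iff.2 fun l => ?_
  simp only [advance]
  split_ifs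
  · exact measurable_shiftSeq.comp (measurable_pi_apply c)
  · exact measurable_ageSeq.comp
      ((((h c).div_const _).const_mul _).prodMk (measurable_pi_apply l))

variable [Fintype κ] {θ : κ → ℝ} {v : κ → ℝ}

lemma isProbabilityMeasure_clockLaw (hθ : ∀ c, 0 < θ c) :
    IsProbabilityMeasure (clockLaw θ) := by
  have := fun c => isProbabilityMeasure_expSeq (hθ c)
  unfold clockLaw
  infer_instance

/-- The joint law of the ringing time and of the clocks after clock `c` has rung first. -/
lemma lintegral_isWinner (hθ : ∀ c, 0 < θ c) (hv : ∀ l, 0 ≤ v l) {c : κ} (hc : 0 < v c)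
    {F : ℝ → (κ → ℕ → ℝ) → ℝ≥0∞} (hF : Measurable (Function.uncurry F)) :
    ∫⁻ y, {y | IsWinner v y c}.indicator (fun y => F (y c 0 / v c) (advance v y c)) y ∂clockLaw θ
      = ∫⁻ t in Set.Ioi 0, ENNReal.ofReal (θ c * v c * Real.exp (-((∑ l, θ l * v l) * t)))
          * ∫⁻ y, F t y ∂clockLaw θ := by
  classical
  have hP := fun c => isProbabilityMeasure_expSeq (hθ c)
  have hP' := isProbabilityMeasure_clockLaw hθ
  -- Here `t` is the ringing time, `y` the continuation of the winning clock, and `x` contains the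
  -- other clocks, which have to survive until `t`.
  set H : ℝ → (ℕ → ℝ) → (κ → ℕ → ℝ) → ℝ≥0∞ := fun t y x =>
    {x : κ → ℕ → ℝ | ∀ l, l ≠ c → v l * t < x l 0}.indicator
      (fun x => F t fun l => if l = c then y else ageSeq (v l * t) (x l)) x with hH
  have h00 : ∀ l, Measurable fun y : κ → ℕ → ℝ => y l 0 := fun l =>
    (measurable_pi_apply 0).comp (measurable_pi_apply l)
  have hHm : Measurable fun p : ℝ × (ℕ → ℝ) × (κ → ℕ → ℝ) => H p.1 p.2.1 p.2.2 := by
    have hset : MeasurableSet {p : ℝ × (ℕ → ℝ) × (κ → ℕ → ℝ) |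
        ∀ l, l ≠ c → v l * p.1 < p.2.2 l 0} := by
      simp only [Set.ofPred_forall]
      refine MeasurableSet.iInter fun l => MeasurableSet.iInter fun _ => measurableSet_lt
        (measurable_fst.const_mul _) ((h00 l).comp measurable_snd.snd)
    have hfun : Measurable fun p : ℝ × (ℕ → ℝ) × (κ → ℕ → ℝ) =>
        F p.1 fun l => if l = c then p.2.1 else ageSeq (v l * p.1) (p.2.2 l) := by
      have hx : ∀ l, Measurable fun p : ℝ × (ℕ → ℝ) × (κ → ℕ → ℝ) => p.2.2 l := fun l =>
        (measurable_pi_apply l).comp measurable_snd.snd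
      have hy : Measurable fun p : ℝ × (ℕ → ℝ) × (κ → ℕ → ℝ) => p.2.1 := measurable_snd.fst
      have ha : ∀ l, Measurable fun p : ℝ × (ℕ → ℝ) × (κ → ℕ → ℝ) =>
          ageSeq (v l * p.1) (p.2.2 l) := fun l =>
        measurable_ageSeq.comp ((measurable_fst.const_mul (v l)).prodMk (hx l))
      exact hF.comp (measurable_fst.prodMk (measurable_pi_iff.2 fun l =>
        Measurable.ite (MeasurableSet.const (l = c)) hy (ha l)))
    exact hfun.indicator hset
  have hFw : Measurable fun y => {y | IsWinner v y c}.indicator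
      (fun y => F (y c 0 / v c) (advance v y c)) y :=
    (hF.comp (((h00 c).div_const _).prodMk (measurable_advance v c))).indicator
      (measurableSet_isWinner v c)
  have hFt : ∀ t, Measurable (F t) := fun t => hF.comp measurable_prodMk_left
  -- replace the clock `c`
  have h1 : ∀ x : κ → ℕ → ℝ, ∀ y : ℕ → ℝ, {y | IsWinner v y c}.indicator
      (fun y => F (y c 0 / v c) (advance v y c)) (Function.update x c y)
      = H (y 0 / v c) (shiftSeq y) x := by
    intro x y
    have e1 : Function.update x c y ∈ {y | IsWinner v y c}
        ↔ x ∈ {x : κ → ℕ → ℝ | ∀ l, l ≠ c → v l * (y 0 / v c) < x l 0} := by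
      simp only [Set.mem_ofPred_eq, IsWinner, hc, true_and, Function.update_self]
      refine forall_congr' fun l => imp_congr_right fun hl => ?_
      rw [Function.update_of_ne hl]
    have e2 : advance v (Function.update x c y) c
        = fun l => if l = c then shiftSeq y else ageSeq (v l * (y 0 / v c)) (x l) := by
      ext1 l
      by_cases hl : l = c
      · simp [advance, hl]
      · simp [advance, hl]
    simp only [hH, Set.indicator, e1, e2, Function.update_self]
  -- For fixed `t` each losing clock contributes its survival probability `exp (-(θ l * v l * t))`
  -- and starts afresh.
  have h2 : ∀ t y, 0 < t → ∫⁻ x, H t y x ∂clockLaw θ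
      = ENNReal.ofReal (Real.exp (-((∑ l ∈ Finset.univ.erase c, θ l * v l) * t)))
        * ∫⁻ x, F t (Function.update x c y) ∂clockLaw θ := by
    intro t y ht
    have hupd : Measurable fun x : κ → ℕ → ℝ => Function.update x c y :=
      measurable_pi_iff.2 fun l => by
        by_cases hl : l = c
        · subst hl; simp
        · simp only [Function.update_of_ne hl]; exact measurable_pi_apply l
    have key := lintegral_pi_restrict_map (μ := fun c => expSeq (θ c))
      (s := fun l => if l = c then Set.univ else {y | v l * t < y 0})
      (fun l => by
        split_ifs
        exacts [.univ, measurableSet_lt measurable_const (measurable_pi_apply 0)])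
      (f := fun l => if l = c then id else ageSeq (v l * t))
      (fun l => by
        split_ifs
        exacts [measurable_id, measurable_ageSeq.comp (measurable_const.prodMk measurable_id)])
      (k := fun l => if l = c then 1 else ENNReal.ofReal (Real.exp (-(θ l * (v l * t)))))
      (fun l => by split_ifs <;> simp)
      (fun l => by
        split_ifs
        · simp
        · exact map_ageSeq (hθ l) (mul_nonneg (hv l) ht.le))
      (G := fun x => F t (Function.update x c y)) ((hFt t).comp hupd)
    have hprod : (∏ l, if l = c then 1 else ENNReal.ofReal (Real.exp (-(θ l * (v l * t)))))
        = ENNReal.ofReal (Real.exp (-((∑ l ∈ Finset.univ.erase c, θ l * v l) * t))) := by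
      rw [← Finset.mul_prod_erase _ _ (Finset.mem_univ c), if_pos rfl, one_mul, Finset.sum_mul,
        ← Finset.sum_neg_distrib, Real.exp_sum, ENNReal.ofReal_prod_of_nonneg
          fun _ _ => (Real.exp_pos _).le]
      refine Finset.prod_congr rfl fun l hl => ?_
      rw [if_neg (Finset.ne_of_mem_erase hl), mul_assoc]
    rw [hprod] at key
    rw [clockLaw, ← key]
    refine lintegral_congr fun x => ?_
    have e1 : x ∈ {x : κ → ℕ → ℝ | ∀ l, l ≠ c → v l * t < x l 0}
        ↔ x ∈ Set.univ.pi fun l => if l = c then Set.univ else {y : ℕ → ℝ | v l * t < y 0} := by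
      simp only [Set.mem_ofPred_eq, Set.mem_pi, Set.mem_univ, true_implies]
      refine forall_congr' fun l => ?_
      by_cases hl : l = c <;> simp [hl]
    have e2 : (Function.update (fun l => (if l = c then id else ageSeq (v l * t)) (x l)) c y)
        = fun l => if l = c then y else ageSeq (v l * t) (x l) := by
      ext1 l
      by_cases hl : l = c
      · subst hl; simp
      · simp [hl]
    simp only [hH, Set.indicator, e1, e2]
  have hgm : Measurable fun t => ∫⁻ y, ∫⁻ x, H t y x ∂clockLaw θ ∂expSeq (θ c) := by
    have : Measurable fun p : ℝ × (ℕ → ℝ) => ∫⁻ x, H p.1 p.2 x ∂clockLaw θ := by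
      have e : Measurable fun q : (ℝ × (ℕ → ℝ)) × (κ → ℕ → ℝ) => H q.1.1 q.1.2 q.2 :=
        hHm.comp (measurable_fst.fst.prodMk (measurable_fst.snd.prodMk measurable_snd))
      exact e.lintegral_prod_right'
    exact this.lintegral_prod_right'
  calc ∫⁻ y, {y | IsWinner v y c}.indicator
        (fun y => F (y c 0 / v c) (advance v y c)) y ∂clockLaw θ
      = ∫⁻ x, ∫⁻ y, H (y 0 / v c) (shiftSeq y) x ∂expSeq (θ c) ∂clockLaw θ := by
        rw [clockLaw, ← lintegral_pi_update c hFw]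
        simp only [h1]
    _ = ∫⁻ y, ∫⁻ x, H (y 0 / v c) (shiftSeq y) x ∂clockLaw θ ∂expSeq (θ c) := by
        rw [lintegral_lintegral_swap]
        refine Measurable.aemeasurable ?_
        refine hHm.comp (((measurable_pi_apply 0).comp measurable_snd |>.div_const _).prodMk
          ((measurable_shiftSeq.comp measurable_snd).prodMk measurable_fst))
    _ = ∫⁻ s, ∫⁻ y, ∫⁻ x, H (s / v c) y x ∂clockLaw θ ∂expSeq (θ c) ∂expMeasure (θ c) := by
        refine lintegral_expSeq (hθ c)
          (F := fun s y => ∫⁻ x, H (s / v c) y x ∂clockLaw θ) ?_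
        have e : Measurable fun q : (ℝ × (ℕ → ℝ)) × (κ → ℕ → ℝ) => H (q.1.1 / v c) q.1.2 q.2 :=
          hHm.comp ((measurable_fst.fst.div_const _).prodMk
            (measurable_fst.snd.prodMk measurable_snd))
        exact e.lintegral_prod_right'
    -- The winning clock runs at speed `v c`, so its own time is `s = v c * t`.
    _ = ∫⁻ s in Set.Ioi 0, (fun t => ENNReal.ofReal (θ c * Real.exp (-(θ c * v c * t)))
          * ∫⁻ y, ∫⁻ x, H t y x ∂clockLaw θ ∂expSeq (θ c)) (s / v c) := by
        rw [lintegral_expMeasure (f := fun s => ∫⁻ y, ∫⁻ x, H (s / v c) y x ∂clockLaw θ ∂expSeq (θ c))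
          (hgm.comp (measurable_id.div_const (v c)))]
        refine lintegral_congr fun s => ?_
        simp only
        congr 5
        field_simp
    _ = ∫⁻ t in Set.Ioi 0, ENNReal.ofReal (v c) *
          (ENNReal.ofReal (θ c * Real.exp (-(θ c * v c * t)))
          * ∫⁻ y, ∫⁻ x, H t y x ∂clockLaw θ ∂expSeq (θ c)) :=
        setLIntegral_Ioi_comp_div hc fun t => ENNReal.ofReal (θ c * Real.exp (-(θ c * v c * t)))
          * ∫⁻ y, ∫⁻ x, H t y x ∂clockLaw θ ∂expSeq (θ c)
    _ = _ := by
        refine setLIntegral_congr_fun measurableSet_Ioi fun t ht => ?_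
        have e1 : ∫⁻ y, ∫⁻ x, H t y x ∂clockLaw θ ∂expSeq (θ c)
            = ENNReal.ofReal (Real.exp (-((∑ l ∈ Finset.univ.erase c, θ l * v l) * t)))
              * ∫⁻ y, F t y ∂clockLaw θ := by
          simp only [h2 t _ ht]
          have hupd2 : Measurable fun p : (ℕ → ℝ) × (κ → ℕ → ℝ) =>
              F t (Function.update p.2 c p.1) := by
            refine (hFt t).comp (measurable_pi_iff.2 fun l => ?_)
            by_cases hl : l = c
            · subst hl; simpa using measurable_fst
            · simp only [Function.update_of_ne hl]
              exact (measurable_pi_apply l).comp measurable_snd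
          rw [lintegral_const_mul _ hupd2.lintegral_prod_right',
            lintegral_lintegral_swap hupd2.aemeasurable, clockLaw, lintegral_pi_update c (hFt t)]
        rw [e1, ← mul_assoc, ← mul_assoc, ← ENNReal.ofReal_mul hc.le, ← ENNReal.ofReal_mul
          (mul_nonneg hc.le (mul_nonneg (hθ c).le (Real.exp_pos _).le))]
        congr 2
        rw [← Finset.add_sum_erase _ _ (Finset.mem_univ c), add_mul, neg_add, Real.exp_add]
        ring

end Clocks

/-! ### Jump processes driven by exponential clocks -/

section JumpProcess

variable {κ S : Type*}

open Classical in
/-- The first clock that rings, if there is one. -/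
noncomputable def winner (v : κ → ℝ) (y : κ → ℕ → ℝ) : Option κ :=
  if h : ∃ c, IsWinner v y c then some h.choose else none

lemma IsWinner.winner_eq {v : κ → ℝ} {y : κ → ℕ → ℝ} {c : κ} (h : IsWinner v y c) :
    winner v y = some c := by
  have h' : ∃ c, IsWinner v y c := ⟨c, h⟩
  rw [winner, dif_pos h', h'.choose_spec.unique h]

lemma winner_eq_some_iff {v : κ → ℝ} {y : κ → ℕ → ℝ} {c : κ} :
    winner v y = some c ↔ IsWinner v y c := by
  refine ⟨fun h => ?_, IsWinner.winner_eq⟩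
  rw [winner] at h
  split_ifs at h with h'
  exact Option.some_injective _ h ▸ h'.choose_spec

/-- The time until the next jump, for a state and clocks. In the state `s`, clock `c` runs at speed
`v s c`. -/
noncomputable def holdTime (v : S → κ → ℝ) (z : S × (κ → ℕ → ℝ)) : ℝ :=
  match winner (v z.1) z.2 with
  | some c => z.2 c 0 / v z.1 c
  | none => 0

/-- The state and the clocks after the next jump. When clock `c` rings in the state `s`, the process
jumps to `jump s c`. -/
noncomputable def chainStep (v : S → κ → ℝ) (jump : S → κ → S) (z : S × (κ → ℕ → ℝ)) :
    S × (κ → ℕ → ℝ) :=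
  match winner (v z.1) z.2 with
  | some c => (jump z.1 c, advance (v z.1) z.2 c)
  | none => z

/-- The time of the `n`-th jump. -/
noncomputable def ringTime (v : S → κ → ℝ) (jump : S → κ → S) (n : ℕ)
    (z : S × (κ → ℕ → ℝ)) : ℝ :=
  ∑ k ∈ Finset.range n, holdTime v ((chainStep v jump)^[k] z)

variable {v : S → κ → ℝ} {jump : S → κ → S}

lemma IsWinner.holdTime_eq {z : S × (κ → ℕ → ℝ)} {c : κ} (h : IsWinner (v z.1) z.2 c) :
    holdTime v z = z.2 c 0 / v z.1 c := by
  rw [holdTime, h.winner_eq]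

lemma IsWinner.chainStep_eq {z : S × (κ → ℕ → ℝ)} {c : κ} (h : IsWinner (v z.1) z.2 c) :
    chainStep v jump z = (jump z.1 c, advance (v z.1) z.2 c) := by
  rw [chainStep, h.winner_eq]

lemma ringTime_zero (z : S × (κ → ℕ → ℝ)) : ringTime v jump 0 z = 0 := by simp [ringTime]

lemma ringTime_succ (n : ℕ) (z : S × (κ → ℕ → ℝ)) :
    ringTime v jump (n + 1) z = ringTime v jump n z + holdTime v ((chainStep v jump)^[n] z) :=
  Finset.sum_range_succ _ _

lemma ringTime_succ' (n : ℕ) (z : S × (κ → ℕ → ℝ)) :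
    ringTime v jump (n + 1) z = holdTime v z + ringTime v jump n (chainStep v jump z) := by
  rw [ringTime, Finset.sum_range_succ', add_comm]
  rfl

open Classical in
/-- The state at time `t` of the process that starts with `z`. -/
noncomputable def chainPath (v : S → κ → ℝ) (jump : S → κ → S) (z : S × (κ → ℕ → ℝ)) (t : ℝ) : S :=
  if h : ∃ n, t < ringTime v jump (n + 1) z then ((chainStep v jump)^[Nat.find h] z).1 else z.1

lemma monotone_ringTime {z : S × (κ → ℕ → ℝ)}
    (h0 : ∀ n, 0 ≤ holdTime v ((chainStep v jump)^[n] z)) :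
    Monotone fun n => ringTime v jump n z :=
  monotone_nat_of_le_succ fun n => by rw [ringTime_succ]; linarith [h0 n]

lemma chainPath_eq {z : S × (κ → ℕ → ℝ)}
    (h0 : ∀ n, 0 ≤ holdTime v ((chainStep v jump)^[n] z)) {n : ℕ} {t : ℝ}
    (h1 : ringTime v jump n z ≤ t) (h2 : t < ringTime v jump (n + 1) z) :
    chainPath v jump z t = ((chainStep v jump)^[n] z).1 := by
  classical
  have h : ∃ n, t < ringTime v jump (n + 1) z := ⟨n, h2⟩
  have hf : Nat.find h = n := by
    refine (Nat.find_eq_iff h).2 ⟨h2, fun m hm => ?_⟩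
    exact not_lt.2 ((monotone_ringTime h0 (show m + 1 ≤ n from hm)).trans h1)
  rw [chainPath, dif_pos h, hf]

/-- The costs up to time `t` or to the `n`-th jump, whichever comes first, if the running costs are
`f` and the final costs are `V`. -/
noncomputable def chainCost (v : S → κ → ℝ) (jump : S → κ → S) (V f : S → ℝ) :
    ℕ → ℝ × (S × (κ → ℕ → ℝ)) → ℝ≥0∞
  | 0, p => ENNReal.ofReal (V p.2.1)
  | n + 1, p =>
    if p.1 < holdTime v p.2 then ENNReal.ofReal (V p.2.1 + p.1 * f p.2.1)
    else ENNReal.ofReal (holdTime v p.2 * f p.2.1)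
      + chainCost v jump V f n (p.1 - holdTime v p.2, chainStep v jump p.2)

lemma setLIntegral_Ico_comp_add (h t : ℝ) (g : ℝ → ℝ≥0∞) :
    ∫⁻ s in Set.Ico 0 (t - h), g (s + h) = ∫⁻ s in Set.Ico h t, g s := by
  rw [← lintegral_indicator measurableSet_Ico, ← lintegral_indicator measurableSet_Ico,
    ← lintegral_add_right_eq_self ((Set.Ico h t).indicator g) h]
  refine lintegral_congr fun x => ?_
  have : x ∈ Set.Ico 0 (t - h) ↔ x + h ∈ Set.Ico h t := by
    simp only [Set.mem_Ico]
    constructor <;> rintro ⟨h1, h2⟩ <;> constructor <;> linarith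
  by_cases hx : x + h ∈ Set.Ico h t <;> simp only [Set.indicator, this, hx, if_true, if_false]

/-- Before the `n`-th jump the recursion reproduces the true costs. The path `X` is quantified
inside the induction, because each step shifts time by the first holding time. -/
lemma chainCost_eq {V f : S → ℝ} (hV : ∀ s, 0 ≤ V s) (hf : ∀ s, 0 ≤ f s) (n : ℕ) :
    ∀ (z : S × (κ → ℕ → ℝ)) (X : ℝ → S) (t : ℝ),
      (∀ n, 0 ≤ holdTime v ((chainStep v jump)^[n] z)) →
      (∀ n t, ringTime v jump n z ≤ t → t < ringTime v jump (n + 1) z →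
        X t = ((chainStep v jump)^[n] z).1) →
      0 ≤ t → t < ringTime v jump n z →
      chainCost v jump V f n (t, z) = ENNReal.ofReal (V (X t))
        + ∫⁻ s in Set.Ico 0 t, ENNReal.ofReal (f (X s)) := by
  induction n with
  | zero =>
    intro z X t _ _ h0 h1
    rw [ringTime_zero] at h1
    exact absurd h1 (not_lt.2 h0)
  | succ n ih =>
    intro z X t hh hX h0 h1
    have hr1 : ringTime v jump 1 z = holdTime v z := by
      rw [ringTime_succ, ringTime_zero, zero_add]; rfl
    have hX0 : ∀ s, 0 ≤ s → s < holdTime v z → X s = z.1 := fun s hs hs' =>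
      hX 0 s (by rwa [ringTime_zero]) (by rwa [zero_add, hr1])
    have hconst : ∀ a, a ≤ holdTime v z → ∫⁻ s in Set.Ico 0 a, ENNReal.ofReal (f (X s))
        = ENNReal.ofReal (a * f z.1) := by
      intro a ha
      rw [setLIntegral_congr_fun (g := fun _ => ENNReal.ofReal (f z.1)) measurableSet_Ico
        fun s hs => by rw [hX0 s hs.1 (hs.2.trans_le ha)]]
      rw [setLIntegral_const, Real.volume_Ico, sub_zero, mul_comm a, ENNReal.ofReal_mul (hf _)]
    simp only [chainCost]
    split_ifs with hlt
    · rw [hX0 t h0 hlt, hconst t hlt.le, ENNReal.ofReal_add (hV _) (mul_nonneg h0 (hf _))]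
    · rw [not_lt] at hlt
      have hh0 : 0 ≤ holdTime v z := hh 0
      have h2 := ih (chainStep v jump z) (fun s => X (s + holdTime v z)) (t - holdTime v z)
        (fun n => hh (n + 1)) ?_ (by linarith)
        (by rw [ringTime_succ'] at h1; linarith)
      · rw [h2, sub_add_cancel, setLIntegral_Ico_comp_add (holdTime v z) t
          (fun s => ENNReal.ofReal (f (X s))), ← Set.Ico_union_Ico_eq_Ico hh0 hlt,
          lintegral_union measurableSet_Ico (Set.Ico_disjoint_Ico_same), hconst _ le_rfl]
        ring
      · intro n s hs1 hs2
        rw [← Function.iterate_succ_apply]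
        refine hX (n + 1) _ ?_ ?_
        · rw [ringTime_succ']; linarith
        · rw [ringTime_succ']; linarith

section Measurability

variable [Fintype κ] [MeasurableSpace S] [Countable S] [DiscreteMeasurableSpace S]

instance : MeasurableSpace (Option κ) := ⊤

instance : DiscreteMeasurableSpace (Option κ) := ⟨fun _ => trivial⟩

lemma measurable_winner (v : κ → ℝ) : Measurable (winner v) := by
  refine measurable_to_countable' fun o => ?_
  cases o with
  | some c =>
    convert measurableSet_isWinner v c using 1
    ext y
    exact winner_eq_some_iff
  | none =>
    have : winner v ⁻¹' {none} = (⋃ c, {y | IsWinner v y c})ᶜ := by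
      ext y
      simp only [Set.mem_preimage, Set.mem_singleton_iff, Set.mem_compl_iff, Set.mem_iUnion,
        Set.mem_ofPred_eq, ← winner_eq_some_iff]
      cases winner v y <;> simp
    rw [this]
    exact (MeasurableSet.iUnion fun c => measurableSet_isWinner v c).compl

lemma measurable_holdTime (v : S → κ → ℝ) : Measurable (holdTime v) := by
  refine measurable_from_prod_countable_right fun s => ?_
  have h : Measurable fun p : Option κ × (κ → ℕ → ℝ) =>
      (match p.1 with | some c => p.2 c 0 / v s c | none => (0 : ℝ)) := by
    refine measurable_from_prod_countable_right fun o => ?_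
    cases o with
    | some c =>
      exact ((measurable_pi_apply 0).comp (measurable_pi_apply c)).div_const _
    | none => exact measurable_const
  exact h.comp ((measurable_winner (v s)).prodMk measurable_id)

lemma measurable_chainStep (v : S → κ → ℝ) (jump : S → κ → S) :
    Measurable (chainStep v jump) := by
  refine measurable_from_prod_countable_right fun s => ?_
  have h : Measurable fun p : Option κ × (κ → ℕ → ℝ) =>
      (match p.1 with | some c => (jump s c, advance (v s) p.2 c) | none => (s, p.2)) := by
    refine measurable_from_prod_countable_right fun o => ?_
    cases o with
    | some c => exact measurable_const.prodMk (measurable_advance (v s) c)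
    | none => exact measurable_const.prodMk measurable_id
  exact h.comp ((measurable_winner (v s)).prodMk measurable_id)

lemma measurable_ringTime (n : ℕ) : Measurable (ringTime v jump n) :=
  Finset.measurable_sum _ fun k _ =>
    (measurable_holdTime v).comp ((measurable_chainStep v jump).iterate k)

lemma measurable_chainPath : Measurable fun p : (S × (κ → ℕ → ℝ)) × ℝ =>
    chainPath v jump p.1 p.2 := by
  classical
  set p : ℕ → (S × (κ → ℕ → ℝ)) × ℝ → Prop := fun n q => q.2 < ringTime v jump (n + 1) q.1 with hp
  have hpm : ∀ n, MeasurableSet {q | p n q} := fun n =>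
    measurableSet_lt measurable_snd ((measurable_ringTime (n + 1)).comp measurable_fst)
  have hE : MeasurableSet {q | ∃ n, p n q} := by
    simp only [Set.ofPred_exists]
    exact MeasurableSet.iUnion hpm
  -- `Measurable.find` requires an index for every argument. If the jump times do not pass the given
  -- time, the index is `0`, in agreement with the default value in `chainPath`.
  set p' : ℕ → (S × (κ → ℕ → ℝ)) × ℝ → Prop := fun n q => p n q ∨ ¬ ∃ n, p n q with hp'
  have hex : ∀ q, ∃ n, p' n q := fun q => by
    by_cases h : ∃ n, p n q
    · obtain ⟨n, hn⟩ := h; exact ⟨n, Or.inl hn⟩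
    · exact ⟨0, Or.inr h⟩
  have h1 := Measurable.find (p := p')
    (f := fun n (q : (S × (κ → ℕ → ℝ)) × ℝ) => ((chainStep v jump)^[n] q.1).1)
    (fun n => measurable_fst.comp (((measurable_chainStep v jump).iterate n).comp measurable_fst))
    (fun n => (hpm n).union hE.compl) hex
  convert h1 using 2 with q
  by_cases h : ∃ n, p n q
  · rw [chainPath, dif_pos h]
    have : Nat.find h = Nat.find (hex q) :=
      le_antisymm (Nat.find_min' h ((Nat.find_spec (hex q)).resolve_right fun h' => h' h))
        (Nat.find_min' (hex q) (Or.inl (Nat.find_spec h)))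
    rw [this]
  · rw [chainPath, dif_neg h]
    have : Nat.find (hex q) = 0 := by
      rw [Nat.find_eq_zero]; exact Or.inr h
    rw [this]
    rfl

lemma measurable_chainCost {V f : S → ℝ} (n : ℕ) : Measurable (chainCost v jump V f n) := by
  have hS : ∀ g : S → ℝ, Measurable fun p : ℝ × (S × (κ → ℕ → ℝ)) => g p.2.1 := fun g =>
    (Measurable.of_discrete (f := g)).comp measurable_snd.fst
  have hh : Measurable fun p : ℝ × (S × (κ → ℕ → ℝ)) => holdTime v p.2 :=
    (measurable_holdTime v).comp measurable_snd
  induction n with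
  | zero => exact (hS V).ennreal_ofReal
  | succ n ih =>
    refine Measurable.ite (measurableSet_lt measurable_fst hh) ?_ ?_
    · exact ((hS V).add (measurable_fst.mul (hS f))).ennreal_ofReal
    · refine (hh.mul (hS f)).ennreal_ofReal.add (ih.comp ?_)
      exact (measurable_fst.sub hh).prodMk ((measurable_chainStep v jump).comp measurable_snd)

end Measurability

end JumpProcess

/-! ### First-jump analysis, absence of explosion, Dynkin's inequality -/

section JumpProcessLaw

variable {κ S : Type*} [Fintype κ] {v : S → κ → ℝ} {jump : S → κ → S} {θ : κ → ℝ}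

lemma setLIntegral_exp_Ioi {Λ : ℝ} (hΛ : 0 < Λ) :
    ∫⁻ t in Set.Ioi 0, ENNReal.ofReal (Λ * Real.exp (-(Λ * t))) = 1 := by
  have := isProbabilityMeasure_expMeasure hΛ
  have h := lintegral_expMeasure (θ := Λ) (f := fun _ => 1) measurable_const
  simpa using h.symm

lemma sum_rate_pos (hθ : ∀ c, 0 < θ c) {w : κ → ℝ} (hw : ∀ c, 0 ≤ w c) (hw' : ∃ c, 0 < w c) :
    0 < ∑ c, θ c * w c := by
  obtain ⟨c, hc⟩ := hw'
  exact Finset.sum_pos' (fun l _ => mul_nonneg (hθ l).le (hw l))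
    ⟨c, Finset.mem_univ c, mul_pos (hθ c) hc⟩

lemma measure_isWinner (hθ : ∀ c, 0 < θ c) {w : κ → ℝ} (hw : ∀ c, 0 ≤ w c) (c : κ) :
    clockLaw θ {y | IsWinner w y c} = ∫⁻ t in Set.Ioi 0,
      ENNReal.ofReal (θ c * w c * Real.exp (-((∑ l, θ l * w l) * t))) := by
  have := isProbabilityMeasure_clockLaw hθ
  rcases (hw c).eq_or_lt with h | h
  · have : {y : κ → ℕ → ℝ | IsWinner w y c} = ∅ := by
      ext y
      simp [IsWinner, ← h]
    simp [this, ← h]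
  · rw [← lintegral_indicator_one (measurableSet_isWinner w c)]
    have h1 := lintegral_isWinner hθ hw h (F := fun _ _ => 1) measurable_const
    simp only [lintegral_const, measure_univ, mul_one] at h1
    exact h1

/-- The events that clock `c` wins are disjoint, and their probabilities add up to the integral of
an exponential density with the total rate. -/
lemma ae_exists_isWinner (hθ : ∀ c, 0 < θ c) {w : κ → ℝ} (hw : ∀ c, 0 ≤ w c)
    (hw' : ∃ c, 0 < w c) : ∀ᵐ y ∂clockLaw θ, ∃ c, IsWinner w y c := by
  have := isProbabilityMeasure_clockLaw hθ
  have hm : MeasurableSet {y : κ → ℕ → ℝ | ∃ c, IsWinner w y c} := by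
    simp only [Set.ofPred_exists]
    exact MeasurableSet.iUnion fun c => measurableSet_isWinner w c
  have h1 : clockLaw θ {y | ∃ c, IsWinner w y c} = 1 := by
    simp only [Set.ofPred_exists]
    have hdisj : Pairwise (Function.onFun Disjoint fun c => {y : κ → ℕ → ℝ | IsWinner w y c}) :=
      fun c c' hcc' => Set.disjoint_left.2 fun y (h : IsWinner w y c) (h' : IsWinner w y c') =>
        hcc' (h.unique h')
    rw [measure_iUnion hdisj fun c => measurableSet_isWinner w c, tsum_fintype]
    simp only [measure_isWinner hθ hw]
    rw [← lintegral_finsetSum _ fun c _ => by fun_prop,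
      ← setLIntegral_exp_Ioi (sum_rate_pos hθ hw hw')]
    refine lintegral_congr fun t => ?_
    rw [← ENNReal.ofReal_sum_of_nonneg fun c _ =>
      mul_nonneg (mul_nonneg (hθ c).le (hw c)) (Real.exp_pos _).le, ← Finset.sum_mul]
  rw [ae_iff]
  have h2 := (prob_compl_eq_zero_iff hm).2 h1
  exact h2

variable [MeasurableSpace S]

/-- First-jump analysis. -/
lemma lintegral_chainStep (hθ : ∀ c, 0 < θ c) {s : S} (hv : ∀ c, 0 ≤ v s c) (hv' : ∃ c, 0 < v s c)
    {F : ℝ × (S × (κ → ℕ → ℝ)) → ℝ≥0∞} (hF : Measurable F) :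
    ∫⁻ y, F (holdTime v (s, y), chainStep v jump (s, y)) ∂clockLaw θ
      = ∫⁻ t in Set.Ioi 0, ∑ c,
        ENNReal.ofReal (θ c * v s c * Real.exp (-((∑ l, θ l * v s l) * t)))
          * ∫⁻ y, F (t, jump s c, y) ∂clockLaw θ := by
  have hP := isProbabilityMeasure_clockLaw hθ
  have h1 : ∀ᵐ y ∂clockLaw θ, F (holdTime v (s, y), chainStep v jump (s, y))
      = ∑ c, {y | IsWinner (v s) y c}.indicator
        (fun y => F (y c 0 / v s c, jump s c, advance (v s) y c)) y := by
    filter_upwards [ae_exists_isWinner hθ hv hv'] with y ⟨c, hc⟩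
    rw [Finset.sum_eq_single c, Set.indicator_of_mem (show y ∈ {y | IsWinner (v s) y c} from hc),
      IsWinner.holdTime_eq (z := (s, y)) hc, IsWinner.chainStep_eq (z := (s, y)) hc]
    · intro c' _ hne
      have hn : y ∉ {y | IsWinner (v s) y c'} := fun h => hne (IsWinner.unique h hc)
      exact Set.indicator_of_notMem hn _
    · simp
  have hFc : ∀ c, Measurable fun p : ℝ × (κ → ℕ → ℝ) => F (p.1, jump s c, p.2) := fun c =>
    hF.comp (measurable_fst.prodMk (measurable_const.prodMk measurable_snd))
  rw [lintegral_congr_ae h1, lintegral_finsetSum, lintegral_finsetSum]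
  · refine Finset.sum_congr rfl fun c _ => ?_
    rcases (hv c).eq_or_lt with h | h
    · have : {y : κ → ℕ → ℝ | IsWinner (v s) y c} = ∅ := by
        ext y
        simp [IsWinner, ← h]
      simp [this, ← h]
    · exact lintegral_isWinner hθ hv h (F := fun t y => F (t, jump s c, y)) (hFc c)
  · intro c _
    exact Measurable.mul (by fun_prop) (hFc c).lintegral_prod_right'
  · intro c _
    refine Measurable.indicator ?_ (measurableSet_isWinner _ c)
    refine hF.comp (Measurable.prodMk ?_ (measurable_const.prodMk (measurable_advance (v s) c)))
    exact ((measurable_pi_apply 0).comp (measurable_pi_apply c)).div_const _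

variable [Countable S] [DiscreteMeasurableSpace S]

/-- By `lintegral_chainStep` the clocks have the law `clockLaw θ` again after the first jump, so an
event that is null from every state reached stays null. -/
lemma ae_chainStep (hθ : ∀ c, 0 < θ c) {s : S} (hv : ∀ c, 0 ≤ v s c) (hv' : ∃ c, 0 < v s c)
    {p : ℝ × (S × (κ → ℕ → ℝ)) → Prop} (hp : MeasurableSet {q | p q})
    (h : ∀ t > 0, ∀ c, ∀ᵐ y ∂clockLaw θ, p (t, jump s c, y)) :
    ∀ᵐ y ∂clockLaw θ, p (holdTime v (s, y), chainStep v jump (s, y)) := by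
  set E : Set (ℝ × (S × (κ → ℕ → ℝ))) := {q | ¬ p q} with hEdef
  have hE : MeasurableSet E := hp.compl
  have h1 := lintegral_chainStep (jump := jump) hθ hv hv'
    (F := E.indicator fun _ => 1) (measurable_const.indicator hE)
  have h2 : ∀ t > 0, ∀ c, ∫⁻ y, E.indicator (fun _ => (1 : ℝ≥0∞)) (t, jump s c, y)
      ∂clockLaw θ = 0 := by
    intro t ht c
    have hm : Measurable fun y : κ → ℕ → ℝ => (t, jump s c, y) :=
      measurable_const.prodMk (measurable_const.prodMk measurable_id)
    rw [lintegral_indicator_const_comp hm hE, one_mul]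
    exact h t ht c
  have hm : Measurable fun y : κ → ℕ → ℝ => (holdTime v (s, y), chainStep v jump (s, y)) :=
    ((measurable_holdTime v).comp measurable_prodMk_left).prodMk
      ((measurable_chainStep v jump).comp measurable_prodMk_left)
  rw [setLIntegral_congr_fun (g := fun _ => 0) measurableSet_Ioi
    (fun t ht => Finset.sum_eq_zero fun c _ => by rw [h2 t ht c, mul_zero]), lintegral_zero,
    lintegral_indicator_const_comp hm hE, one_mul] at h1
  exact h1

lemma ae_holdTime_pos (hθ : ∀ c, 0 < θ c) {s : S} (hv : ∀ c, 0 ≤ v s c) (hv' : ∃ c, 0 < v s c) :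
    ∀ᵐ y ∂clockLaw θ, 0 < holdTime v (s, y) :=
  ae_chainStep (jump := fun s _ => s) hθ hv hv' (p := fun q => 0 < q.1)
    (measurableSet_lt measurable_const measurable_fst) fun _ ht _ => Eventually.of_forall fun _ => ht

lemma ae_iterate (hθ : ∀ c, 0 < θ c) (hv : ∀ s c, 0 ≤ v s c) (hv' : ∀ s, ∃ c, 0 < v s c)
    {p : S × (κ → ℕ → ℝ) → Prop} (hp : MeasurableSet {z | p z})
    (h : ∀ s, ∀ᵐ y ∂clockLaw θ, p (s, y)) (n : ℕ) :
    ∀ s, ∀ᵐ y ∂clockLaw θ, p ((chainStep v jump)^[n] (s, y)) := by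
  induction n with
  | zero => exact h
  | succ n ih =>
    intro s
    exact ae_chainStep hθ (hv s) (hv' s) (p := fun q => p ((chainStep v jump)^[n] q.2))
      ((((measurable_chainStep v jump).iterate n).comp measurable_snd) hp) fun _ _ c => ih _

lemma measurableSet_exists_isWinner (v : S → κ → ℝ) :
    MeasurableSet {z : S × (κ → ℕ → ℝ) | ∃ c, IsWinner (v z.1) z.2 c} := by
  have h : Measurable fun z : S × (κ → ℕ → ℝ) => winner (v z.1) z.2 :=
    measurable_from_prod_countable_right fun s => measurable_winner (v s)
  convert h (MeasurableSet.of_discrete (s := {o : Option κ | ∃ c, o = some c})) using 1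
  ext z
  simp [winner_eq_some_iff]

/-- A holding time with total rate `L` contributes the factor `L / (L + 1) ≤ Λ / (Λ + 1)`. The
geometric bound makes the sum over `n` finite, which excludes explosion. -/
lemma lintegral_exp_neg_ringTime_le (hθ : ∀ c, 0 < θ c) (hv : ∀ s c, 0 ≤ v s c)
    (hv' : ∀ s, ∃ c, 0 < v s c) {Λ : ℝ} (hΛ : ∀ s, ∑ c, θ c * v s c ≤ Λ) (n : ℕ) :
    ∀ s, ∫⁻ y, ENNReal.ofReal (Real.exp (-ringTime v jump n (s, y))) ∂clockLaw θ
      ≤ ENNReal.ofReal (Λ / (Λ + 1)) ^ n := by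
  have hP := isProbabilityMeasure_clockLaw hθ
  induction n with
  | zero => intro s; simp [ringTime_zero]
  | succ n ih =>
    intro s
    have hl := sum_rate_pos hθ (hv s) (hv' s)
    set L := ∑ c, θ c * v s c with hL
    have hrt : Measurable fun z : S × (κ → ℕ → ℝ) =>
        ENNReal.ofReal (Real.exp (-ringTime v jump n z)) :=
      (Real.measurable_exp.comp (measurable_ringTime n).neg).ennreal_ofReal
    have h1 := lintegral_chainStep (jump := jump) hθ (hv s) (hv' s)
      (F := fun q => ENNReal.ofReal (Real.exp (-q.1))
        * ENNReal.ofReal (Real.exp (-ringTime v jump n q.2)))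
      (((Real.measurable_exp.comp measurable_fst.neg).ennreal_ofReal).mul
        (hrt.comp measurable_snd))
    have h2 : ∀ y, ENNReal.ofReal (Real.exp (-ringTime v jump (n + 1) (s, y)))
        = ENNReal.ofReal (Real.exp (-holdTime v (s, y)))
          * ENNReal.ofReal (Real.exp (-ringTime v jump n (chainStep v jump (s, y)))) := by
      intro y
      rw [← ENNReal.ofReal_mul (Real.exp_pos _).le, ← Real.exp_add, ringTime_succ', neg_add]
    simp only [h2]
    rw [h1]
    have h3 : ∀ t c, ∫⁻ y, ENNReal.ofReal (Real.exp (-t))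
        * ENNReal.ofReal (Real.exp (-ringTime v jump n (jump s c, y))) ∂clockLaw θ
        ≤ ENNReal.ofReal (Real.exp (-t)) * ENNReal.ofReal (Λ / (Λ + 1)) ^ n := by
      intro t c
      have e := lintegral_const_mul (μ := clockLaw θ) (ENNReal.ofReal (Real.exp (-t)))
        (f := fun y => ENNReal.ofReal (Real.exp (-ringTime v jump n (jump s c, y))))
        (hrt.comp measurable_prodMk_left)
      rw [e]
      gcongr
      exact ih _
    calc _ ≤ ∫⁻ t in Set.Ioi 0, ∑ c, ENNReal.ofReal (θ c * v s c * Real.exp (-(L * t)))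
          * (ENNReal.ofReal (Real.exp (-t)) * ENNReal.ofReal (Λ / (Λ + 1)) ^ n) := by
          gcongr with t c
          exact h3 _ _
      _ = ∫⁻ t in Set.Ioi 0, ENNReal.ofReal (L / (L + 1)) * ENNReal.ofReal (Λ / (Λ + 1)) ^ n
            * ENNReal.ofReal ((L + 1) * Real.exp (-((L + 1) * t))) := by
          refine lintegral_congr fun t => ?_
          rw [← Finset.sum_mul, ← ENNReal.ofReal_sum_of_nonneg fun c _ =>
            mul_nonneg (mul_nonneg (hθ c).le (hv s c)) (Real.exp_pos _).le, ← Finset.sum_mul, ← hL,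
            ← mul_assoc, ← ENNReal.ofReal_mul (mul_nonneg hl.le (Real.exp_pos _).le),
            mul_right_comm (ENNReal.ofReal (L / (L + 1))), ← ENNReal.ofReal_mul (by positivity)]
          congr 2
          rw [mul_assoc, ← Real.exp_add, ← mul_assoc, div_mul_cancel₀ _ (by positivity)]
          congr 2
          ring
      _ = ENNReal.ofReal (L / (L + 1)) * ENNReal.ofReal (Λ / (Λ + 1)) ^ n := by
          rw [lintegral_const_mul _ (by fun_prop), setLIntegral_exp_Ioi (by linarith), mul_one]
      _ ≤ _ := by
          rw [pow_succ']
          refine mul_le_mul' (ENNReal.ofReal_le_ofReal ?_) le_rfl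
          have := hΛ s
          rw [div_le_div_iff₀ (by linarith) (by linarith)]
          nlinarith

/-- The jump times tend to infinity. -/
lemma ae_forall_exists_lt_ringTime (hθ : ∀ c, 0 < θ c) (hv : ∀ s c, 0 ≤ v s c)
    (hv' : ∀ s, ∃ c, 0 < v s c) {Λ : ℝ} (hΛ : ∀ s, ∑ c, θ c * v s c ≤ Λ) (s : S) :
    ∀ᵐ y ∂clockLaw θ, ∀ t, ∀ᶠ n in atTop, t < ringTime v jump n (s, y) := by
  have hm : ∀ n, Measurable fun y : κ → ℕ → ℝ =>
      ENNReal.ofReal (Real.exp (-ringTime v jump n (s, y))) := fun n =>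
    (Real.measurable_exp.comp ((measurable_ringTime n).comp
      measurable_prodMk_left).neg).ennreal_ofReal
  have hΛ0 : 0 < Λ := (sum_rate_pos hθ (hv s) (hv' s)).trans_le (hΛ s)
  have hq : ENNReal.ofReal (Λ / (Λ + 1)) < 1 := by
    rw [ENNReal.ofReal_lt_one, div_lt_one (by linarith)]
    linarith
  have h1 : ∫⁻ y, ∑' n, ENNReal.ofReal (Real.exp (-ringTime v jump n (s, y))) ∂clockLaw θ ≠ ∞ := by
    rw [lintegral_tsum fun n => (hm n).aemeasurable]
    refine ne_top_of_le_ne_top ?_ (ENNReal.tsum_le_tsum fun n =>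
      lintegral_exp_neg_ringTime_le hθ hv hv' hΛ n s)
    rw [ENNReal.tsum_geometric]
    exact ENNReal.inv_ne_top.2 (tsub_pos_of_lt hq).ne'
  filter_upwards [ae_lt_top (Measurable.tsum hm) h1] with y hy t
  have h2 := ENNReal.tendsto_atTop_zero_of_tsum_ne_top hy.ne
  have h3 := h2.eventually_lt_const (ENNReal.ofReal_pos.2 (Real.exp_pos (-t)))
  filter_upwards [h3] with n hn
  rw [ENNReal.ofReal_lt_ofReal_iff (Real.exp_pos _), Real.exp_lt_exp] at hn
  linarith

/-- The analytic part of the induction for Dynkin's inequality: `τ` is the first jump time, `L` the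
total rate and `W` the sum of the values of `V` after the jump, weighted by the rates. Up to `t` the
integrand is dominated by the derivative of `P`; the increment of `P` and the contribution of a
first jump after `t` add up to exactly `V + k * t`. -/
lemma setLIntegral_generator_le {L V W f k t : ℝ} (hL : 0 < L) (hV : 0 ≤ V) (hW : 0 ≤ W)
    (hf : 0 ≤ f) (hk : 0 ≤ k) (ht : 0 ≤ t) (hgen : W - L * V + f ≤ k) :
    ∫⁻ τ in Set.Ioi 0, (if t < τ then ENNReal.ofReal (L * Real.exp (-(L * τ)) * (V + t * f))
      else ENNReal.ofReal (Real.exp (-(L * τ)) * (L * (τ * f + k * (t - τ)) + W)))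
      ≤ ENNReal.ofReal (V + k * t) := by
  rw [← Set.Ioc_union_Ioi_eq_Ioi ht, lintegral_union measurableSet_Ioi
    (Set.Ioc_disjoint_Ioi le_rfl)]
  set P : ℝ → ℝ := fun τ => -(Real.exp (-(L * τ)) * (τ * f + V + k * (t - τ))) with hP
  set p : ℝ → ℝ := fun τ => Real.exp (-(L * τ)) * (L * (τ * f + k * (t - τ)) + L * V + k - f)
    with hp
  have hd : ∀ τ, HasDerivAt P (p τ) τ := by
    intro τ
    have h1 : HasDerivAt (fun τ => Real.exp (-(L * τ))) (Real.exp (-(L * τ)) * (-L)) τ := by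
      have := ((hasDerivAt_id τ).const_mul L).neg.exp
      simpa using this
    have h2 : HasDerivAt (fun τ => τ * f + V + k * (t - τ)) (f - k) τ := by
      have := (((hasDerivAt_id τ).mul_const f).add_const V).add
        (((hasDerivAt_id τ).const_sub t).const_mul k)
      convert! this using 1
      ring
    convert! (h1.mul h2).neg using 1
    simp only [hp]
    ring
  have hpc : Continuous p := by fun_prop
  have h1 : ∫⁻ τ in Set.Ioc 0 t, (if t < τ then
        ENNReal.ofReal (L * Real.exp (-(L * τ)) * (V + t * f))
      else ENNReal.ofReal (Real.exp (-(L * τ)) * (L * (τ * f + k * (t - τ)) + W)))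
      ≤ ENNReal.ofReal (P t - P 0) := by
    have e : P t - P 0 = ∫ τ in Set.Ioc 0 t, p τ := by
      rw [← intervalIntegral.integral_of_le ht,
        intervalIntegral.integral_eq_sub_of_hasDerivAt (fun τ _ => hd τ)
          (hpc.intervalIntegrable _ _)]
    have hnn : ∀ τ ∈ Set.Ioc 0 t,
        Real.exp (-(L * τ)) * (L * (τ * f + k * (t - τ)) + W) ≤ p τ ∧ 0 ≤ p τ := by
      intro τ hτ
      have h2 : Real.exp (-(L * τ)) * (L * (τ * f + k * (t - τ)) + W) ≤ p τ := by
        simp only [hp]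
        refine mul_le_mul_of_nonneg_left ?_ (Real.exp_pos _).le
        linarith
      refine ⟨h2, le_trans ?_ h2⟩
      have := sub_nonneg.2 hτ.2
      have := hτ.1
      positivity
    rw [e, ofReal_integral_eq_lintegral_ofReal (hpc.integrableOn_Ioc)
      ((ae_restrict_iff' measurableSet_Ioc).2 (Eventually.of_forall fun τ hτ => (hnn τ hτ).2))]
    refine setLIntegral_mono' measurableSet_Ioc fun τ hτ => ?_
    rw [if_neg (not_lt.2 hτ.2)]
    exact ENNReal.ofReal_le_ofReal (hnn τ hτ).1
  have h2 : ∫⁻ τ in Set.Ioi t, (if t < τ then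
        ENNReal.ofReal (L * Real.exp (-(L * τ)) * (V + t * f))
      else ENNReal.ofReal (Real.exp (-(L * τ)) * (L * (τ * f + k * (t - τ)) + W)))
      = ENNReal.ofReal (Real.exp (-(L * t)) * (V + t * f)) := by
    rw [← setLIntegral_Ioi_comp_add, setLIntegral_congr_fun (g := fun τ =>
      ENNReal.ofReal (Real.exp (-(L * t)) * (V + t * f))
        * ENNReal.ofReal (L * Real.exp (-(L * τ)))) measurableSet_Ioi,
      lintegral_const_mul _ (by fun_prop), setLIntegral_exp_Ioi hL, mul_one]
    intro τ hτ
    have hτ' : t < τ + t := by linarith [Set.mem_Ioi.1 hτ]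
    simp only [hτ', if_true]
    rw [← ENNReal.ofReal_mul (by positivity)]
    congr 1
    rw [mul_add L τ t, neg_add, Real.exp_add]
    ring
  rw [h2]
  refine (add_le_add_left h1 _).trans ?_
  rw [← ENNReal.ofReal_add _ (by positivity)]
  · refine ENNReal.ofReal_le_ofReal (le_of_eq ?_)
    simp only [hP, mul_zero, neg_zero, Real.exp_zero]
    ring
  · have e : P t - P 0 = V + k * t - Real.exp (-(L * t)) * (V + t * f) := by
      simp only [hP, mul_zero, neg_zero, Real.exp_zero]
      ring
    have h3 : P t - P 0 = ∫ τ in Set.Ioc 0 t, p τ := by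
      rw [← intervalIntegral.integral_of_le ht,
        intervalIntegral.integral_eq_sub_of_hasDerivAt (fun τ _ => hd τ)
          (hpc.intervalIntegrable _ _)]
    rw [h3]
    refine setIntegral_nonneg measurableSet_Ioc fun τ hτ => ?_
    simp only [hp]
    have h4 := sub_nonneg.2 hτ.2
    have h5 := hτ.1
    have h6 : 0 ≤ L * (τ * f + k * (t - τ)) := by positivity
    refine mul_nonneg (Real.exp_pos _).le ?_
    linarith

variable {V f : S → ℝ} {k : ℝ} {D : Set S}

/-- Induction on the number of jumps by conditioning on the first one. Clocks at rest never win, so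
`D` has to be closed only under jumps of running clocks. -/
lemma lintegral_chainCost_le (hθ : ∀ c, 0 < θ c) (hv : ∀ s c, 0 ≤ v s c)
    (hv' : ∀ s, ∃ c, 0 < v s c) (hV : ∀ s, 0 ≤ V s) (hf : ∀ s, 0 ≤ f s) (hk : 0 ≤ k)
    (hD : ∀ s ∈ D, ∀ c, 0 < v s c → jump s c ∈ D)
    (hgen : ∀ s ∈ D, ∑ c, θ c * v s c * (V (jump s c) - V s) + f s ≤ k) (n : ℕ) :
    ∀ s ∈ D, ∀ t, 0 ≤ t →
      ∫⁻ y, chainCost v jump V f n (t, s, y) ∂clockLaw θ ≤ ENNReal.ofReal (V s + k * t) := by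
  have hP := isProbabilityMeasure_clockLaw hθ
  induction n with
  | zero =>
    intro s _ t ht
    simp only [chainCost, lintegral_const, measure_univ, mul_one]
    exact ENNReal.ofReal_le_ofReal (by have := mul_nonneg hk ht; linarith)
  | succ n ih =>
    intro s hs t ht
    have hl := sum_rate_pos hθ (hv s) (hv' s)
    set L := ∑ c, θ c * v s c with hL
    have hFm : Measurable fun q : ℝ × (S × (κ → ℕ → ℝ)) =>
        if t < q.1 then ENNReal.ofReal (V s + t * f s)
        else ENNReal.ofReal (q.1 * f s) + chainCost v jump V f n (t - q.1, q.2) :=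
      Measurable.ite (measurableSet_lt measurable_const measurable_fst) measurable_const
        ((measurable_fst.mul_const _).ennreal_ofReal.add ((measurable_chainCost n).comp
          ((measurable_fst.const_sub t).prodMk measurable_snd)))
    have h1 := lintegral_chainStep (jump := jump) hθ (hv s) (hv' s) hFm
    have h2 : ∫⁻ y, chainCost v jump V f (n + 1) (t, s, y) ∂clockLaw θ = _ := h1
    rw [h2]
    have hW : 0 ≤ ∑ c, θ c * v s c * V (jump s c) :=
      Finset.sum_nonneg fun c _ => mul_nonneg (mul_nonneg (hθ c).le (hv s c)) (hV _)
    refine le_trans ?_ (setLIntegral_generator_le hl (hV s) hW (hf s) hk ht ?_)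
    · refine setLIntegral_mono' measurableSet_Ioi fun τ hτ => ?_
      rw [Set.mem_Ioi] at hτ
      split_ifs with htτ
      · simp only [lintegral_const, measure_univ, mul_one]
        rw [← Finset.sum_mul, ← ENNReal.ofReal_sum_of_nonneg fun c _ =>
            mul_nonneg (mul_nonneg (hθ c).le (hv s c)) (Real.exp_pos _).le, ← Finset.sum_mul, ← hL,
            ← ENNReal.ofReal_mul (by positivity)]
      · rw [not_lt] at htτ
        have htτ' : 0 ≤ t - τ := sub_nonneg.2 htτ
        have h3 : ∀ c, ENNReal.ofReal (θ c * v s c * Real.exp (-(L * τ)))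
            * ∫⁻ y, (ENNReal.ofReal (τ * f s)
              + chainCost v jump V f n (t - τ, jump s c, y)) ∂clockLaw θ
            ≤ ENNReal.ofReal (θ c * v s c * Real.exp (-(L * τ))
              * (τ * f s + (V (jump s c) + k * (t - τ)))) := by
          intro c
          rcases (hv s c).eq_or_lt with h | h
          · simp [← h]
          · rw [ENNReal.ofReal_mul (p := θ c * v s c * Real.exp (-(L * τ)))
              (mul_nonneg (mul_nonneg (hθ c).le (hv s c)) (Real.exp_pos _).le)]
            gcongr
            rw [lintegral_add_left measurable_const, lintegral_const, measure_univ, mul_one,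
              ENNReal.ofReal_add (mul_nonneg hτ.le (hf s))
                (add_nonneg (hV _) (mul_nonneg hk htτ'))]
            gcongr
            exact ih _ (hD s hs c h) _ htτ'
        refine (Finset.sum_le_sum fun c _ => h3 c).trans ?_
        rw [← ENNReal.ofReal_sum_of_nonneg fun c _ => by
          have := hθ c; have := hv s c; have := hV (jump s c); have := hf s; positivity]
        refine ENNReal.ofReal_le_ofReal (le_of_eq ?_)
        have e : ∀ c, θ c * v s c * Real.exp (-(L * τ)) * (τ * f s + (V (jump s c) + k * (t - τ)))
            = Real.exp (-(L * τ)) * ((θ c * v s c) * (τ * f s + k * (t - τ))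
              + θ c * v s c * V (jump s c)) := fun c => by ring
        simp only [e]
        rw [← Finset.mul_sum, Finset.sum_add_distrib, ← Finset.sum_mul]
    · have := hgen s hs
      simp only [mul_sub, Finset.sum_sub_distrib] at this
      rw [← Finset.sum_mul] at this
      linarith

lemma ae_holdTime_iterate_nonneg (hθ : ∀ c, 0 < θ c) (hv : ∀ s c, 0 ≤ v s c)
    (hv' : ∀ s, ∃ c, 0 < v s c) (s : S) :
    ∀ᵐ y ∂clockLaw θ, ∀ n, 0 ≤ holdTime v ((chainStep v jump)^[n] (s, y)) := by
  rw [ae_all_iff]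
  intro n
  have h := ae_iterate (jump := jump) hθ hv hv' (p := fun z => 0 < holdTime v z)
    (measurableSet_lt measurable_const (measurable_holdTime v))
    (fun s => ae_holdTime_pos hθ (hv s) (hv' s)) n s
  filter_upwards [h] with y hy using hy.le

/-- Dynkin's inequality: if the generator maps `V` to a function which is at most `k - f`, then the
expected running costs `f` up to time `t` plus the expected final costs `V` are at most
`V s + k t`. -/
theorem lintegral_chainPath_le (hθ : ∀ c, 0 < θ c) (hv : ∀ s c, 0 ≤ v s c)
    (hv' : ∀ s, ∃ c, 0 < v s c) {Λ : ℝ} (hΛ : ∀ s, ∑ c, θ c * v s c ≤ Λ)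
    (hV : ∀ s, 0 ≤ V s) (hf : ∀ s, 0 ≤ f s) (hk : 0 ≤ k)
    (hD : ∀ s ∈ D, ∀ c, 0 < v s c → jump s c ∈ D)
    (hgen : ∀ s ∈ D, ∑ c, θ c * v s c * (V (jump s c) - V s) + f s ≤ k)
    {s : S} (hs : s ∈ D) {t : ℝ} (ht : 0 ≤ t) :
    ∫⁻ y, (ENNReal.ofReal (V (chainPath v jump (s, y) t))
      + ∫⁻ u in Set.Ico 0 t, ENNReal.ofReal (f (chainPath v jump (s, y) u))) ∂clockLaw θ
      ≤ ENNReal.ofReal (V s + k * t) := by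
  -- Without explosion the truncated costs are eventually equal to the true ones, so Fatou's lemma
  -- carries the bound, uniform in `n`, to the limit.
  have h1 : ∀ᵐ y ∂clockLaw θ, ENNReal.ofReal (V (chainPath v jump (s, y) t))
      + ∫⁻ u in Set.Ico 0 t, ENNReal.ofReal (f (chainPath v jump (s, y) u))
      = liminf (fun n => chainCost v jump V f n (t, s, y)) atTop := by
    filter_upwards [ae_holdTime_iterate_nonneg (jump := jump) hθ hv hv' s,
      ae_forall_exists_lt_ringTime (jump := jump) hθ hv hv' hΛ s] with y h0 hT
    refine (Tendsto.liminf_eq (tendsto_const_nhds.congr' ?_)).symm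
    filter_upwards [hT t] with n hn
    exact (chainCost_eq hV hf n (s, y) _ t h0 (fun n t h h' => chainPath_eq h0 h h') ht hn).symm
  rw [lintegral_congr_ae h1]
  refine (lintegral_liminf_le fun n => (measurable_chainCost n).comp
    (measurable_const.prodMk measurable_prodMk_left)).trans ?_
  refine liminf_le_of_le (by isBoundedDefault) fun b hb => ?_
  obtain ⟨n, hn⟩ := hb.exists
  exact hn.trans (lintegral_chainCost_le hθ hv hv' hV hf hk hD hgen n s hs t ht)

end JumpProcessLaw

/-! ### Suspension as a recursion in the successive queue lengths -/

section Switching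

variable {a b : ℝ} {z : Bool} {f : ℝ → ℝ}

lemma le_firstTime {s x : EReal} {p : ℝ → Prop} (h : ∀ u : ℝ, s ≤ u → p u → x ≤ u) :
    x ≤ firstTime s p := by
  refine le_sInf ?_
  rintro _ ⟨u, hu, rfl⟩
  exact h u hu.1 hu.2

lemma firstTime_le {s : EReal} {p : ℝ → Prop} {u : ℝ} (h : s ≤ u) (hu : p u) :
    firstTime s p ≤ u := sInf_le ⟨u, ⟨h, hu⟩, rfl⟩

lemma switchTime_odd (l : ℕ) : switchTime a b z f (2 * l + 1)
    = firstTime (switchTime a b z f (2 * l)) (fun u => b ≤ f u) := by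
  rw [switchTime, if_pos (even_two_mul l)]

lemma switchTime_even (l : ℕ) : switchTime a b z f (2 * (l + 1))
    = firstTime (switchTime a b z f (2 * l + 1)) (fun u => f u < a) := by
  rw [show 2 * (l + 1) = (2 * l + 1) + 1 by ring, switchTime, if_neg (by simp)]

lemma monotone_switchTime : Monotone (switchTime a b z f) := by
  refine monotone_nat_of_le_succ fun l => ?_
  rw [switchTime]
  split_ifs <;> exact le_firstTime fun u hu _ => hu

/-- The mark of a queue with present length `x`, if `e` is the mark just before. -/
noncomputable def newMark (a b : ℝ) (e : Bool) (x : ℝ) : Bool :=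
  if e then decide (x < b) else decide (x < a)

/-- On the time interval `[0, T)` the queue has evolved in such a way that it is suspended just
before `T` if and only if `e = true`. -/
def PreMark (a b : ℝ) (z : Bool) (f : ℝ → ℝ) (T : ℝ) (e : Bool) : Prop :=
  if e then ∃ l : ℕ, switchTime a b z f (2 * l) ≤ T ∧
    ∀ u : ℝ, u < T → switchTime a b z f (2 * l) ≤ u → f u < b
  else (z = false ∧ ∀ u : ℝ, 0 ≤ u → u < T → a ≤ f u) ∨
    ∃ l : ℕ, switchTime a b z f (2 * l + 1) ≤ T ∧
      ∀ u : ℝ, u < T → switchTime a b z f (2 * l + 1) ≤ u → a ≤ f u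

lemma preMark_zero : PreMark a b z f 0 z := by
  unfold PreMark
  cases z with
  | true =>
    refine ⟨0, by simp [switchTime], fun u hu h => ?_⟩
    simp only [switchTime, if_true] at h
    exact absurd (EReal.coe_nonneg.1 h) (not_le.2 hu)
  | false => exact Or.inl ⟨rfl, fun u h1 h2 => absurd h1 (not_le.2 h2)⟩

lemma suspended_of_forall_lt {l : ℕ} {t T' : ℝ} (hl : switchTime a b z f (2 * l) ≤ t)
    (ht : t < T') (h : ∀ u : ℝ, u < T' → switchTime a b z f (2 * l) ≤ u → f u < b) :
    Suspended a b z f t := by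
  refine ⟨l, hl, lt_of_lt_of_le (EReal.coe_lt_coe_iff.2 ht) ?_⟩
  rw [switchTime_odd]
  refine le_firstTime fun u hu hb => ?_
  by_contra hlt
  exact absurd (h u (EReal.coe_lt_coe_iff.1 (not_le.1 hlt)) hu) (not_lt.2 hb)

lemma not_suspended_of_forall_le {l : ℕ} {t T' : ℝ} (hl : switchTime a b z f (2 * l + 1) ≤ t)
    (ht : t < T') (h : ∀ u : ℝ, u < T' → switchTime a b z f (2 * l + 1) ≤ u → a ≤ f u) :
    ¬ Suspended a b z f t := by
  rintro ⟨k, hk1, hk2⟩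
  have h1 : 2 * l + 1 < 2 * k + 1 := by
    by_contra hle
    exact absurd (monotone_switchTime (not_lt.1 hle)) (not_le.2 (hl.trans_lt hk2))
  have h2 : switchTime a b z f (2 * (l + 1)) ≤ t :=
    (monotone_switchTime (by omega)).trans hk1
  rw [switchTime_even] at h2
  refine absurd h2 (not_le.2 (lt_of_lt_of_le (EReal.coe_lt_coe_iff.2 ht) ?_))
  refine le_firstTime fun u hu hb => ?_
  by_contra hlt
  exact absurd (h u (EReal.coe_lt_coe_iff.1 (not_le.1 hlt)) hu) (not_le.2 hb)

lemma not_suspended_of_forall_le_zero {t T' : ℝ} (hz : z = false)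
    (ht : t < T') (h : ∀ u : ℝ, 0 ≤ u → u < T' → a ≤ f u) :
    ¬ Suspended a b z f t := by
  rintro ⟨k, hk1, -⟩
  have h2 : switchTime a b z f 0 ≤ t := (monotone_switchTime (Nat.zero_le _)).trans hk1
  rw [switchTime, if_neg (by simp [hz])] at h2
  refine absurd h2 (not_le.2 (lt_of_lt_of_le (EReal.coe_lt_coe_iff.2 ht) ?_))
  refine le_firstTime fun u hu hb => ?_
  by_contra hlt
  exact absurd (h u (by exact_mod_cast hu) (EReal.coe_lt_coe_iff.1 (not_le.1 hlt))) (not_le.2 hb)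

/-- While the length is constant on `[T, T')`, a switch can occur only at `T`, and since `a < b` at
most one occurs there. So the mark just before `T` and the length decide about the whole interval.
-/
lemma PreMark.newMark {T T' x : ℝ} {e : Bool} (hab : a < b) (h : PreMark a b z f T e)
    (hT : 0 ≤ T) (hTT : T < T') (hf : ∀ u, T ≤ u → u < T' → f u = x) :
    PreMark a b z f T' (newMark a b e x) ∧
      ∀ t, T ≤ t → t < T' → (Suspended a b z f t ↔ newMark a b e x = true) := by
  have hTe : (T : EReal) ≤ T' := EReal.coe_le_coe_iff.2 hTT.le
  have hle : ∀ t : ℝ, T ≤ t → (T : EReal) ≤ t := fun t ht => EReal.coe_le_coe_iff.2 ht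
  cases e with
  | true =>
    obtain ⟨l, hl, hlb⟩ := h
    by_cases hx : x < b
    · have h1 : ∀ u : ℝ, u < T' → switchTime a b z f (2 * l) ≤ u → f u < b := by
        intro u hu hs
        by_cases huT : u < T
        · exact hlb u huT hs
        · rwa [hf u (not_lt.1 huT) hu]
      rw [show _root_.newMark a b true x = true by simp [_root_.newMark, hx]]
      exact ⟨⟨l, hl.trans hTe, h1⟩, fun t ht ht' =>
        iff_of_true (suspended_of_forall_lt (hl.trans (hle t ht)) ht' h1) rfl⟩
    · have hs1 : switchTime a b z f (2 * l + 1) ≤ T := by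
        rw [switchTime_odd]
        exact firstTime_le hl (by rw [hf T le_rfl hTT]; exact not_lt.1 hx)
      have hs2 : (T : EReal) ≤ switchTime a b z f (2 * l + 1) := by
        rw [switchTime_odd]
        refine le_firstTime fun u hu hb => ?_
        by_contra hlt
        exact absurd (hlb u (EReal.coe_lt_coe_iff.1 (not_le.1 hlt)) hu) (not_lt.2 hb)
      have h1 : ∀ u : ℝ, u < T' → switchTime a b z f (2 * l + 1) ≤ u → a ≤ f u := by
        intro u hu hs
        rw [hf u (EReal.coe_le_coe_iff.1 (hs2.trans hs)) hu]
        linarith [not_lt.1 hx]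
      rw [show _root_.newMark a b true x = false by simp [_root_.newMark, hx]]
      exact ⟨Or.inr ⟨l, hs1.trans hTe, h1⟩, fun t ht ht' =>
        iff_of_false (not_suspended_of_forall_le (hs1.trans (hle t ht)) ht' h1) (by simp)⟩
  | false =>
    by_cases hx : x < a
    · rw [show _root_.newMark a b false x = true by simp [_root_.newMark, hx]]
      suffices hs : ∃ l, switchTime a b z f (2 * l) ≤ T ∧ (T : EReal) ≤ switchTime a b z f (2 * l) by
        obtain ⟨l, hs1, hs2⟩ := hs
        have h1 : ∀ u : ℝ, u < T' → switchTime a b z f (2 * l) ≤ u → f u < b := by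
          intro u hu hs
          rw [hf u (EReal.coe_le_coe_iff.1 (hs2.trans hs)) hu]
          linarith
        exact ⟨⟨l, hs1.trans hTe, h1⟩, fun t ht ht' =>
          iff_of_true (suspended_of_forall_lt (hs1.trans (hle t ht)) ht' h1) rfl⟩
      rcases h with ⟨hz, h⟩ | ⟨l, hl, hla⟩
      · refine ⟨0, ?_, ?_⟩
        · rw [mul_zero, switchTime, if_neg (by simp [hz])]
          exact firstTime_le (by exact_mod_cast hT) (by rw [hf T le_rfl hTT]; exact hx)
        · rw [mul_zero, switchTime, if_neg (by simp [hz])]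
          refine le_firstTime fun u hu hb => ?_
          by_contra hlt
          exact absurd (h u (by exact_mod_cast hu) (EReal.coe_lt_coe_iff.1 (not_le.1 hlt)))
            (not_le.2 hb)
      · refine ⟨l + 1, ?_, ?_⟩
        · rw [switchTime_even]
          exact firstTime_le hl (by rw [hf T le_rfl hTT]; exact hx)
        · rw [switchTime_even]
          refine le_firstTime fun u hu hb => ?_
          by_contra hlt
          exact absurd (hla u (EReal.coe_lt_coe_iff.1 (not_le.1 hlt)) hu) (not_le.2 hb)
    · rw [show _root_.newMark a b false x = false by simp [_root_.newMark, hx]]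
      rcases h with ⟨hz, h⟩ | ⟨l, hl, hla⟩
      · have h1 : ∀ u : ℝ, 0 ≤ u → u < T' → a ≤ f u := by
          intro u h0 hu
          by_cases huT : u < T
          · exact h u h0 huT
          · rw [hf u (not_lt.1 huT) hu]; exact not_lt.1 hx
        exact ⟨Or.inl ⟨hz, h1⟩, fun t _ ht' =>
          iff_of_false (not_suspended_of_forall_le_zero hz ht' h1) (by simp)⟩
      · have h1 : ∀ u : ℝ, u < T' → switchTime a b z f (2 * l + 1) ≤ u → a ≤ f u := by
          intro u hu hs
          by_cases huT : u < T
          · exact hla u huT hs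
          · rw [hf u (not_lt.1 huT) hu]; exact not_lt.1 hx
        exact ⟨Or.inr ⟨l, hl.trans hTe, h1⟩, fun t ht ht' =>
          iff_of_false (not_suspended_of_forall_le (hl.trans (hle t ht)) ht' h1) (by simp)⟩

end Switching

/-! ### Renewal counting through residual times -/

section Residual

/-- After `u` units of clock time `k` of the successive durations `ξ` have elapsed, and `w` is the
sequence of the remaining ones. -/
structure Residual (ξ : ℕ → ℝ) (k : ℕ) (u : ℝ) (w : ℕ → ℝ) : Prop where
  sum_le : ∑ i ∈ Finset.range k, ξ i ≤ u
  zero : w 0 = ∑ i ∈ Finset.range (k + 1), ξ i - u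
  succ : ∀ i, w (i + 1) = ξ (k + 1 + i)
  pos : 0 < w 0

variable {ξ w : ℕ → ℝ} {k : ℕ} {u : ℝ}

lemma residual_zero (hξ : ∀ i, 0 < ξ i) : Residual ξ 0 0 ξ where
  sum_le := by simp
  zero := by simp
  succ i := by rw [zero_add, add_comm]
  pos := hξ 0

lemma Residual.age (h : Residual ξ k u w) {d : ℝ} (hd : 0 ≤ d) (hd' : d < w 0) :
    Residual ξ k (u + d) (ageSeq d w) where
  sum_le := by linarith [h.sum_le]
  zero := by simp only [ageSeq, consSeq]; linarith [h.zero]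
  succ i := h.succ i
  pos := by simp only [ageSeq, consSeq]; linarith

lemma Residual.shift (h : Residual ξ k u w) (hξ : ∀ i, 0 < ξ i) :
    Residual ξ (k + 1) (u + w 0) (shiftSeq w) where
  sum_le := by linarith [h.zero]
  zero := by
    rw [shiftSeq, h.succ, Finset.sum_range_succ _ (k + 1)]
    linarith [h.zero]
  succ i := by rw [shiftSeq, h.succ]; congr 1; ring
  pos := by rw [shiftSeq, h.succ]; exact hξ _

/-- The durations are positive, so the partial sums increase; `0 < w 0` says that the one with `k +
1` terms exceeds `u`. -/
lemma Residual.countingProcess_eq (h : Residual ξ k u w) (hξ : ∀ i, 0 < ξ i) :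
    countingProcess ξ u = k := by
  have h1 : {n : ℕ | ∑ i ∈ Finset.range n, ξ i ≤ u} = Set.Iic k := by
    ext n
    simp only [Set.mem_ofPred_eq, Set.mem_Iic]
    have hmono : Monotone fun n => ∑ i ∈ Finset.range n, ξ i :=
      monotone_nat_of_le_succ fun n => by rw [Finset.sum_range_succ]; linarith [hξ n]
    constructor
    · intro hn
      by_contra hlt
      have := hmono (show k + 1 ≤ n by omega)
      simp only at this
      linarith [h.zero, h.pos]
    · exact fun hn => (hmono hn).trans h.sum_le
  rw [countingProcess, h1, csSup_Iic]

end Residual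

/-! ### Identification of the queue length process with a jump chain -/

namespace Network

variable {I J m : ℕ} (net : Network I J) (ρ : Fin m → Fin J) (a b : ℝ)

/-- The speeds of the clocks of the arrivals and of the services, when the state consists of the
queue lengths `s.1` and of the suspension marks `s.2`. -/
noncomputable def clockSpeed (s : (Fin J → ℕ) × (Fin J → Bool)) : Fin J ⊕ Fin J → ℝ
  | Sum.inl _ => 1
  | Sum.inr j => if s.2 j then 0 else net.flow ρ {l | b ≤ (s.1 l : ℝ)} j

/-- The queue lengths after an arrival or a service. -/
def queueStep (q : Fin J → ℕ) : Fin J ⊕ Fin J → Fin J → ℕ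
  | Sum.inl j => Function.update q j (q j + 1)
  | Sum.inr j => Function.update q j (q j - 1)

/-- The state after an arrival or a service. -/
noncomputable def stateStep (s : (Fin J → ℕ) × (Fin J → Bool)) (c : Fin J ⊕ Fin J) :
    (Fin J → ℕ) × (Fin J → Bool) :=
  (queueStep s.1 c, fun l => newMark a b (s.2 l) (queueStep s.1 c l))

/-- The state at time `0` for the queue lengths `n` and the initial marks `z`. -/
noncomputable def initState (n : Fin J → ℕ) (z : Fin J → Bool) : (Fin J → ℕ) × (Fin J → Bool) :=
  (n, fun l => newMark a b (z l) (n l))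

variable {net ρ a b}

lemma allocation_nonneg (hflow : ∀ σ j, 0 ≤ net.flow ρ σ j) (z : Fin J → Bool)
    (path : ℝ → Fin J → ℝ) (t : ℝ) (j : Fin J) : 0 ≤ net.allocation ρ a b z path t j := by
  unfold allocation
  split_ifs
  exacts [le_rfl, hflow _ _]

/-- The path is constant as long as no clock rings, but the speeds of the clocks are known only as
long as the path is constant. The circle is broken at the first time when some service has used up
its residual work: before it the path is constant, so the work done is speed times elapsed time,
which by `hw` has not yet reached the residual. -/
lemma path_eq_of_residual (hflow : ∀ σ j, 0 ≤ net.flow ρ σ j) (hab : a < b)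
    {z : Fin J → Bool} {path : ℝ → Fin J → ℝ} {y : Fin J ⊕ Fin J → ℕ → ℝ} {n₀ : Fin J → ℕ}
    (hy : ∀ c i, 0 < y c i)
    (hint : ∀ t, 0 ≤ t → ∀ j,
      IntervalIntegrable (fun s => net.allocation ρ a b z path s j) volume 0 t)
    (hq : ∀ t, 0 ≤ t → ∀ j, path t j = n₀ j + countingProcess (y (Sum.inl j)) t
      - countingProcess (y (Sum.inr j)) (∫ s in (0 : ℝ)..t, net.allocation ρ a b z path s j))
    {s : (Fin J → ℕ) × (Fin J → Bool)} {T T' : ℝ} (hT : 0 ≤ T) (hTT : T < T')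
    {cnt : Fin J ⊕ Fin J → ℕ} {w : Fin J ⊕ Fin J → ℕ → ℝ}
    (hinl : ∀ j, Residual (y (Sum.inl j)) (cnt (Sum.inl j)) T (w (Sum.inl j)))
    (hinr : ∀ j, Residual (y (Sum.inr j)) (cnt (Sum.inr j))
      (∫ s in (0 : ℝ)..T, net.allocation ρ a b z path s j) (w (Sum.inr j)))
    (hs : ∀ j, (s.1 j : ℝ) = n₀ j + cnt (Sum.inl j) - cnt (Sum.inr j))
    {ep : Fin J → Bool} (hpm : ∀ j, PreMark a b (z j) (fun t => path t j) T (ep j))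
    (hmark : ∀ j, s.2 j = newMark a b (ep j) (s.1 j))
    (hw : ∀ c t, T ≤ t → t < T' → net.clockSpeed ρ b s c * (t - T) < w c 0) :
    (∀ t, T ≤ t → t < T' → ∀ j, path t j = s.1 j) ∧
      ∀ j, ∫ u in (0 : ℝ)..T', net.allocation ρ a b z path u j
        = (∫ u in (0 : ℝ)..T, net.allocation ρ a b z path u j)
          + net.clockSpeed ρ b s (Sum.inr j) * (T' - T) := by
  set x : Fin J → ℝ → ℝ := fun j t => net.allocation ρ a b z path t j with hx
  have hx0 : ∀ j t, 0 ≤ x j t := fun j t => allocation_nonneg hflow z path t j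
  have hii : ∀ j t t', 0 ≤ t → 0 ≤ t' → IntervalIntegrable (x j) volume t t' := fun j t t' h h' =>
    (hint t h j).symm.trans (hint t' h' j)
  have hadd : ∀ j t, T ≤ t → ∫ u in (0 : ℝ)..t, x j u
      = (∫ u in (0 : ℝ)..T, x j u) + ∫ u in T..t, x j u := fun j t ht =>
    (intervalIntegral.integral_add_adjacent_intervals (hint T hT j)
      (hii j T t hT (hT.trans ht))).symm
  have hA : ∀ t, T ≤ t → t ≤ T' → (∀ u, T ≤ u → u < t → ∀ j, path u j = s.1 j) →
      ∀ j, ∫ u in T..t, x j u = net.clockSpeed ρ b s (Sum.inr j) * (t - T) := by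
    intro t ht htT hp j
    rcases ht.eq_or_lt with rfl | htlt
    · simp
    have hsus := ((hpm j).newMark hab hT htlt fun u h1 h2 => hp u h1 h2 j).2
    have hc : ∫ u in T..t, x j u = ∫ _ in T..t, net.clockSpeed ρ b s (Sum.inr j) := by
      refine intervalIntegral.integral_congr_ae ?_
      have hne : ∀ᵐ u : ℝ, u ≠ t := compl_mem_ae_iff.2 (measure_singleton t)
      filter_upwards [hne] with u hu hmem
      rw [Set.uIoc_of_le ht] at hmem
      have hut : u < t := lt_of_le_of_ne hmem.2 hu
      have hpu : path u = fun l => (s.1 l : ℝ) := funext fun l => hp u hmem.1.le hut l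
      have := hsus u hmem.1.le hut
      rw [← hmark j] at this
      simp only [hx, allocation, clockSpeed, this, hpu]
    rw [hc, intervalIntegral.integral_const, smul_eq_mul, mul_comm]
  have hB : ∀ t, T ≤ t → t < T' → (∀ j, ∫ u in T..t, x j u < w (Sum.inr j) 0) →
      ∀ j, path t j = s.1 j := by
    intro t ht htT hlt j
    have h1 := ((hinl j).age (sub_nonneg.2 ht)
      (by simpa [clockSpeed] using hw (Sum.inl j) t ht htT)).countingProcess_eq (hy _)
    have h2 := ((hinr j).age (intervalIntegral.integral_nonneg ht fun u _ => hx0 j u)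
      (hlt j)).countingProcess_eq (hy _)
    rw [add_sub_cancel] at h1
    rw [← hadd j t ht] at h2
    rw [hq t (hT.trans ht) j, h1, h2, hs]
  have hgood : ∀ t, T ≤ t → t < T' → ∀ j, ∫ u in T..t, x j u < w (Sum.inr j) 0 := by
    intro t₀ ht₀ ht₀T
    by_contra! hbad
    -- The work done is continuous in time, so the set of bad times is compact and has a least
    -- element `t₁`.
    have hcl : IsClosed (⋃ j, Set.Icc T t₀ ∩
        (fun t => ∫ u in T..t, x j u) ⁻¹' Set.Ici (w (Sum.inr j) 0)) := by
      refine isClosed_iUnion_of_finite fun j => ContinuousOn.preimage_isClosed_of_isClosed ?_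
        isClosed_Icc isClosed_Ici
      have := intervalIntegral.continuousOn_primitive_interval' (μ := volume)
        (hii j T t₀ hT (hT.trans ht₀)) Set.left_mem_uIcc
      rwa [Set.uIcc_of_le ht₀] at this
    have hcp : IsCompact (⋃ j, Set.Icc T t₀ ∩
        (fun t => ∫ u in T..t, x j u) ⁻¹' Set.Ici (w (Sum.inr j) 0)) :=
      (isCompact_Icc (a := T) (b := t₀)).of_isClosed_subset hcl
        (Set.iUnion_subset fun j => Set.inter_subset_left)
    obtain ⟨j₀, hj₀⟩ := hbad
    obtain ⟨t₁, h1, h1min⟩ := hcp.exists_isLeast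
      ⟨t₀, Set.mem_iUnion.2 ⟨j₀, ⟨ht₀, le_rfl⟩, hj₀⟩⟩
    obtain ⟨j, ⟨hT1, h10⟩, hj⟩ := Set.mem_iUnion.1 h1
    have hpre : ∀ u, T ≤ u → u < t₁ → ∀ l, path u l = s.1 l := by
      intro u hu hut
      refine hB u hu (by linarith) fun l => ?_
      by_contra! hl
      exact absurd (h1min (Set.mem_iUnion.2 ⟨l, ⟨hu, by linarith⟩, hl⟩)) (not_le.2 hut)
    have h2 := hA t₁ hT1 (by linarith) hpre j
    have h3 := hw (Sum.inr j) t₁ hT1 (by linarith)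
    have h4 : w (Sum.inr j) 0 ≤ ∫ u in T..t₁, x j u := hj
    linarith
  have hpath : ∀ t, T ≤ t → t < T' → ∀ j, path t j = s.1 j := fun t ht htT =>
    hB t ht htT (hgood t ht htT)
  refine ⟨hpath, fun j => ?_⟩
  have := hadd j T' hTT.le
  rw [hA T' hTT.le le_rfl hpath j] at this
  exact this

/-- The invariant which ties the trajectory of the queue lengths to the jump chain. -/
structure Tracks (net : Network I J) (ρ : Fin m → Fin J) (a b : ℝ) (z : Fin J → Bool)
    (path : ℝ → Fin J → ℝ) (y : Fin J ⊕ Fin J → ℕ → ℝ) (n₀ : Fin J → ℕ) (T : ℝ)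
    (p : ((Fin J → ℕ) × (Fin J → Bool)) × (Fin J ⊕ Fin J → ℕ → ℝ))
    (cnt : Fin J ⊕ Fin J → ℕ) (ep : Fin J → Bool) : Prop where
  nonneg : 0 ≤ T
  arrival : ∀ j, Residual (y (Sum.inl j)) (cnt (Sum.inl j)) T (p.2 (Sum.inl j))
  service : ∀ j, Residual (y (Sum.inr j)) (cnt (Sum.inr j))
      (∫ s in (0 : ℝ)..T, net.allocation ρ a b z path s j) (p.2 (Sum.inr j))
  queue : ∀ j, (p.1.1 j : ℝ) = n₀ j + cnt (Sum.inl j) - cnt (Sum.inr j)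
  preMark : ∀ j, PreMark a b (z j) (fun t => path t j) T (ep j)
  mark : ∀ j, p.1.2 j = newMark a b (ep j) (p.1.1 j)

lemma clockSpeed_nonneg (hflow : ∀ σ j, 0 ≤ net.flow ρ σ j)
    (s : (Fin J → ℕ) × (Fin J → Bool)) (c : Fin J ⊕ Fin J) : 0 ≤ net.clockSpeed ρ b s c := by
  cases c with
  | inl j => exact zero_le_one
  | inr j =>
    simp only [clockSpeed]
    split_ifs
    exacts [le_rfl, hflow _ _]

/-- Between jumps `path_eq_of_residual` applies, and the present marks become the marks just before
the next jump. A service clock runs only if its queue is not suspended, and an empty queue is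
suspended because `0 < a`; so the truncated subtraction in `queueStep` is exact. -/
lemma Tracks.step (hflow : ∀ σ j, 0 ≤ net.flow ρ σ j) (ha : 0 < a) (hab : a < b)
    {z : Fin J → Bool} {path : ℝ → Fin J → ℝ} {y : Fin J ⊕ Fin J → ℕ → ℝ} {n₀ : Fin J → ℕ}
    (hy : ∀ c i, 0 < y c i)
    (hint : ∀ t, 0 ≤ t → ∀ j,
      IntervalIntegrable (fun s => net.allocation ρ a b z path s j) volume 0 t)
    (hq : ∀ t, 0 ≤ t → ∀ j, path t j = n₀ j + countingProcess (y (Sum.inl j)) t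
      - countingProcess (y (Sum.inr j)) (∫ s in (0 : ℝ)..t, net.allocation ρ a b z path s j))
    {T : ℝ} {p : ((Fin J → ℕ) × (Fin J → Bool)) × (Fin J ⊕ Fin J → ℕ → ℝ)}
    {cnt : Fin J ⊕ Fin J → ℕ} {ep : Fin J → Bool}
    (h : Tracks net ρ a b z path y n₀ T p cnt ep)
    (hwin : ∃ c, IsWinner (net.clockSpeed ρ b p.1) p.2 c) :
    (∀ t, T ≤ t → t < T + holdTime (net.clockSpeed ρ b) p → ∀ j, path t j = p.1.1 j) ∧
      ∃ cnt' ep', Tracks net ρ a b z path y n₀ (T + holdTime (net.clockSpeed ρ b) p)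
        (chainStep (net.clockSpeed ρ b) (stateStep a b) p) cnt' ep' := by
  classical
  obtain ⟨c, hc⟩ := hwin
  rw [hc.holdTime_eq, hc.chainStep_eq]
  have hv := clockSpeed_nonneg (b := b) hflow p.1
  set d := p.2 c 0 / net.clockSpeed ρ b p.1 c with hd
  have hpos : ∀ l, 0 < p.2 l 0 := by
    rintro (j | j)
    exacts [(h.arrival j).pos, (h.service j).pos]
  have hd0 : 0 < d := div_pos (hpos c) hc.1
  have hcd : net.clockSpeed ρ b p.1 c * d = p.2 c 0 := by rw [hd]; field_simp [hc.1.ne']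
  have hw : ∀ l t, T ≤ t → t < T + d → net.clockSpeed ρ b p.1 l * (t - T) < p.2 l 0 := by
    intro l t ht htd
    by_cases hl : l = c
    · rw [hl, ← hcd]
      exact mul_lt_mul_of_pos_left (by linarith) hc.1
    · exact (mul_le_mul_of_nonneg_left (by linarith) (hv l)).trans_lt (hc.2 l hl)
  obtain ⟨hpath, hB⟩ := path_eq_of_residual hflow hab hy hint hq h.nonneg
    (show T < T + d by linarith) h.arrival h.service h.queue h.preMark h.mark hw
  refine ⟨hpath, Function.update cnt c (cnt c + 1), p.1.2, ?_⟩
  have hres : ∀ l u, Residual (y l) (cnt l) u (p.2 l) →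
      Residual (y l) (Function.update cnt c (cnt c + 1) l) (u + net.clockSpeed ρ b p.1 l * d)
        (advance (net.clockSpeed ρ b p.1) p.2 c l) := by
    intro l u hl
    by_cases hlc : l = c
    · subst hlc
      simp only [advance, if_true, Function.update_self, hcd]
      exact hl.shift (hy _)
    · simp only [advance, hlc, if_false, Function.update_of_ne hlc]
      exact hl.age (mul_nonneg (hv l) hd0.le) (hc.2 l hlc)
  refine ⟨by linarith [h.nonneg], fun j => ?_, fun j => ?_, fun j => ?_, fun j => ?_, fun j => rfl⟩
  · simpa [clockSpeed] using hres (Sum.inl j) _ (h.arrival j)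
  · have := hres (Sum.inr j) _ (h.service j)
    rwa [hB j, add_sub_cancel_left]
  · cases c with
    | inl k =>
      simp only [stateStep, queueStep]
      by_cases hjk : j = k
      · subst hjk
        simp [h.queue j]
        ring
      · simp [Function.update_of_ne, hjk, h.queue j]
    | inr k =>
      simp only [stateStep, queueStep]
      by_cases hjk : j = k
      · subst hjk
        have hq1 : 1 ≤ p.1.1 j := by
          rcases Nat.eq_zero_or_pos (p.1.1 j) with h0 | h0
          · have h1 := h.mark j
            rw [h0, Nat.cast_zero] at h1
            have h2 : newMark a b (ep j) 0 = true := by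
              unfold newMark
              split_ifs
              · exact decide_eq_true (by linarith)
              · exact decide_eq_true ha
            have h3 := hc.1
            simp [clockSpeed, h1, h2] at h3
          · exact h0
        simp [h.queue j, Nat.cast_sub hq1]
        ring
      · simp [Function.update_of_ne, hjk, h.queue j]
  · rw [h.mark j]
    exact ((h.preMark j).newMark hab h.nonneg (by linarith) fun u h1 h2 => hpath u h1 h2 j).1

/-- The queue lengths are those of the jump chain. -/
theorem path_eq_chainPath (hflow : ∀ σ j, 0 ≤ net.flow ρ σ j) (ha : 0 < a) (hab : a < b)
    {z : Fin J → Bool} {path : ℝ → Fin J → ℝ} {y : Fin J ⊕ Fin J → ℕ → ℝ} {n₀ : Fin J → ℕ}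
    (hy : ∀ c i, 0 < y c i)
    (hint : ∀ t, 0 ≤ t → ∀ j,
      IntervalIntegrable (fun s => net.allocation ρ a b z path s j) volume 0 t)
    (hq : ∀ t, 0 ≤ t → ∀ j, path t j = n₀ j + countingProcess (y (Sum.inl j)) t
      - countingProcess (y (Sum.inr j)) (∫ s in (0 : ℝ)..t, net.allocation ρ a b z path s j))
    (hwin : ∀ n, ∃ c, IsWinner (net.clockSpeed ρ b
      ((chainStep (net.clockSpeed ρ b) (stateStep a b))^[n] (initState a b n₀ z, y)).1)
      ((chainStep (net.clockSpeed ρ b) (stateStep a b))^[n] (initState a b n₀ z, y)).2 c)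
    (hhold : ∀ n, 0 ≤ holdTime (net.clockSpeed ρ b)
      ((chainStep (net.clockSpeed ρ b) (stateStep a b))^[n] (initState a b n₀ z, y)))
    (hring : ∀ t, ∃ n, t < ringTime (net.clockSpeed ρ b) (stateStep a b) n (initState a b n₀ z, y))
    (t : ℝ) (ht : 0 ≤ t) (j : Fin J) :
    path t j = (chainPath (net.clockSpeed ρ b) (stateStep a b) (initState a b n₀ z, y) t).1 j := by
  classical
  have htr : ∀ n, ∃ cnt ep, Tracks net ρ a b z path y n₀
      (ringTime (net.clockSpeed ρ b) (stateStep a b) n (initState a b n₀ z, y))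
      ((chainStep (net.clockSpeed ρ b) (stateStep a b))^[n] (initState a b n₀ z, y)) cnt ep := by
    intro n
    induction n with
    | zero =>
      refine ⟨0, z, ?_⟩
      rw [ringTime_zero]
      refine ⟨le_rfl, fun j => residual_zero (hy _), fun j => ?_, fun j => ?_,
        fun j => preMark_zero, fun j => rfl⟩
      · rw [intervalIntegral.integral_same]
        exact residual_zero (hy _)
      · simp [initState]
    | succ n ih =>
      obtain ⟨cnt, ep, h⟩ := ih
      obtain ⟨-, cnt', ep', h'⟩ := h.step hflow ha hab hy hint hq (hwin n)
      refine ⟨cnt', ep', ?_⟩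
      rw [ringTime_succ, Function.iterate_succ_apply']
      exact h'
  have hex := hring t
  obtain ⟨n, hn⟩ : ∃ n, Nat.find hex = n + 1 := by
    refine Nat.exists_eq_succ_of_ne_zero fun h0 => ?_
    have := Nat.find_spec hex
    rw [h0, ringTime_zero] at this
    linarith
  have h1 : ringTime (net.clockSpeed ρ b) (stateStep a b) n (initState a b n₀ z, y) ≤ t :=
    not_lt.1 (Nat.find_min hex (by omega))
  have h2 := Nat.find_spec hex
  rw [hn] at h2
  rw [chainPath_eq hhold h1 h2]
  obtain ⟨cnt, ep, h⟩ := htr n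
  rw [ringTime_succ] at h2
  exact (h.step hflow ha hab hy hint hq (hwin n)).1 t h1 h2 j

end Network

/-! ### The law of the primitive data -/

section ClockLaw

variable {J : ℕ} {Ω : Type*} [MeasurableSpace Ω] {P : Measure Ω} {lam mu : Fin J → ℝ}
  {η Δ : Fin J → ℕ → Ω → ℝ}

/-- All interarrival times and all amounts of work. -/
def allClocks (η Δ : Fin J → ℕ → Ω → ℝ) (ω : Ω) : Fin J ⊕ Fin J → ℕ → ℝ :=
  Sum.elim (fun j k => η j k ω) (fun j k => Δ j k ω)

lemma IsPrimitiveData.measurable_allClocks (h : IsPrimitiveData P lam mu η Δ) :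
    Measurable (allClocks η Δ) := by
  refine measurable_pi_iff.2 fun c => measurable_pi_iff.2 fun k => ?_
  cases c with
  | inl j => exact h.measurable_arrival j k
  | inr j => exact h.measurable_work j k

lemma IsPrimitiveData.map_clock (h : IsPrimitiveData P lam mu η Δ) (c : Fin J ⊕ Fin J) (k : ℕ) :
    P.map (fun ω => allClocks η Δ ω c k) = expMeasure (Sum.elim lam mu c) := by
  cases c with
  | inl j => exact h.law_arrival j k
  | inr j => exact h.law_work j k

/-- By independence the law of the family indexed by clock and number is an infinite product;
currying turns it into the product over the clocks of laws of sequences. -/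
lemma IsPrimitiveData.map_allClocks (h : IsPrimitiveData P lam mu η Δ)
    (hlam : ∀ j, 0 < lam j) (hmu : ∀ j, 0 < mu j) :
    P.map (allClocks η Δ) = clockLaw (Sum.elim lam mu) := by
  have hθ : ∀ c, 0 < (Sum.elim lam mu : Fin J ⊕ Fin J → ℝ) c := by
    rintro (j | j)
    exacts [hlam j, hmu j]
  have hp := fun c => isProbabilityMeasure_expMeasure (hθ c)
  have hp' := fun c => isProbabilityMeasure_expSeq (hθ c)
  have hinj : Function.Injective fun p : (Fin J ⊕ Fin J) × ℕ =>
      Sum.map (fun j => (j, p.2)) (fun j => (j, p.2)) p.1 := by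
    rintro ⟨c | c, k⟩ ⟨c' | c', k'⟩ hc <;> simp_all
  have h1 := h.indep.precomp hinj
  have h2 : (fun (p : (Fin J ⊕ Fin J) × ℕ) => (fun p : (Fin J × ℕ) ⊕ (Fin J × ℕ) =>
      Sum.elim (fun u => η u.1 u.2) (fun u => Δ u.1 u.2) p)
        (Sum.map (fun j => (j, p.2)) (fun j => (j, p.2)) p.1))
      = fun p ω => allClocks η Δ ω p.1 p.2 := by
    funext ⟨c, k⟩ ω
    cases c <;> rfl
  have hm : ∀ p : (Fin J ⊕ Fin J) × ℕ, Measurable fun ω => allClocks η Δ ω p.1 p.2 := fun p =>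
    (measurable_pi_apply _).comp ((measurable_pi_apply _).comp h.measurable_allClocks)
  have h3 : iIndepFun (fun (p : (Fin J ⊕ Fin J) × ℕ) ω => allClocks η Δ ω p.1 p.2) P := by
    rw [← h2]; exact h1
  have h4 := h3.map_fun_eq_infinitePi_map hm
  simp only [h.map_clock] at h4
  have h5 := Measure.infinitePi_map_curry
    (μ := fun (c : Fin J ⊕ Fin J) (_ : ℕ) => expMeasure (Sum.elim lam mu c))
  rw [← h4, Measure.map_map (MeasurableEquiv.measurable _) (measurable_pi_iff.2 hm)] at h5
  rw [clockLaw, ← Measure.infinitePi_eq_pi]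
  exact h5

lemma ae_expMeasure_pos {θ : ℝ} (hθ : 0 < θ) : ∀ᵐ x ∂expMeasure θ, 0 < x := by
  have := isProbabilityMeasure_expMeasure hθ
  have h := lintegral_expMeasure (θ := θ) (f := Set.indicator (Set.Iic 0) 1)
    (measurable_one.indicator measurableSet_Iic)
  rw [lintegral_indicator_one measurableSet_Iic, setLIntegral_eq_zero measurableSet_Ioi] at h
  · rw [ae_iff]
    simp only [not_lt]
    exact h
  · intro x hx
    simp [Set.indicator, not_le.2 (Set.mem_Ioi.1 hx)]

lemma IsPrimitiveData.ae_pos (h : IsPrimitiveData P lam mu η Δ)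
    (hlam : ∀ j, 0 < lam j) (hmu : ∀ j, 0 < mu j) :
    ∀ᵐ ω ∂P, ∀ c k, 0 < allClocks η Δ ω c k := by
  have hθ : ∀ c, 0 < (Sum.elim lam mu : Fin J ⊕ Fin J → ℝ) c := by
    rintro (j | j)
    exacts [hlam j, hmu j]
  refine ae_all_iff.2 fun c => ae_all_iff.2 fun k => ?_
  have hm : Measurable fun ω => allClocks η Δ ω c k :=
    (measurable_pi_apply _).comp ((measurable_pi_apply _).comp h.measurable_allClocks)
  have := ae_expMeasure_pos (hθ c)
  rw [← h.map_clock c k] at this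
  exact ae_of_ae_map hm.aemeasurable this

end ClockLaw

namespace Network

variable {I J m : ℕ} {net : Network I J} {ρ : Fin m → Fin J} {a b : ℝ}

lemma exists_clockSpeed_pos (j₀ : Fin J) (s : (Fin J → ℕ) × (Fin J → Bool)) :
    ∃ c, 0 < net.clockSpeed ρ b s c := ⟨Sum.inl j₀, one_pos⟩

lemma exists_sum_clockSpeed_le (hnet : net.IsLocalTraffic) (hl : ∀ j, 0 < net.load j)
    (hcap : net.C = net.K *ᵥ net.load) (hρ : net.IsViableRanking ρ) {lam mu : Fin J → ℝ}
    (hmu : ∀ j, 0 < mu j) : ∃ Λ, ∀ s, ∑ c, (Sum.elim lam mu c) * net.clockSpeed ρ b s c ≤ Λ := by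
  refine ⟨∑ j, lam j + ∑ j, mu j * (2 * net.load j), fun s => ?_⟩
  rw [Fintype.sum_sum_type]
  simp only [Sum.elim_inl, Sum.elim_inr, clockSpeed, mul_one]
  gcongr with j
  · exact (hmu j).le
  · split_ifs
    · linarith [hl j]
    · exact flow_le _ hnet hl hcap hρ j

/-- Almost surely the queue length process is the jump chain driven by the primitive data. -/
theorem ae_eq_chainPath (hnet : net.IsLocalTraffic) (hl : ∀ j, 0 < net.load j)
    (hcap : net.C = net.K *ᵥ net.load) (hρ : net.IsViableRanking ρ) (ha : 0 < a) (hab : a < b)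
    (j₀ : Fin J) {lam mu : Fin J → ℝ} (hlam : ∀ j, 0 < lam j) (hmu : ∀ j, 0 < mu j)
    {Ω : Type*} [MeasurableSpace Ω] {P : Measure Ω} {η Δ : Fin J → ℕ → Ω → ℝ}
    {Q : ℝ → Ω → Fin J → ℝ} {n₀ : Fin J → ℕ} {z : Fin J → Bool}
    (h : IsPrimitiveData P lam mu η Δ)
    (hQ : IsQueueProcess net ρ a b (fun j => n₀ j) z P η Δ Q) :
    ∀ᵐ ω ∂P, ∀ t, 0 ≤ t → ∀ j, Q t ω j = (chainPath (net.clockSpeed ρ b) (stateStep a b)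
      (initState a b n₀ z, allClocks η Δ ω) t).1 j := by
  have hθ : ∀ c, 0 < (Sum.elim lam mu : Fin J ⊕ Fin J → ℝ) c := by
    rintro (j | j)
    exacts [hlam j, hmu j]
  have hflow : ∀ σ j, 0 ≤ net.flow ρ σ j := fun σ j => flow_nonneg σ hnet hl hcap hρ j
  have hv := clockSpeed_nonneg (b := b) hflow
  have hv' := exists_clockSpeed_pos (net := net) (ρ := ρ) (b := b) j₀
  obtain ⟨Λ, hΛ⟩ := exists_sum_clockSpeed_le (b := b) (lam := lam) hnet hl hcap hρ hmu
  have hmap := h.map_allClocks hlam hmu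
  have haY := h.measurable_allClocks.aemeasurable (μ := P)
  have h1 := ae_all_iff.2 fun n => ae_iterate (jump := stateStep a b) hθ hv hv'
    (p := fun z => ∃ c, IsWinner (net.clockSpeed ρ b z.1) z.2 c)
    (measurableSet_exists_isWinner (net.clockSpeed ρ b))
    (fun s => ae_exists_isWinner hθ (hv s) (hv' s)) n (initState a b n₀ z)
  have h2 := ae_holdTime_iterate_nonneg (jump := stateStep a b) hθ hv hv' (initState a b n₀ z)
  have h3 := ae_forall_exists_lt_ringTime (jump := stateStep a b) hθ hv hv' hΛ (initState a b n₀ z)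
  rw [← hmap] at h1 h2 h3
  filter_upwards [ae_of_ae_map haY h1, ae_of_ae_map haY h2, ae_of_ae_map haY h3,
    hQ.integrable, hQ.queue_eq, h.ae_pos hlam hmu] with ω w1 w2 w3 w4 w5 w6 t ht j
  exact path_eq_chainPath hflow ha hab w6 w4 w5 w1 w2 (fun t => (w3 t).exists) t ht j

end Network

/-! ### A potential that pays for suspensions -/

section MarkCost

/-- A bounded function of the mark and the length of a queue, on which the generator is almost
`-1` while the queue is suspended and almost nonpositive else. -/
noncomputable def markCost (a b κ ν : ℝ) (e : Bool) (x : ℝ) : ℝ :=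
  if e then ν * (b + 1 - x) + 2 * ν * (b + 1) * Real.exp (-(κ * (b - a)))
  else 2 * ν * (b + 1) * Real.exp (-(κ * (x - a)))

variable {a b κ ν : ℝ}

lemma markCost_nonneg (hν : 0 ≤ ν) (hb : 0 ≤ b) {e : Bool} {x : ℝ}
    (h : if e then x < b else a ≤ x) : 0 ≤ markCost a b κ ν e x := by
  cases e with
  | true =>
    have h' : x < b := h
    have h1 : 0 ≤ b + 1 - x := by linarith
    simp only [markCost, if_true]
    positivity
  | false =>
    simp only [markCost, Bool.false_eq_true, if_false]
    positivity

/-- While the queue is suspended, each of the two terms is at most `ν (b + 1)`: the second by `he`.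
This is why the exponential carries the factor `2 ν (b + 1)`. -/
lemma markCost_le (hκ : 0 ≤ κ) (hν : 0 ≤ ν) (hb : 0 ≤ b)
    (he : Real.exp (-(κ * (b - a))) ≤ 1 / 2) {e : Bool} {x : ℝ} (hx : 0 ≤ x)
    (h : if e then x < b else a ≤ x) : markCost a b κ ν e x ≤ 2 * ν * (b + 1) := by
  have h0 : 0 ≤ 2 * ν * (b + 1) := by positivity
  cases e with
  | true =>
    simp only [markCost, if_true]
    nlinarith [mul_le_mul_of_nonneg_left he h0, mul_nonneg hν hx]
  | false =>
    have h' : a ≤ x := h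
    simp only [markCost, Bool.false_eq_true, if_false]
    refine mul_le_of_le_one_right h0 (Real.exp_le_one_iff.2 ?_)
    have := mul_nonneg hκ (sub_nonneg.2 h')
    linarith

lemma newMark_of_consistent {e : Bool} {x : ℝ} (h : if e then x < b else a ≤ x) :
    newMark a b e x = e := by
  cases e with
  | true => exact decide_eq_true h
  | false => exact decide_eq_false (not_lt.2 h)

lemma consistent_newMark (hab : a < b) (e : Bool) (x : ℝ) :
    if newMark a b e x then x < b else a ≤ x := by
  cases e with
  | true =>
    by_cases hx : x < b
    · simp [newMark, hx]
    · have : a ≤ x := by linarith [not_lt.1 hx]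
      simpa [newMark, hx] using this
  | false =>
    by_cases hx : x < a
    · have : x < b := by linarith
      simpa [newMark, hx] using this
    · simpa [newMark, hx] using not_lt.1 hx

/-- While the queue is suspended only arrivals occur. Each lowers the cost by at least `ν`, also the
one that ends the suspension, since `b + 1 - n ≥ 1` is lost there; as `1 ≤ ν * lam` the drift is at
most `-1`. Otherwise, below `b` the service rate is at most `lam * exp (-κ)`, so `exp (-κ x)` has
nonpositive drift; from `b` on the cost is below the exponentially small value at `b`. At a
depletion the new cost is at most the exponential continued below `a`, by `markCost_le`. -/
lemma markCost_generator_le (ha : 0 < a) (hab : a < b) (hκ : 0 ≤ κ) (hν : 0 ≤ ν)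
    (he : Real.exp (-(κ * (b - a))) ≤ 1 / 2) {e : Bool} {n : ℕ}
    (h : if e then (n : ℝ) < b else a ≤ n) {lam y k : ℝ} (hlam : 0 ≤ lam) (hνl : 1 ≤ ν * lam)
    (hy : 0 ≤ y) (hye : e = true → y = 0) (hyb : (n : ℝ) < b → y ≤ lam * Real.exp (-κ))
    (hk : y * Real.exp κ ≤ k) :
    lam * (markCost a b κ ν (newMark a b e (n + 1 : ℕ)) (n + 1 : ℕ) - markCost a b κ ν e n)
      + y * (markCost a b κ ν (newMark a b e (n - 1 : ℕ)) (n - 1 : ℕ) - markCost a b κ ν e n)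
      ≤ -(if e then 1 else 0) + k * (2 * ν * (b + 1) * Real.exp (-(κ * (b - a)))) := by
  have hb : 0 < b := ha.trans hab
  have hΓ : 0 ≤ 2 * ν * (b + 1) := by positivity
  set Γ := 2 * ν * (b + 1) with hΓd
  have hk0 : 0 ≤ k := le_trans (by positivity) hk
  set X := Real.exp (-(κ * (b - a))) with hX
  have hX0 : 0 < X := Real.exp_pos _
  have hkX : 0 ≤ k * (Γ * X) := by positivity
  cases e with
  | true =>
    have h' : (n : ℝ) < b := h
    rw [hye rfl, zero_mul, add_zero]
    have h1 : markCost a b κ ν (newMark a b true (n + 1 : ℕ)) (n + 1 : ℕ)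
        ≤ markCost a b κ ν true n - ν := by
      by_cases hn : ((n + 1 : ℕ) : ℝ) < b
      · rw [show newMark a b true (n + 1 : ℕ) = true from decide_eq_true hn]
        simp only [markCost, if_true]
        push_cast
        linarith
      · rw [show newMark a b true (n + 1 : ℕ) = false from decide_eq_false hn]
        simp only [markCost, if_true, Bool.false_eq_true, if_false]
        have h2 : Real.exp (-(κ * (((n + 1 : ℕ) : ℝ) - a))) ≤ X :=
          Real.exp_le_exp.2 (by nlinarith [not_lt.1 hn])
        have h3 := mul_le_mul_of_nonneg_left h2 hΓ
        nlinarith [mul_nonneg hν (sub_nonneg.2 h'.le)]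
    have h2 := mul_le_mul_of_nonneg_left h1 hlam
    simp only [if_true]
    nlinarith
  | false =>
    have h' : a ≤ n := h
    have hn1 : 1 ≤ n := by
      rcases Nat.eq_zero_or_pos n with h0 | h0
      · rw [h0, Nat.cast_zero] at h'; linarith
      · exact h0
    set Y := Real.exp (-(κ * ((n : ℝ) - a))) with hY
    have hY0 : 0 < Y := Real.exp_pos _
    have hm : markCost a b κ ν false n = Γ * Y := rfl
    have hup : markCost a b κ ν (newMark a b false (n + 1 : ℕ)) (n + 1 : ℕ)
        = Γ * Y * Real.exp (-κ) := by
      have : newMark a b false (n + 1 : ℕ) = false :=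
        decide_eq_false (by push_cast; linarith)
      rw [this]
      simp only [markCost, Bool.false_eq_true, if_false]
      rw [mul_assoc Γ Y, hY, ← Real.exp_add]
      congr 2
      push_cast
      ring
    have hdn : markCost a b κ ν (newMark a b false (n - 1 : ℕ)) (n - 1 : ℕ)
        ≤ Γ * Y * Real.exp κ := by
      have hcast : ((n - 1 : ℕ) : ℝ) = n - 1 := by push_cast [Nat.cast_sub hn1]; ring
      have hYe : Y * Real.exp κ = Real.exp (-(κ * ((n : ℝ) - 1 - a))) := by
        rw [hY, ← Real.exp_add]
        congr 1
        ring
      rw [mul_assoc, hYe, hcast]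
      by_cases hn : (n : ℝ) - 1 < a
      · rw [show newMark a b false ((n : ℝ) - 1) = true from decide_eq_true hn]
        have h1 : (1 : ℝ) ≤ Real.exp (-(κ * ((n : ℝ) - 1 - a))) :=
          Real.one_le_exp (by nlinarith)
        refine le_trans (markCost_le hκ hν hb.le he ?_ (by simp; linarith))
          (le_mul_of_one_le_right hΓ h1)
        have : (1 : ℝ) ≤ n := by exact_mod_cast hn1
        linarith
      · rw [show newMark a b false ((n : ℝ) - 1) = false from decide_eq_false hn]
        exact le_rfl
    rw [hm, hup]
    simp only [Bool.false_eq_true, if_false, neg_zero, zero_add]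
    have h2 := mul_le_mul_of_nonneg_left hdn hy
    have hΓY : 0 ≤ Γ * Y := by positivity
    have hee : Real.exp (-κ) * Real.exp κ = 1 := by rw [← Real.exp_add]; simp
    have hek : 1 ≤ Real.exp κ := Real.one_le_exp hκ
    have hek' : Real.exp (-κ) ≤ 1 := Real.exp_le_one_iff.2 (by linarith)
    by_cases hnb : (n : ℝ) < b
    · have h3 := hyb hnb
      -- The bound on the drift factors in this way, and `hyb` gives the sign of the last factor.
      have h4 : Γ * Y * ((Real.exp κ - 1) * (y - lam * Real.exp (-κ))) ≤ 0 :=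
        mul_nonpos_of_nonneg_of_nonpos hΓY
          (mul_nonpos_of_nonneg_of_nonpos (by linarith) (by linarith))
      have h5 : Γ * Y * ((Real.exp κ - 1) * (y - lam * Real.exp (-κ)))
          = lam * (Γ * Y * Real.exp (-κ) - Γ * Y * (Real.exp (-κ) * Real.exp κ))
            + y * (Γ * Y * Real.exp κ - Γ * Y) := by ring
      rw [hee] at h5
      linarith
    · have hYX : Y ≤ X := Real.exp_le_exp.2 (by nlinarith [not_lt.1 hnb])
      have h3 : lam * (Γ * Y * Real.exp (-κ) - Γ * Y) ≤ 0 :=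
        mul_nonpos_of_nonneg_of_nonpos hlam (by nlinarith)
      have h4 : Γ * Y * (y * Real.exp κ) ≤ Γ * X * k :=
        mul_le_mul (mul_le_mul_of_nonneg_left hYX hΓ) hk (by positivity) (by positivity)
      have h5 : 0 ≤ y * (Γ * Y) := by positivity
      nlinarith

end MarkCost

/-! ### The generator on mark costs and on pool work -/

namespace Network

variable {I J m : ℕ} {net : Network I J} {ρ : Fin m → Fin J} {a b : ℝ}

/-- The states whose marks agree with the thresholds. -/
def consistentStates (J : ℕ) (a b : ℝ) : Set ((Fin J → ℕ) × (Fin J → Bool)) :=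
  {s | ∀ j, if s.2 j then (s.1 j : ℝ) < b else a ≤ s.1 j}

/-- The time needed for the work of the job types in `A`. -/
noncomputable def poolWork (mu : Fin J → ℝ) (A : Finset (Fin J)) (q : Fin J → ℕ) : ℝ :=
  ∑ j ∈ A, (q j : ℝ) / mu j

/-- The sum of the mark costs of all queues. -/
noncomputable def totalMarkCost (a b κ ν : ℝ) (s : (Fin J → ℕ) × (Fin J → Bool)) : ℝ :=
  ∑ j, markCost a b κ ν (s.2 j) (s.1 j)

lemma stateStep_mem_consistentStates (hab : a < b) (s : (Fin J → ℕ) × (Fin J → Bool))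
    (c : Fin J ⊕ Fin J) : stateStep a b s c ∈ consistentStates J a b :=
  fun j => consistent_newMark hab (s.2 j) (queueStep s.1 c j)

lemma initState_mem_consistentStates (hab : a < b) (n : Fin J → ℕ) (z : Fin J → Bool) :
    initState a b n z ∈ consistentStates J a b :=
  fun j => consistent_newMark hab (z j) (n j)

lemma queueStep_of_ne (q : Fin J → ℕ) {c : Fin J ⊕ Fin J} {l : Fin J}
    (h : c ≠ Sum.inl l) (h' : c ≠ Sum.inr l) : queueStep q c l = q l := by
  cases c with
  | inl j =>
    have hj : l ≠ j := fun hl => h (by rw [hl])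
    simp [queueStep, Function.update_of_ne hj]
  | inr j =>
    have hj : l ≠ j := fun hl => h' (by rw [hl])
    simp [queueStep, Function.update_of_ne hj]

lemma stateStep_of_ne {s : (Fin J → ℕ) × (Fin J → Bool)} (hs : s ∈ consistentStates J a b)
    {c : Fin J ⊕ Fin J} {l : Fin J} (h : c ≠ Sum.inl l) (h' : c ≠ Sum.inr l) :
    (stateStep a b s c).1 l = s.1 l ∧ (stateStep a b s c).2 l = s.2 l := by
  have h1 := queueStep_of_ne s.1 h h'
  refine ⟨h1, ?_⟩
  simp only [stateStep, h1]
  exact newMark_of_consistent (hs l)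

lemma totalMarkCost_step {κ ν : ℝ} {s : (Fin J → ℕ) × (Fin J → Bool)}
    (hs : s ∈ consistentStates J a b) {c : Fin J ⊕ Fin J} {j : Fin J}
    (hc : c = Sum.inl j ∨ c = Sum.inr j) :
    totalMarkCost a b κ ν (stateStep a b s c) - totalMarkCost a b κ ν s
      = markCost a b κ ν ((stateStep a b s c).2 j) ((stateStep a b s c).1 j)
        - markCost a b κ ν (s.2 j) (s.1 j) := by
  rw [totalMarkCost, totalMarkCost, ← Finset.sum_sub_distrib]
  refine Finset.sum_eq_single_of_mem j (Finset.mem_univ j) fun l _ hl => ?_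
  have h1 : c ≠ Sum.inl l := by
    rintro rfl
    rcases hc with h | h
    exacts [hl (Sum.inl_injective h), Sum.inl_ne_inr h]
  have h2 : c ≠ Sum.inr l := by
    rintro rfl
    rcases hc with h | h
    exacts [Sum.inr_ne_inl h, hl (Sum.inr_injective h)]
  obtain ⟨h3, h4⟩ := stateStep_of_ne hs h1 h2
  rw [h3, h4, sub_self]

/-- The effect of the generator on the mark costs. -/
lemma totalMarkCost_generator_le (hflow : ∀ σ j, 0 ≤ net.flow ρ σ j) (ha : 0 < a) (hab : a < b)
    {κ ν k : ℝ} (hκ : 0 ≤ κ) (hν : 0 ≤ ν) (he : Real.exp (-(κ * (b - a))) ≤ 1 / 2)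
    {lam mu : Fin J → ℝ} (hlam : ∀ j, 0 ≤ lam j) (hmu : ∀ j, 0 ≤ mu j)
    (hνl : ∀ j, 1 ≤ ν * lam j)
    (hout : ∀ σ j, j ∉ σ → mu j * net.flow ρ σ j ≤ lam j * Real.exp (-κ))
    (hk : ∀ σ j, mu j * net.flow ρ σ j * Real.exp κ ≤ k) (hk0 : 0 ≤ k)
    {s : (Fin J → ℕ) × (Fin J → Bool)} (hs : s ∈ consistentStates J a b) :
    ∑ c, Sum.elim lam mu c * net.clockSpeed ρ b s c *
      (totalMarkCost a b κ ν (stateStep a b s c) - totalMarkCost a b κ ν s)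
      ≤ -(∑ j, if s.2 j then (1 : ℝ) else 0)
        + J * (k * (2 * ν * (b + 1) * Real.exp (-(κ * (b - a))))) := by
  rw [Fintype.sum_sum_type, ← Finset.sum_add_distrib, ← Finset.sum_neg_distrib]
  have hJ : (J : ℝ) * (k * (2 * ν * (b + 1) * Real.exp (-(κ * (b - a)))))
      = ∑ _j : Fin J, k * (2 * ν * (b + 1) * Real.exp (-(κ * (b - a)))) := by simp
  rw [hJ, ← Finset.sum_add_distrib]
  refine Finset.sum_le_sum fun j _ => ?_
  rw [totalMarkCost_step hs (Or.inl rfl), totalMarkCost_step hs (Or.inr rfl)]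
  simp only [Sum.elim_inl, Sum.elim_inr, stateStep, queueStep, Function.update_self]
  have hin : net.clockSpeed ρ b s (Sum.inl j) = 1 := rfl
  rw [hin, mul_one]
  refine markCost_generator_le ha hab hκ hν he (hs j) (hlam j) (hνl j)
    (mul_nonneg (hmu j) (clockSpeed_nonneg hflow s _)) (fun h => ?_) (fun h => ?_) ?_
  · simp [clockSpeed, h]
  · simp only [clockSpeed]
    split_ifs
    · simpa using mul_nonneg (hlam j) (Real.exp_pos _).le
    · exact hout _ j (by simpa using h)
  · simp only [clockSpeed]
    split_ifs
    · simpa using hk0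
    · exact hk _ j

lemma poolWork_nonneg {mu : Fin J → ℝ} (hmu : ∀ j, 0 < mu j) (A : Finset (Fin J))
    (q : Fin J → ℕ) : 0 ≤ poolWork mu A q :=
  Finset.sum_nonneg fun j _ => div_nonneg (Nat.cast_nonneg _) (hmu j).le

lemma poolWork_step_inl (mu : Fin J → ℝ) (A : Finset (Fin J)) (q : Fin J → ℕ) (j : Fin J) :
    poolWork mu A (queueStep q (Sum.inl j)) - poolWork mu A q
      = if j ∈ A then 1 / mu j else 0 := by
  rw [poolWork, poolWork, ← Finset.sum_sub_distrib, ← Finset.sum_ite_eq' A j fun j => 1 / mu j]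
  refine Finset.sum_congr rfl fun l _ => ?_
  by_cases hl : l = j
  · subst hl
    simp only [queueStep, Function.update_self, if_true]
    push_cast
    ring
  · simp [queueStep, hl]

lemma poolWork_step_inr (mu : Fin J → ℝ) (A : Finset (Fin J)) {q : Fin J → ℕ} {j : Fin J}
    (hj : 1 ≤ q j) :
    poolWork mu A (queueStep q (Sum.inr j)) - poolWork mu A q
      = if j ∈ A then -(1 / mu j) else 0 := by
  rw [poolWork, poolWork, ← Finset.sum_sub_distrib, ← Finset.sum_ite_eq' A j fun j => -(1 / mu j)]
  refine Finset.sum_congr rfl fun l _ => ?_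
  by_cases hl : l = j
  · subst hl
    simp only [queueStep, Function.update_self, if_true, Nat.cast_sub hj]
    push_cast
    ring
  · simp [queueStep, hl]

/-- A running service clock means that the queue is not suspended, so by consistency its length is
at least `a > 0`. -/
lemma one_le_of_clockSpeed_pos (ha : 0 < a) {s : (Fin J → ℕ) × (Fin J → Bool)}
    (hs : s ∈ consistentStates J a b) {j : Fin J} (h : 0 < net.clockSpeed ρ b s (Sum.inr j)) :
    1 ≤ s.1 j := by
  have h1 : s.2 j = false := by
    by_contra hne
    simp [clockSpeed, Bool.eq_true_of_not_eq_false hne] at h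
  have h2 := hs j
  rw [h1] at h2
  have h3 : a ≤ s.1 j := h2
  rcases Nat.eq_zero_or_pos (s.1 j) with h0 | h0
  · rw [h0, Nat.cast_zero] at h3; linarith
  · exact h0

lemma abs_poolWork_step_le (hflow : ∀ σ j, 0 ≤ net.flow ρ σ j) (ha : 0 < a)
    {mu : Fin J → ℝ} (hmu : ∀ j, 0 < mu j) {d : ℝ}
    (hd : ∀ j, 1 / mu j ≤ d) (A : Finset (Fin J)) {s : (Fin J → ℕ) × (Fin J → Bool)}
    (hs : s ∈ consistentStates J a b) {c : Fin J ⊕ Fin J} (hc : net.clockSpeed ρ b s c ≠ 0) :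
    |poolWork mu A (queueStep s.1 c) - poolWork mu A s.1| ≤ d := by
  have h0 : ∀ j, 0 < 1 / mu j := fun j => one_div_pos.2 (hmu j)
  cases c with
  | inl j =>
    rw [poolWork_step_inl]
    split_ifs
    · rw [abs_of_pos (h0 j)]; exact hd j
    · rw [abs_zero]; exact (h0 j).le.trans (hd j)
  | inr j =>
    rw [poolWork_step_inr _ _ (one_le_of_clockSpeed_pos ha hs
      (lt_of_le_of_ne (clockSpeed_nonneg hflow s _) hc.symm))]
    split_ifs
    · rw [abs_neg, abs_of_pos (h0 j)]; exact hd j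
    · rw [abs_zero]; exact (h0 j).le.trans (hd j)

/-- The effect of the generator on the work of the job types in `A`. -/
lemma poolWork_generator (hflow : ∀ σ j, 0 ≤ net.flow ρ σ j) (ha : 0 < a)
    {lam mu : Fin J → ℝ} (hmu : ∀ j, 0 < mu j) (A : Finset (Fin J))
    {s : (Fin J → ℕ) × (Fin J → Bool)} (hs : s ∈ consistentStates J a b) :
    ∑ c, Sum.elim lam mu c * net.clockSpeed ρ b s c *
      (poolWork mu A (queueStep s.1 c) - poolWork mu A s.1)
      = ∑ j ∈ A, (lam j / mu j - net.clockSpeed ρ b s (Sum.inr j)) := by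
  have h1 : ∀ j, mu j * net.clockSpeed ρ b s (Sum.inr j) *
      (poolWork mu A (queueStep s.1 (Sum.inr j)) - poolWork mu A s.1)
      = if j ∈ A then -net.clockSpeed ρ b s (Sum.inr j) else 0 := by
    intro j
    rcases (clockSpeed_nonneg (b := b) hflow s (Sum.inr j)).eq_or_lt with h | h
    · simp [← h]
    · rw [poolWork_step_inr _ _ (one_le_of_clockSpeed_pos ha hs h)]
      split_ifs
      · field_simp [(hmu j).ne']
      · simp
  have hin : ∀ j, net.clockSpeed ρ b s (Sum.inl j) = 1 := fun _ => rfl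
  rw [Fintype.sum_sum_type]
  simp only [Sum.elim_inl, Sum.elim_inr, h1, poolWork_step_inl, hin]
  rw [← Finset.sum_add_distrib]
  have h2 : ∑ j ∈ A, (lam j / mu j - net.clockSpeed ρ b s (Sum.inr j))
      = ∑ j, if j ∈ A then lam j / mu j - net.clockSpeed ρ b s (Sum.inr j) else 0 := by
    rw [Finset.sum_ite_mem, Finset.univ_inter]
  rw [h2]
  refine Finset.sum_congr rfl fun j _ => ?_
  split_ifs
  · ring
  · simp

end Network

/-! ### The Lyapunov function of the smallest pool -/

namespace Network

variable {I J m : ℕ} {net : Network I J} {ρ : Fin m → Fin J} {a b : ℝ}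

/-- Nominal and actual rates differ only at suspended queues, by at most `M` each. -/
lemma sum_service_ge (hflow : ∀ σ j, 0 ≤ net.flow ρ σ j) {M : ℝ}
    (hM : ∀ σ j, net.flow ρ σ j ≤ M) (A : Finset (Fin J)) (s : (Fin J → ℕ) × (Fin J → Bool)) :
    ∑ j ∈ A, net.flow ρ {l | b ≤ (s.1 l : ℝ)} j - M * ∑ j, (if s.2 j then (1 : ℝ) else 0)
      ≤ ∑ j ∈ A, net.clockSpeed ρ b s (Sum.inr j) := by
  have h1 : ∑ j ∈ A, (net.flow ρ {l | b ≤ (s.1 l : ℝ)} j - net.clockSpeed ρ b s (Sum.inr j))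
      ≤ ∑ j, M * (if s.2 j then (1 : ℝ) else 0) := by
    refine (Finset.sum_le_sum fun j _ => ?_).trans
      (Finset.sum_le_univ_sum_of_nonneg (s := A) (f := fun j => M * (if s.2 j then (1 : ℝ) else 0))
        fun j => ?_)
    · simp only [clockSpeed]
      split_ifs
      · simpa using hM _ j
      · simp
    · have := (hflow ∅ j).trans (hM ∅ j)
      split_ifs <;> simp [this]
  rw [Finset.sum_sub_distrib, ← Finset.mul_sum] at h1
  linarith

/-- The Lyapunov function for a quantity `Φ`. -/
noncomputable def lyapunov (a b κ ν M : ℝ) (Φ : (Fin J → ℕ) → ℝ)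
    (s : (Fin J → ℕ) × (Fin J → Bool)) : ℝ :=
  Φ s.1 ^ 2 + 2 * M * Φ s.1 * totalMarkCost a b κ ν s

lemma totalMarkCost_nonneg {κ ν : ℝ} (hν : 0 ≤ ν) (hb : 0 ≤ b)
    {s : (Fin J → ℕ) × (Fin J → Bool)} (hs : s ∈ consistentStates J a b) :
    0 ≤ totalMarkCost a b κ ν s :=
  Finset.sum_nonneg fun j _ => markCost_nonneg hν hb (hs j)

lemma totalMarkCost_le {κ ν : ℝ} (hκ : 0 ≤ κ) (hν : 0 ≤ ν) (hb : 0 ≤ b)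
    (he : Real.exp (-(κ * (b - a))) ≤ 1 / 2)
    {s : (Fin J → ℕ) × (Fin J → Bool)} (hs : s ∈ consistentStates J a b) :
    totalMarkCost a b κ ν s ≤ J * (2 * ν * (b + 1)) := by
  refine (Finset.sum_le_sum fun j _ => markCost_le hκ hν hb he (Nat.cast_nonneg _) (hs j)).trans ?_
  simp

/-- The effect of the generator on the Lyapunov function. -/
lemma lyapunov_generator_le {ι : Type*} [Finite ι] [Nonempty ι]
    (hflow : ∀ σ j, 0 ≤ net.flow ρ σ j) (ha : 0 < a) (hab : a < b)
    {κ ν k M d h Λ H : ℝ} (hκ : 0 ≤ κ) (hν : 0 ≤ ν) (he : Real.exp (-(κ * (b - a))) ≤ 1 / 2)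
    {lam mu : Fin J → ℝ} (hlam : ∀ j, 0 ≤ lam j) (hmu : ∀ j, 0 < mu j)
    (hνl : ∀ j, 1 ≤ ν * lam j)
    (hout : ∀ σ j, j ∉ σ → mu j * net.flow ρ σ j ≤ lam j * Real.exp (-κ))
    (hk : ∀ σ j, mu j * net.flow ρ σ j * Real.exp κ ≤ k) (hk0 : 0 ≤ k)
    (hM0 : 0 ≤ M) (hM : ∀ σ j, net.flow ρ σ j ≤ M) (hd : 0 ≤ d) (hh0 : 0 ≤ h)
    (hh : ∀ j, 1 / mu j ≤ h)
    (hΛ : ∀ s, ∑ c, Sum.elim lam mu c * net.clockSpeed ρ b s c ≤ Λ)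
    (hH : ∑ j, lam j / mu j ≤ H) (hload : ∑ j, |lam j / mu j - net.load j| ≤ d / 4)
    (hsmall : 2 * M * (J * (k * (2 * ν * (b + 1) * Real.exp (-(κ * (b - a)))))) ≤ d / 2)
    {A : ι → Finset (Fin J)}
    (hdrain : ∀ σ : Set (Fin J), (∀ i, ∃ j ∈ A i, j ∈ σ) →
      ∀ i, d ≤ ∑ j ∈ A i, (net.flow ρ σ j - net.load j))
    {s : (Fin J → ℕ) × (Fin J → Bool)} (hs : s ∈ consistentStates J a b) :
    ∑ c, Sum.elim lam mu c * net.clockSpeed ρ b s c *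
      (lyapunov a b κ ν M (fun q => ⨅ i, poolWork mu (A i) q) (stateStep a b s c)
        - lyapunov a b κ ν M (fun q => ⨅ i, poolWork mu (A i) q) s)
      + d * ⨅ i, poolWork mu (A i) s.1
      ≤ 2 * (J * (b * h)) * (H + d) + Λ * (h ^ 2 + 2 * M * h * (J * (2 * ν * (b + 1)))) := by
  have hb : 0 < b := ha.trans hab
  set Φ : (Fin J → ℕ) → ℝ := fun q => ⨅ i, poolWork mu (A i) q with hΦ
  have hΦ0 : ∀ q, 0 ≤ Φ q := fun q => Real.iInf_nonneg fun i => poolWork_nonneg hmu _ _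
  have hΦle : ∀ q i, Φ q ≤ poolWork mu (A i) q := fun q i => ciInf_le (Set.finite_range _).bddBelow i
  -- The minimum is followed along a pool `i` that attains it at `s`: after a jump `Φ` is at most
  -- the work of the same pool, whose change is linear in the queue lengths.
  obtain ⟨i, hi⟩ : ∃ i, poolWork mu (A i) s.1 = Φ s.1 :=
    exists_eq_ciInf_of_finite
  have hθ : ∀ c, 0 ≤ (Sum.elim lam mu : Fin J ⊕ Fin J → ℝ) c := by
    rintro (j | j)
    exacts [hlam j, (hmu j).le]
  set w : Fin J ⊕ Fin J → ℝ := fun c => Sum.elim lam mu c * net.clockSpeed ρ b s c with hw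
  have hw0 : ∀ c, 0 ≤ w c := fun c => mul_nonneg (hθ c) (clockSpeed_nonneg hflow s c)
  set Ψ := totalMarkCost a b κ ν (J := J) with hΨ
  set B := J * (2 * ν * (b + 1)) with hB
  set U : (Fin J → ℕ) → ℝ := poolWork mu (A i) with hU
  have hstep : ∀ c, w c * (lyapunov a b κ ν M Φ (stateStep a b s c) - lyapunov a b κ ν M Φ s)
      ≤ 2 * Φ s.1 * (w c * (U (queueStep s.1 c) - U s.1))
        + 2 * M * Φ s.1 * (w c * (Ψ (stateStep a b s c) - Ψ s))
        + w c * (h ^ 2 + 2 * M * h * B) := by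
    intro c
    by_cases hc : net.clockSpeed ρ b s c = 0
    · have : w c = 0 := by simp only [hw, hc, mul_zero]
      rw [this]
      simp
    have h1 := abs_poolWork_step_le hflow ha hmu hh (A i) hs hc
    rw [← hU] at h1
    have h2 : Φ (stateStep a b s c).1 ≤ U (queueStep s.1 c) := hΦle _ i
    have h3 := stateStep_mem_consistentStates hab s c
    have h4 := totalMarkCost_nonneg (κ := κ) hν hb.le h3
    have h5 := totalMarkCost_le hκ hν hb.le he h3
    rw [← hΨ] at h4 h5
    have h6 := hΦ0 (stateStep a b s c).1
    set δ := U (queueStep s.1 c) - U s.1 with hδ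
    have h7 : U (queueStep s.1 c) = Φ s.1 + δ := by rw [← hi]; ring
    rw [h7] at h2
    have hsq : Φ (stateStep a b s c).1 ^ 2 ≤ (Φ s.1 + δ) ^ 2 := pow_le_pow_left₀ h6 h2 2
    have hδ2 : δ ^ 2 ≤ h ^ 2 := sq_le_sq' (abs_le.1 h1).1 (abs_le.1 h1).2
    have hprod : Φ (stateStep a b s c).1 * Ψ (stateStep a b s c)
        ≤ Φ s.1 * Ψ (stateStep a b s c) + h * B := by
      have e1 := mul_le_mul_of_nonneg_right h2 h4
      have e2 : δ * Ψ (stateStep a b s c) ≤ h * B :=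
        (mul_le_mul_of_nonneg_right (abs_le.1 h1).2 h4).trans (mul_le_mul_of_nonneg_left h5 hh0)
      linarith
    have hprod' := mul_le_mul_of_nonneg_left hprod (mul_nonneg zero_le_two hM0)
    have key : lyapunov a b κ ν M Φ (stateStep a b s c) - lyapunov a b κ ν M Φ s
        ≤ 2 * Φ s.1 * δ + 2 * M * Φ s.1 * (Ψ (stateStep a b s c) - Ψ s)
          + (h ^ 2 + 2 * M * h * B) := by
      simp only [lyapunov, ← hΨ]
      linarith
    have := mul_le_mul_of_nonneg_left key (hw0 c)
    linarith
  have hsum := Finset.sum_le_sum fun c (_ : c ∈ Finset.univ) => hstep c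
  rw [Finset.sum_add_distrib, Finset.sum_add_distrib, ← Finset.mul_sum, ← Finset.mul_sum,
    ← Finset.sum_mul] at hsum
  have hgU : ∑ c, w c * (U (queueStep s.1 c) - U s.1)
      = ∑ j ∈ A i, (lam j / mu j - net.clockSpeed ρ b s (Sum.inr j)) :=
    poolWork_generator hflow ha hmu (A i) hs
  have hgΨ : ∑ c, w c * (Ψ (stateStep a b s c) - Ψ s) ≤ _ :=
    totalMarkCost_generator_le hflow ha hab hκ hν he hlam (fun j => (hmu j).le) hνl hout hk hk0 hs
  have hΛs : ∑ c, w c ≤ Λ := hΛ s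
  set susp := ∑ j, (if s.2 j then (1 : ℝ) else 0) with hsusp
  have hsusp0 : 0 ≤ susp := Finset.sum_nonneg fun j _ => by split_ifs <;> norm_num
  set E := J * (k * (2 * ν * (b + 1) * Real.exp (-(κ * (b - a))))) with hE
  have hΦs := hΦ0 s.1
  have hB0 : 0 ≤ B := by positivity
  have hJbh : 0 ≤ J * (b * h) := by positivity
  have hH0 : 0 ≤ H := le_trans (Finset.sum_nonneg fun j _ => div_nonneg (hlam j) (hmu j).le) hH
  -- If every pool has a stocked job type, the pool work has drift at most `-d`, up to `d / 4` for
  -- the rates of the prelimit network and `M` for each suspended queue. Otherwise all queues in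
  -- some pool are below `b`, so `Φ ≤ J * (b * h)` and crude bounds suffice.
  have hmain : 2 * Φ s.1 * ∑ c, w c * (U (queueStep s.1 c) - U s.1)
      ≤ 2 * Φ s.1 * (-(3 / 4 * d) + M * susp) + 2 * (J * (b * h)) * (H + d) := by
    rw [hgU]
    by_cases hlarge : ∀ i, ∃ j ∈ A i, b ≤ (s.1 j : ℝ)
    · have h1 := hdrain {l | b ≤ (s.1 l : ℝ)} hlarge i
      have h2 := sum_service_ge (b := b) hflow hM (A i) s
      rw [← hsusp] at h2
      have h3 : ∑ j ∈ A i, (lam j / mu j - net.load j) ≤ d / 4 :=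
        ((Finset.sum_le_sum fun j _ => le_abs_self _).trans
          (Finset.sum_le_univ_sum_of_nonneg fun j => abs_nonneg _)).trans hload
      rw [Finset.sum_sub_distrib] at h1 h3 ⊢
      have h4 : ∑ j ∈ A i, lam j / mu j - ∑ j ∈ A i, net.clockSpeed ρ b s (Sum.inr j)
          ≤ -(3 / 4 * d) + M * susp := by linarith
      have := mul_le_mul_of_nonneg_left h4 (mul_nonneg zero_le_two hΦs)
      have h5 : 0 ≤ 2 * (J * (b * h)) * (H + d) := by positivity
      linarith
    · push Not at hlarge
      obtain ⟨i', hi'⟩ := hlarge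
      have h1 : Φ s.1 ≤ J * (b * h) := by
        refine (hΦle s.1 i').trans ?_
        have : poolWork mu (A i') s.1 ≤ ∑ _j ∈ A i', b * h := by
          refine Finset.sum_le_sum fun j hj => ?_
          rw [div_eq_mul_one_div]
          exact mul_le_mul (hi' j hj).le (hh j) (one_div_pos.2 (hmu j)).le hb.le
        refine this.trans ?_
        rw [Finset.sum_const, nsmul_eq_mul]
        refine mul_le_mul_of_nonneg_right ?_ (by positivity)
        exact_mod_cast (Finset.card_le_univ _).trans_eq (Fintype.card_fin J)
      have h2 : ∑ j ∈ A i, (lam j / mu j - net.clockSpeed ρ b s (Sum.inr j)) ≤ H := by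
        refine le_trans ?_ hH
        refine (Finset.sum_le_sum fun j _ => ?_).trans
          (Finset.sum_le_univ_sum_of_nonneg fun j => div_nonneg (hlam j) (hmu j).le)
        linarith [clockSpeed_nonneg (b := b) hflow s (Sum.inr j)]
      have h3 := mul_le_mul_of_nonneg_left h2 (mul_nonneg zero_le_two hΦs)
      have h4 : Φ s.1 * (H + d) ≤ J * (b * h) * (H + d) :=
        mul_le_mul_of_nonneg_right h1 (by linarith)
      have h5 : 0 ≤ Φ s.1 * (M * susp) := by positivity
      have h6 : 0 ≤ Φ s.1 * d := by positivity
      linarith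
  -- The drift of the mark cost cancels `2 * M * Φ * susp`. Of the remaining `-(3 / 2) * d * Φ`, the
  -- exponentially small error consumes at most `d * Φ / 2`.
  have hΨmul := mul_le_mul_of_nonneg_left hgΨ (show 0 ≤ 2 * M * Φ s.1 by positivity)
  have hΛmul := mul_le_mul_of_nonneg_right hΛs
    (show 0 ≤ h ^ 2 + 2 * M * h * B by positivity)
  have hEmul := mul_le_mul_of_nonneg_left hsmall hΦs
  linarith

end Network

section Dynkin

variable {κ : Type*} [Fintype κ] {S : Type*} [MeasurableSpace S] [Countable S]
  [DiscreteMeasurableSpace S] {θ : κ → ℝ} {v : S → κ → ℝ} {jump : S → κ → S} {V f : S → ℝ} {k : ℝ}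
  {D : Set S}

/-- Dynkin's inequality on an invariant set. -/
lemma lintegral_chainPath_le_of_invariant (hθ : ∀ c, 0 < θ c) (hv : ∀ s c, 0 ≤ v s c)
    (hv' : ∀ s, ∃ c, 0 < v s c) {Λ : ℝ} (hΛ : ∀ s, ∑ c, θ c * v s c ≤ Λ)
    (hV : ∀ s ∈ D, 0 ≤ V s) (hf : ∀ s, 0 ≤ f s) (hk : 0 ≤ k)
    (hD : ∀ s ∈ D, ∀ c, jump s c ∈ D)
    (hgen : ∀ s ∈ D, ∑ c, θ c * v s c * (V (jump s c) - V s) + f s ≤ k)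
    {s : S} (hs : s ∈ D) {t : ℝ} (ht : 0 ≤ t) :
    ∫⁻ y, (ENNReal.ofReal (V (chainPath v jump (s, y) t))
      + ∫⁻ u in Set.Ico 0 t, ENNReal.ofReal (f (chainPath v jump (s, y) u))) ∂clockLaw θ
      ≤ ENNReal.ofReal (V s + k * t) := by
  -- Outside `D` the function `V` may be negative; its positive part agrees with it on `D`.
  have h := lintegral_chainPath_le (V := fun s => max (V s) 0) hθ hv hv' hΛ
    (fun s => le_max_right _ _) hf hk (fun s hs c _ => hD s hs c) (fun s hs => ?_) hs ht
  · simp only [ENNReal.ofReal_max, ENNReal.ofReal_zero, max_eq_left zero_le] at h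
    rwa [max_eq_left (hV s hs)] at h
  · simp only [max_eq_left (hV s hs), max_eq_left (hV _ (hD s hs _))]
    exact hgen s hs

end Dynkin

/-! ### Estimates uniform in the scaling parameter -/

namespace Network

variable {I J m : ℕ} {net : Network I J} {ρ : Fin m → Fin J}

lemma IsHeavyTraffic.load_pos {lamR muR : ℝ → Fin J → ℝ} {β : Fin J → ℝ}
    (h : net.IsHeavyTraffic lamR muR β) (j : Fin J) : 0 < net.load j :=
  div_pos (h.lam_pos j) (h.mu_pos j)

lemma exists_exp_neg_bound {lam x : Fin J → ℝ} (h : ∀ j, x j < lam j) :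
    ∃ κ > 0, ∀ j, x j < lam j * Real.exp (-κ) := by
  have h1 : ∀ j, ∀ᶠ κ : ℝ in 𝓝 0, x j < lam j * Real.exp (-κ) := by
    intro j
    have hc : Continuous fun κ : ℝ => lam j * Real.exp (-κ) := by fun_prop
    have := hc.tendsto 0
    simp only [neg_zero, Real.exp_zero, mul_one] at this
    exact this.eventually_const_lt (h j)
  have h2 := (eventually_all.2 h1).filter_mono (nhdsWithin_le_nhds (s := Set.Ioi 0))
  obtain ⟨κ, hκ, hκ0⟩ := (h2.and self_mem_nhdsWithin).exists
  exact ⟨κ, hκ0, hκ⟩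

lemma tendsto_affine_mul_exp_neg {κ c : ℝ} (hκ : 0 < κ) :
    Tendsto (fun x : ℝ => (c * x + 1) * Real.exp (-(κ * x))) atTop (𝓝 0) := by
  have h1 := tendsto_rpow_mul_exp_neg_mul_atTop_nhds_zero 1 κ hκ
  have h0 := tendsto_rpow_mul_exp_neg_mul_atTop_nhds_zero 0 κ hκ
  have := (h1.const_mul c).add h0
  simp only [Real.rpow_one, Real.rpow_zero, mul_zero, add_zero] at this
  refine this.congr fun x => ?_
  rw [neg_mul]
  ring

/-- The initial value is quadratic in `S` and `b + 1`, the rate of growth linear in `b + 1`. The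
mixed term in `S` and `b + 1` is absorbed by the square of a difference. -/
lemma lyapunov_bound_le {J h M ν H d Λ b S t L : ℝ} (hJ : 0 ≤ J) (hh : 0 ≤ h) (hM : 0 ≤ M)
    (hν : 0 ≤ ν) (hH : 0 ≤ H) (hd : 0 ≤ d) (hΛ : 0 ≤ Λ) (hb : 0 ≤ b) (ht : 0 ≤ t)
    (hL : L ≤ (h * S) ^ 2 + 2 * M * (h * S) * (J * (2 * ν * (b + 1)))) :
    L + (2 * (J * (b * h)) * (H + d) + Λ * (h ^ 2 + 2 * M * h * (J * (2 * ν * (b + 1))))) * t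
      ≤ (2 * h ^ 2 + (2 * M * J * ν) ^ 2 + 2 * J * h * (H + d) + Λ * h ^ 2
        + 4 * Λ * M * h * J * ν) * (S ^ 2 + (b + 1) ^ 2 + (b + 1) * t) := by
  have h3 := sq_nonneg (h * S - 2 * M * J * ν * (b + 1))
  have p1 : 0 ≤ S ^ 2 := sq_nonneg _
  have p2 : 0 ≤ (b + 1) ^ 2 := sq_nonneg _
  have p3 : 0 ≤ (b + 1) * t := by positivity
  have q0 : 0 ≤ 2 * J * h * (H + d) + Λ * h ^ 2 + 4 * Λ * M * h * J * ν := by positivity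
  have r1 := mul_nonneg (add_nonneg (sq_nonneg (2 * M * J * ν)) q0) p1
  have r2 := mul_nonneg (add_nonneg (show 0 ≤ 2 * h ^ 2 by positivity) q0) p2
  have r3 := mul_nonneg (show 0 ≤ 2 * h ^ 2 + (2 * M * J * ν) ^ 2 by positivity) p3
  have r4 : 0 ≤ (2 * J * h * (H + d) + Λ * h ^ 2 * b) * t := by positivity
  linarith

/-- The expected time integral of the smallest pool. -/
lemma lintegral_iInf_poolWork_le {ι : Type*} [Finite ι] [Nonempty ι] {a b : ℝ}
    (hflow : ∀ σ j, 0 ≤ net.flow ρ σ j) (ha : 0 < a) (hab : a < b) (j₀ : Fin J)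
    {κ ν k M d h Λ H : ℝ} (hκ : 0 ≤ κ) (hν : 0 ≤ ν) (he : Real.exp (-(κ * (b - a))) ≤ 1 / 2)
    {lam mu : Fin J → ℝ} (hlam : ∀ j, 0 < lam j) (hmu : ∀ j, 0 < mu j)
    (hνl : ∀ j, 1 ≤ ν * lam j)
    (hout : ∀ σ j, j ∉ σ → mu j * net.flow ρ σ j ≤ lam j * Real.exp (-κ))
    (hk : ∀ σ j, mu j * net.flow ρ σ j * Real.exp κ ≤ k) (hk0 : 0 ≤ k)
    (hM0 : 0 ≤ M) (hM : ∀ σ j, net.flow ρ σ j ≤ M) (hd : 0 < d) (hh0 : 0 ≤ h)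
    (hh : ∀ j, 1 / mu j ≤ h) (hΛ0 : 0 ≤ Λ)
    (hΛ : ∀ s, ∑ c, Sum.elim lam mu c * net.clockSpeed ρ b s c ≤ Λ) (hH0 : 0 ≤ H)
    (hH : ∑ j, lam j / mu j ≤ H) (hload : ∑ j, |lam j / mu j - net.load j| ≤ d / 4)
    (hsmall : 2 * M * (J * (k * (2 * ν * (b + 1) * Real.exp (-(κ * (b - a)))))) ≤ d / 2)
    {A : ι → Finset (Fin J)}
    (hdrain : ∀ σ : Set (Fin J), (∀ i, ∃ j ∈ A i, j ∈ σ) →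
      ∀ i, d ≤ ∑ j ∈ A i, (net.flow ρ σ j - net.load j))
    (n₀ : Fin J → ℕ) (z : Fin J → Bool) {t : ℝ} (ht : 0 ≤ t) :
    ∫⁻ y, (∫⁻ u in Set.Ico 0 t, ENNReal.ofReal (⨅ i, poolWork mu (A i)
        (chainPath (net.clockSpeed ρ b) (stateStep a b) (initState a b n₀ z, y) u).1))
        ∂clockLaw (Sum.elim lam mu)
      ≤ ENNReal.ofReal ((2 * h ^ 2 + (2 * M * J * ν) ^ 2 + 2 * J * h * (H + d) + Λ * h ^ 2
        + 4 * Λ * M * h * J * ν) / d * ((∑ j, (n₀ j : ℝ)) ^ 2 + (b + 1) ^ 2 + (b + 1) * t)) := by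
  have hb0 : 0 < b := ha.trans hab
  have hθ : ∀ c, 0 < (Sum.elim lam mu : Fin J ⊕ Fin J → ℝ) c := by
    rintro (j | j)
    exacts [hlam j, hmu j]
  set Φ : (Fin J → ℕ) → ℝ := fun q => ⨅ i, poolWork mu (A i) q with hΦ
  have hΦ0 : ∀ q, 0 ≤ Φ q := fun q => Real.iInf_nonneg fun i => poolWork_nonneg hmu _ _
  have hs0 := initState_mem_consistentStates hab n₀ z
  have hdyn := lintegral_chainPath_le_of_invariant (D := consistentStates J a b)
    (V := lyapunov a b κ ν M Φ) (f := fun s => d * Φ s.1)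
    (k := 2 * (J * (b * h)) * (H + d) + Λ * (h ^ 2 + 2 * M * h * (J * (2 * ν * (b + 1)))))
    hθ (clockSpeed_nonneg (b := b) hflow) (exists_clockSpeed_pos j₀) hΛ
    (fun s hs => add_nonneg (sq_nonneg _) (mul_nonneg (mul_nonneg (by positivity) (hΦ0 _))
      (totalMarkCost_nonneg hν hb0.le hs)))
    (fun s => mul_nonneg hd.le (hΦ0 _)) (by positivity)
    (fun s _ c => stateStep_mem_consistentStates hab s c)
    (fun s hs => lyapunov_generator_le hflow ha hab hκ hν he (fun j => (hlam j).le)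
      hmu hνl hout hk hk0 hM0 hM hd.le hh0 hh hΛ hH hload hsmall hdrain hs) hs0 ht
  set S := ∑ j, (n₀ j : ℝ) with hS
  have hS0 : 0 ≤ S := Finset.sum_nonneg fun j _ => Nat.cast_nonneg _
  have hΦS : Φ n₀ ≤ h * S := by
    obtain ⟨i⟩ := ‹Nonempty ι›
    refine (ciInf_le (Set.finite_range _).bddBelow i).trans ?_
    rw [hS, Finset.mul_sum]
    refine (Finset.sum_le_sum fun j _ => ?_).trans
      (Finset.sum_le_univ_sum_of_nonneg fun j => mul_nonneg hh0 (Nat.cast_nonneg _))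
    rw [div_eq_mul_one_div, mul_comm]
    exact mul_le_mul_of_nonneg_right (hh j) (Nat.cast_nonneg _)
  have hL : lyapunov a b κ ν M Φ (initState a b n₀ z)
      ≤ (h * S) ^ 2 + 2 * M * (h * S) * (J * (2 * ν * (b + 1))) := by
    refine add_le_add (pow_le_pow_left₀ (hΦ0 _) hΦS 2) ?_
    exact mul_le_mul (mul_le_mul_of_nonneg_left hΦS (by positivity))
      (totalMarkCost_le hκ hν hb0.le he hs0)
      (totalMarkCost_nonneg hν hb0.le hs0) (by positivity)
  have hfin := lyapunov_bound_le (Nat.cast_nonneg J) hh0 hM0 hν hH0 hd.le hΛ0 hb0.le ht hL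
  set C := 2 * h ^ 2 + (2 * M * J * ν) ^ 2 + 2 * J * h * (H + d) + Λ * h ^ 2
    + 4 * Λ * M * h * J * ν with hC
  have hall : ∫⁻ y, (∫⁻ u in Set.Ico 0 t, ENNReal.ofReal (d * Φ (chainPath (net.clockSpeed ρ b)
      (stateStep a b) (initState a b n₀ z, y) u).1)) ∂clockLaw (Sum.elim lam mu)
      ≤ ENNReal.ofReal (C * (S ^ 2 + (b + 1) ^ 2 + (b + 1) * t)) :=
    (lintegral_mono fun y => le_add_self).trans (hdyn.trans (ENNReal.ofReal_le_ofReal hfin))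
  simp only [ENNReal.ofReal_mul hd.le] at hall
  have hd' : ENNReal.ofReal d ≠ ∞ := ENNReal.ofReal_ne_top
  simp only [lintegral_const_mul' _ _ hd'] at hall
  rw [div_mul_eq_mul_div, ENNReal.ofReal_div_of_pos hd]
  rw [ENNReal.le_div_iff_mul_le (Or.inl (by simpa using hd)) (Or.inl hd'), mul_comm]
  exact hall

/-- In every subsystem which is drained while all its pools are stocked, the expected time integral
of the smallest pool is small. -/
theorem exists_lintegral_iInf_poolWork_le {ι : Type*} [Finite ι] [Nonempty ι]
    (hnet : net.IsLocalTraffic) {lamR muR : ℝ → Fin J → ℝ} {β : Fin J → ℝ}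
    (hHT : net.IsHeavyTraffic lamR muR β) (hρ : net.IsViableRanking ρ)
    {α c₁ c₂ : ℝ} (hα : 0 < α) (hc₁ : 0 < c₁) (hc₂ : c₁ < c₂) (j₀ : Fin J)
    {A : ι → Finset (Fin J)} {d : ℝ} (hd : 0 < d)
    (hdrain : ∀ σ : Set (Fin J), (∀ i, ∃ j ∈ A i, j ∈ σ) →
      ∀ i, d ≤ ∑ j ∈ A i, (net.flow ρ σ j - net.load j)) :
    ∃ C : ℝ, 0 ≤ C ∧ ∀ᶠ r : ℝ in atTop, ∀ (n₀ : Fin J → ℕ) (z : Fin J → Bool) (t : ℝ), 0 ≤ t →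
      ∫⁻ y, (∫⁻ u in Set.Ico 0 t, ENNReal.ofReal (⨅ i, poolWork (muR r) (A i)
        (chainPath (net.clockSpeed ρ (c₂ * r ^ α)) (stateStep (c₁ * r ^ α) (c₂ * r ^ α))
          (initState (c₁ * r ^ α) (c₂ * r ^ α) n₀ z, y) u).1))
        ∂clockLaw (Sum.elim (lamR r) (muR r))
      ≤ ENNReal.ofReal (C * ((∑ j, (n₀ j : ℝ)) ^ 2 + (c₂ * r ^ α + 1) ^ 2
          + (c₂ * r ^ α + 1) * t)) := by
  have hl := hHT.load_pos
  have hcap := hHT.capacity_eq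
  have hflow : ∀ σ j, 0 ≤ net.flow ρ σ j := fun σ j => flow_nonneg σ hnet hl hcap hρ j
  have hle_sum : ∀ f : Fin J → ℝ, (∀ j, 0 ≤ f j) → ∀ j, f j ≤ ∑ l, f l := fun f hf j =>
    Finset.single_le_sum (fun l _ => hf l) (Finset.mem_univ j)
  have hlam0 := hHT.lam_pos
  have hmu0 := hHT.mu_pos
  obtain ⟨c, hc, hcσ⟩ := exists_flow_le_of_notMem hnet hl hcap hρ
  have hlm : ∀ j, net.mu j * net.load j = net.lam j := fun j => by
    rw [load]; field_simp [(hmu0 j).ne']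
  obtain ⟨κ, hκ, hκlt⟩ := exists_exp_neg_bound (lam := net.lam)
    (x := fun j => net.mu j * (net.load j - c)) fun j => by
      have := mul_pos (hmu0 j) hc
      have := hlm j
      linarith
  -- The factors `2` leave room for the rates of the `r`-th network to differ from their limits, so
  -- that none of the constants depends on `r`.
  set ν := ∑ j, 2 / net.lam j with hν
  set h := ∑ j, 2 / net.mu j with hh
  set M := ∑ j, 2 * net.load j with hM
  set k := ∑ j, 2 * net.mu j * M * Real.exp κ with hk
  set Λ := ∑ j, 2 * net.lam j + ∑ j, 2 * net.mu j * M with hΛ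
  set H := ∑ j, 2 * net.lam j * h with hH
  have hν0 : 0 ≤ ν := Finset.sum_nonneg fun j _ => by have := hlam0 j; positivity
  have hh0 : 0 ≤ h := Finset.sum_nonneg fun j _ => by have := hmu0 j; positivity
  have hM0 : 0 ≤ M := Finset.sum_nonneg fun j _ => by have := hl j; positivity
  have hk0 : 0 ≤ k := Finset.sum_nonneg fun j _ => by have := hmu0 j; positivity
  have hΛ0 : 0 ≤ Λ := add_nonneg
    (Finset.sum_nonneg fun j _ => by have := hlam0 j; positivity)
    (Finset.sum_nonneg fun j _ => by have := hmu0 j; positivity)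
  have hH0 : 0 ≤ H := Finset.sum_nonneg fun j _ => by have := hlam0 j; positivity
  have hMle : ∀ σ j, net.flow ρ σ j ≤ M := fun σ j => (flow_le σ hnet hl hcap hρ j).trans
    (hle_sum (fun j => 2 * net.load j) (fun j => by have := hl j; positivity) j)
  have ev1 : ∀ᶠ r in atTop, ∀ j, net.lam j / 2 < lamR r j ∧ lamR r j < 2 * net.lam j :=
    eventually_all.2 fun j => by
      have := hlam0 j
      exact ((hHT.tendsto_lam j).eventually_const_lt (by linarith)).and
        ((hHT.tendsto_lam j).eventually_lt_const (by linarith))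
  have ev2 : ∀ᶠ r in atTop, ∀ j, net.mu j / 2 < muR r j ∧ muR r j < 2 * net.mu j :=
    eventually_all.2 fun j => by
      have := hmu0 j
      exact ((hHT.tendsto_mu j).eventually_const_lt (by linarith)).and
        ((hHT.tendsto_mu j).eventually_lt_const (by linarith))
  have ev3 : ∀ᶠ r in atTop, ∀ j, muR r j * (net.load j - c) < lamR r j * Real.exp (-κ) :=
    eventually_all.2 fun j => ((hHT.tendsto_mu j).mul_const _).eventually_lt
      ((hHT.tendsto_lam j).mul_const _) (hκlt j)
  have ev4 : ∀ᶠ r in atTop, ∑ j, |lamR r j / muR r j - net.load j| < d / 4 := by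
    have : Tendsto (fun r => ∑ j, |lamR r j / muR r j - net.load j|) atTop (𝓝 (∑ _j : Fin J, 0)) := by
      refine tendsto_finsetSum _ fun j _ => ?_
      have h1 := ((hHT.tendsto_lam j).div (hHT.tendsto_mu j) (hmu0 j).ne').sub_const (net.load j)
      have h2 := h1.abs
      simpa [load] using h2
    rw [Finset.sum_const_zero] at this
    exact this.eventually_lt_const (by linarith)
  have hX := tendsto_rpow_atTop hα
  have hcc : 0 < κ * (c₂ - c₁) := mul_pos hκ (by linarith)
  -- `b - a` is a multiple of `r ^ α`, so the exponential beats the linear factor `b + 1`.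
  have ev5 : ∀ᶠ r : ℝ in atTop, 2 * M * (J * (k * (2 * ν))) * ((c₂ * r ^ α + 1) *
      Real.exp (-(κ * (c₂ - c₁) * r ^ α))) < d / 2 := by
    have := ((tendsto_affine_mul_exp_neg (c := c₂) hcc).const_mul
      (2 * M * (J * (k * (2 * ν))))).comp hX
    rw [mul_zero] at this
    exact this.eventually_lt_const (by linarith)
  have ev6 : ∀ᶠ r : ℝ in atTop, (0 * r ^ α + 1) * Real.exp (-(κ * (c₂ - c₁) * r ^ α)) < 1 / 2 :=
    ((tendsto_affine_mul_exp_neg (c := 0) hcc).comp hX).eventually_lt_const (by norm_num)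
  refine ⟨(2 * h ^ 2 + (2 * M * J * ν) ^ 2 + 2 * J * h * (H + d) + Λ * h ^ 2
    + 4 * Λ * M * h * J * ν) / d, by positivity, ?_⟩
  filter_upwards [ev1, ev2, ev3, ev4, ev5, ev6, eventually_gt_atTop 0] with r e1 e2 e3 e4 e5 e6 hr
    n₀ z t ht
  have hrα : 0 < r ^ α := Real.rpow_pos_of_pos hr α
  set a := c₁ * r ^ α with ha
  set b := c₂ * r ^ α with hb
  have ha0 : 0 < a := mul_pos hc₁ hrα
  have hab : a < b := mul_lt_mul_of_pos_right hc₂ hrα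
  have hexp : κ * (b - a) = κ * (c₂ - c₁) * r ^ α := by rw [ha, hb]; ring
  rw [← hexp] at e5 e6
  rw [zero_mul, zero_add, one_mul] at e6
  have hlamR := hHT.lamR_pos r hr
  have hmuR := hHT.muR_pos r hr
  have hνl : ∀ j, 1 ≤ ν * lamR r j := fun j => by
    have h1 : 2 / net.lam j ≤ ν :=
      hle_sum (fun j => 2 / net.lam j) (fun j => by have := hlam0 j; positivity) j
    have h2 : 2 / net.lam j * (net.lam j / 2) = 1 := by field_simp [(hlam0 j).ne']
    rw [← h2]
    exact mul_le_mul h1 (e1 j).1.le (by have := hlam0 j; positivity) hν0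
  have hhR : ∀ j, 1 / muR r j ≤ h := fun j => by
    have h1 : 2 / net.mu j ≤ h :=
      hle_sum (fun j => 2 / net.mu j) (fun j => by have := hmu0 j; positivity) j
    refine le_trans ?_ h1
    rw [div_le_div_iff₀ (hmuR j) (hmu0 j)]
    linarith [(e2 j).1]
  have hout : ∀ σ j, j ∉ σ → muR r j * net.flow ρ σ j ≤ lamR r j * Real.exp (-κ) := fun σ j hj =>
    (mul_le_mul_of_nonneg_left (hcσ σ j hj) (hmuR j).le).trans (e3 j).le
  have hkR : ∀ σ j, muR r j * net.flow ρ σ j * Real.exp κ ≤ k := fun σ j => by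
    have h1 : 2 * net.mu j * M * Real.exp κ ≤ k :=
      hle_sum (fun j => 2 * net.mu j * M * Real.exp κ) (fun j => by have := hmu0 j; positivity) j
    refine le_trans ?_ h1
    refine mul_le_mul_of_nonneg_right ?_ (Real.exp_pos _).le
    exact mul_le_mul (e2 j).2.le (hMle σ j) (hflow σ j) (by have := hmu0 j; positivity)
  have hΛR : ∀ s, ∑ c, Sum.elim (lamR r) (muR r) c * net.clockSpeed ρ b s c ≤ Λ := fun s => by
    rw [Fintype.sum_sum_type]
    simp only [Sum.elim_inl, Sum.elim_inr]
    refine add_le_add (Finset.sum_le_sum fun j _ => ?_) (Finset.sum_le_sum fun j _ => ?_)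
    · rw [show net.clockSpeed ρ b s (Sum.inl j) = 1 from rfl, mul_one]
      exact (e1 j).2.le
    · refine mul_le_mul (e2 j).2.le ?_ (clockSpeed_nonneg hflow s _)
        (by have := hmu0 j; positivity)
      simp only [clockSpeed]
      split_ifs
      exacts [hM0, hMle _ j]
  have hHR : ∑ j, lamR r j / muR r j ≤ H := Finset.sum_le_sum fun j _ => by
    rw [div_eq_mul_one_div]
    exact mul_le_mul (e1 j).2.le (hhR j) (one_div_pos.2 (hmuR j)).le
      (by have := hlam0 j; positivity)
  have hsmall : 2 * M * (J * (k * (2 * ν * (b + 1) * Real.exp (-(κ * (b - a)))))) ≤ d / 2 := by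
    refine le_trans (le_of_eq ?_) e5.le
    ring
  exact lintegral_iInf_poolWork_le hflow ha0 hab j₀ hκ.le hν0 e6.le hlamR hmuR hνl hout hkR hk0
    hM0 hMle hd hh0 hhR hΛ0 hΛR hH0 hHR e4.le hsmall hdrain n₀ z ht

end Network

/-! ### The expected cost gap of the queue length process -/

namespace Network

variable {I J m : ℕ} {net : Network I J} {ρ : Fin m → Fin J}

/-- If `j` uses one resource only, every other job type uses another resource, because the sets `N`
are distinct and non-empty. So the column of `j` can be produced by `j` alone, at cost `h j`. -/
lemma notMem_single_of_mem_primary (hnet : net.IsLocalTraffic) (hmu : ∀ j, 0 < net.mu j)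
    {j : Fin J} (hj : j ∈ net.primary) : j ∉ net.single := by
  intro hs
  obtain ⟨i, hi⟩ := Finset.card_eq_one.1 hs
  suffices h : net.h j ≤ net.workloadCost (fun i => net.G i j) from not_lt.2 h hj
  have h0 : 0 ≤ (Pi.single j (1 / net.mu j) : Fin J → ℝ) :=
    Pi.single_nonneg.2 (one_div_pos.2 (hmu j)).le
  rw [workloadCost, image_queuesOf hmu, G_col]
  refine le_csInf ⟨_, _, ⟨h0, rfl⟩, rfl⟩ ?_
  rintro _ ⟨p, ⟨hp, hpK⟩, rfl⟩
  have hrow : ∀ i', ∑ l, net.K i' l * p l = net.K i' j * (1 / net.mu j) := fun i' => by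
    have := congrFun hpK i'
    rw [K_mulVec_apply, K_mulVec_apply] at this
    rw [this, Finset.sum_eq_single_of_mem j (Finset.mem_univ j) fun l _ hl => by simp [hl]]
    simp
  have hz : ∀ l, l ≠ j → p l = 0 := by
    intro l hl
    obtain ⟨i', hi', hne⟩ : ∃ i' ∈ net.N l, i' ≠ i := by
      by_contra! hall
      exact hl (hnet.injective (by
        rw [hi]
        exact (hnet.nonempty l).subset_singleton_iff.1
          fun i' hi' => Finset.mem_singleton.2 (hall i' hi')))
    have h1 : net.K i' j = 0 := by simp [K, hi, hne]
    have h2 := hrow i'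
    rw [h1, zero_mul, Finset.sum_eq_zero_iff_of_nonneg
      fun l _ => mul_nonneg (net.K_nonneg i' l) (hp l)] at h2
    simpa [K, hi'] using h2 l (Finset.mem_univ l)
  have h1 := hrow i
  rw [Finset.sum_eq_single_of_mem j (Finset.mem_univ j) fun l _ hl => by rw [hz l hl, mul_zero]]
    at h1
  have h2 : net.K i j = 1 := by simp [K, hi]
  rw [h2, one_mul, one_mul] at h1
  rw [cost, Finset.sum_eq_single_of_mem j (Finset.mem_univ j) fun l _ hl => by simp [hz l hl], h1]
  have := (hmu j).ne'
  field_simp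
  exact le_rfl

/-- The queue lengths at time `u` when the clocks are `y`. -/
noncomputable def queueAt (net : Network I J) (ρ : Fin m → Fin J) (a b : ℝ) (n₀ : Fin J → ℕ)
    (z : Fin J → Bool) (y : Fin J ⊕ Fin J → ℕ → ℝ) (u : ℝ) : Fin J → ℕ :=
  (chainPath (net.clockSpeed ρ b) (stateStep a b) (initState a b n₀ z, y) u).1

lemma measurable_queueAt (a b : ℝ) (n₀ : Fin J → ℕ) (z : Fin J → Bool) :
    Measurable fun p : (Fin J ⊕ Fin J → ℕ → ℝ) × ℝ => net.queueAt ρ a b n₀ z p.1 p.2 := by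
  have h : Measurable fun p : (Fin J ⊕ Fin J → ℕ → ℝ) × ℝ => ((initState a b n₀ z, p.1), p.2) :=
    (measurable_const.prodMk measurable_fst).prodMk measurable_snd
  exact measurable_fst.comp (measurable_chainPath.comp h)

lemma measurable_setLIntegral_queueAt (a b : ℝ) (n₀ : Fin J → ℕ) (z : Fin J → Bool) (t : ℝ)
    (f : (Fin J → ℕ) → ℝ≥0∞) :
    Measurable fun y => ∫⁻ u in Set.Ico 0 t, f (net.queueAt ρ a b n₀ z y u) :=
  Measurable.lintegral_prod_right' (f := fun p : (Fin J ⊕ Fin J → ℕ → ℝ) × ℝ =>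
    f (net.queueAt ρ a b n₀ z p.1 p.2)) (Measurable.of_discrete.comp (measurable_queueAt a b n₀ z))

/-- The expected queue lengths grow at most linearly. -/
lemma lintegral_queueAt_le (hnet : net.IsLocalTraffic) (hl : ∀ j, 0 < net.load j)
    (hcap : net.C = net.K *ᵥ net.load) (hρ : net.IsViableRanking ρ) (a b : ℝ)
    {lam mu : Fin J → ℝ} (hlam : ∀ j, 0 < lam j) (hmu : ∀ j, 0 < mu j) (n₀ : Fin J → ℕ)
    (z : Fin J → Bool) (j : Fin J) {t : ℝ} (ht : 0 ≤ t) :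
    ∫⁻ y, ENNReal.ofReal (net.queueAt ρ a b n₀ z y t j) ∂clockLaw (Sum.elim lam mu)
      ≤ ENNReal.ofReal (n₀ j + lam j * t) := by
  have hθ : ∀ c, 0 < (Sum.elim lam mu : Fin J ⊕ Fin J → ℝ) c := by
    rintro (j | j)
    exacts [hlam j, hmu j]
  have hflow : ∀ σ j, 0 ≤ net.flow ρ σ j := fun σ j => flow_nonneg σ hnet hl hcap hρ j
  obtain ⟨Λ, hΛ⟩ := exists_sum_clockSpeed_le (b := b) (lam := lam) hnet hl hcap hρ hmu
  -- Arrivals raise the length at rate `lam j`, and services never raise it.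
  have h := lintegral_chainPath_le_of_invariant (D := Set.univ) (jump := stateStep a b)
    (V := fun s => (s.1 j : ℝ)) (f := fun _ => 0) (k := lam j) hθ
    (clockSpeed_nonneg (b := b) hflow) (exists_clockSpeed_pos j) hΛ
    (fun s _ => Nat.cast_nonneg _) (fun _ => le_rfl) (hlam j).le (fun _ _ _ => trivial)
    (fun s _ => ?_) (Set.mem_univ (initState a b n₀ z)) ht
  · simp only [ENNReal.ofReal_zero, lintegral_zero, add_zero] at h
    exact h
  · rw [add_zero, Fintype.sum_sum_type]
    have h1 : ∑ l, Sum.elim lam mu (Sum.inl l) * net.clockSpeed ρ b s (Sum.inl l)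
        * (((stateStep a b s (Sum.inl l)).1 j : ℝ) - s.1 j) = lam j := by
      rw [Finset.sum_eq_single_of_mem j (Finset.mem_univ j)]
      · simp [clockSpeed, stateStep, queueStep]
      · intro l _ hlj
        simp [stateStep, queueStep, Function.update_of_ne hlj.symm]
    have h2 : ∑ l, Sum.elim lam mu (Sum.inr l) * net.clockSpeed ρ b s (Sum.inr l)
        * (((stateStep a b s (Sum.inr l)).1 j : ℝ) - s.1 j) ≤ 0 := by
      refine Finset.sum_nonpos fun l _ => mul_nonpos_of_nonneg_of_nonpos
        (mul_nonneg (hmu l).le (clockSpeed_nonneg hflow s _)) ?_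
      rw [sub_nonpos, Nat.cast_le]
      by_cases hlj : j = l
      · subst hlj
        simp [stateStep, queueStep]
      · simp [stateStep, queueStep, Function.update_of_ne hlj]
    linarith

open Classical in
/-- The cost gap in a queue length vector is bounded by the smallest pools. -/
lemma exists_cost_gap_le_iInf_poolWork (hnet : net.IsLocalTraffic) (hmu : ∀ j, 0 < net.mu j)
    (hρ : net.IsViableRanking ρ) :
    ∃ L > 0, ∀ (mu : Fin J → ℝ) (k : ℝ), 0 ≤ k → (∀ j, 0 < mu j ∧ mu j ≤ k) →
      ∀ q : Fin J → ℕ,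
      net.h ⬝ᵥ (fun j => (q j : ℝ)) - net.workloadCost (net.G *ᵥ fun j => (q j : ℝ))
        ≤ L * k * (∑ j : {j // j ∈ net.primary}, (⨅ _ : Unit, poolWork mu {j.1} q)
          + ∑ l, ⨅ i : {i // i ∈ net.N (ρ l)},
            poolWork mu {j | j ∈ net.zeta ρ i.1 l} q) := by
  obtain ⟨L, hL, hgap⟩ := exists_cost_gap_le hnet hmu hρ
  refine ⟨L, hL, fun mu k hk hmuk q => ?_⟩
  have hne : ∀ l, Nonempty {i // i ∈ net.N (ρ l)} := fun l => (hnet.nonempty (ρ l)).to_subtype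
  -- `exists_cost_gap_le` allows any choice of resources; the minimizing one turns the sums into
  -- minima over the pools.
  have hs : ∀ l, ∃ i : {i // i ∈ net.N (ρ l)},
      poolWork mu ({j | j ∈ net.zeta ρ i.1 l} : Finset (Fin J)) q
        = ⨅ i : {i // i ∈ net.N (ρ l)}, poolWork mu ({j | j ∈ net.zeta ρ i.1 l} : Finset (Fin J)) q :=
    fun l => exists_eq_ciInf_of_finite
  choose s hs using hs
  have hpool : ∀ A : Finset (Fin J), ∑ j ∈ A, (q j : ℝ) ≤ k * poolWork mu A q := by
    intro A
    rw [poolWork, Finset.mul_sum]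
    refine Finset.sum_le_sum fun j _ => ?_
    have h0 := (hmuk j).1
    calc (q j : ℝ) = mu j * (q j / mu j) := by field_simp
      _ ≤ k * (q j / mu j) := mul_le_mul_of_nonneg_right (hmuk j).2 (by positivity)
  refine (hgap (fun j => (q j : ℝ)) (fun j => Nat.cast_nonneg _) (fun l => (s l).1)
    fun l => (s l).2).trans ?_
  rw [mul_assoc, mul_add k, Finset.mul_sum, Finset.mul_sum]
  refine mul_le_mul_of_nonneg_left (add_le_add ?_ (Finset.sum_le_sum fun l _ => ?_)) hL.le
  · rw [Finset.sum_subtype (p := fun j => j ∈ net.primary) _ (fun j => by simp)]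
    refine Finset.sum_le_sum fun j _ => ?_
    rw [ciInf_const]
    simpa using hpool {j.1}
  · rw [← hs l]
    exact hpool _

end Network

namespace Network

variable {I J m : ℕ} {net : Network I J} {ρ : Fin m → Fin J}

/-- The difference between the holding costs and the workload cost of the queue lengths `q`. -/
noncomputable def costGap (net : Network I J) (q : Fin J → ℝ) : ℝ :=
  net.h ⬝ᵥ q - net.workloadCost (net.G *ᵥ q)

open Classical in
/-- The expected time integral of the cost gap. -/
theorem exists_lintegral_costGap_le (hnet : net.IsLocalTraffic) {lamR muR : ℝ → Fin J → ℝ}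
    {β : Fin J → ℝ} (hHT : net.IsHeavyTraffic lamR muR β) (hρ : net.IsViableRanking ρ)
    {α c₁ c₂ : ℝ} (hα : 0 < α) (hc₁ : 0 < c₁) (hc₂ : c₁ < c₂) (j₀ : Fin J) :
    ∃ C : ℝ, 0 ≤ C ∧ ∀ᶠ r : ℝ in atTop, ∀ (n₀ : Fin J → ℕ) (z : Fin J → Bool) (t : ℝ), 0 ≤ t →
      ∫⁻ y, (∫⁻ u in Set.Ico 0 t, ENNReal.ofReal (net.costGap fun j =>
        (net.queueAt ρ (c₁ * r ^ α) (c₂ * r ^ α) n₀ z y u j : ℝ)))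
        ∂clockLaw (Sum.elim (lamR r) (muR r))
      ≤ ENNReal.ofReal (C * ((∑ j, (n₀ j : ℝ)) ^ 2 + (c₂ * r ^ α + 1) ^ 2
          + (c₂ * r ^ α + 1) * t)) := by
  have hl := hHT.load_pos
  have hcap := hHT.capacity_eq
  obtain ⟨L, hL, hgap⟩ := exists_cost_gap_le_iInf_poolWork hnet hHT.mu_pos hρ
  have hP : ∀ j : {j // j ∈ net.primary}, ∃ C : ℝ, 0 ≤ C ∧ ∀ᶠ r : ℝ in atTop,
      ∀ (n₀ : Fin J → ℕ) (z : Fin J → Bool) (t : ℝ), 0 ≤ t →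
      ∫⁻ y, (∫⁻ u in Set.Ico 0 t, ENNReal.ofReal (⨅ _ : Unit, poolWork (muR r) {j.1}
        (net.queueAt ρ (c₁ * r ^ α) (c₂ * r ^ α) n₀ z y u)))
        ∂clockLaw (Sum.elim (lamR r) (muR r))
      ≤ ENNReal.ofReal (C * ((∑ j, (n₀ j : ℝ)) ^ 2 + (c₂ * r ^ α + 1) ^ 2
          + (c₂ * r ^ α + 1) * t)) := fun j => by
    -- A primary job type forms a subsystem with a single pool, which is drained whenever it is
    -- stocked.
    have hd : 0 < 2 ^ (m + 2) * net.rateUnit m :=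
      mul_pos (by positivity) (rateUnit_pos j₀ hl m)
    refine exists_lintegral_iInf_poolWork_le (ι := Unit) hnet hHT hρ hα hc₁ hc₂ j₀ hd
      fun σ hσ _ => ?_
    obtain ⟨l, hl1, hl2⟩ := hσ ()
    rw [Finset.mem_singleton.1 hl1] at hl2
    rw [Finset.sum_singleton, flow_primary_of_mem σ hρ j.2
      (notMem_single_of_mem_primary hnet hHT.mu_pos j.2) hl2, add_sub_cancel_left]
  have hM : ∀ k : Fin m, ∃ C : ℝ, 0 ≤ C ∧ ∀ᶠ r : ℝ in atTop,
      ∀ (n₀ : Fin J → ℕ) (z : Fin J → Bool) (t : ℝ), 0 ≤ t →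
      ∫⁻ y, (∫⁻ u in Set.Ico 0 t, ENNReal.ofReal (⨅ i : {i // i ∈ net.N (ρ k)},
        poolWork (muR r) {j | j ∈ net.zeta ρ i.1 k}
        (net.queueAt ρ (c₁ * r ^ α) (c₂ * r ^ α) n₀ z y u)))
        ∂clockLaw (Sum.elim (lamR r) (muR r))
      ≤ ENNReal.ofReal (C * ((∑ j, (n₀ j : ℝ)) ^ 2 + (c₂ * r ^ α + 1) ^ 2
          + (c₂ * r ^ α + 1) * t)) := fun k => by
    have : Nonempty {i // i ∈ net.N (ρ k)} := (hnet.nonempty (ρ k)).to_subtype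
    -- The pools belonging to `ρ k` are the sets `ζ_i^k` for `i ∈ N (ρ k)`. If all are stocked, each
    -- is drained by `rateUnit_le_sum_zeta`.
    refine exists_lintegral_iInf_poolWork_le hnet hHT hρ hα hc₁ hc₂ j₀ (rateUnit_pos j₀ hl m)
      fun σ hσ i => ?_
    refine rateUnit_le_sum_zeta σ hnet hl hcap hρ (fun i' hi' => ?_) i.2
    obtain ⟨j, hj1, hj2⟩ := hσ ⟨i', hi'⟩
    exact ⟨j, by simpa using hj1, hj2⟩
  choose CP hCP0 hCP using hP
  choose CM hCM0 hCM using hM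
  set K := ∑ j, 2 * net.mu j with hK
  have hK0 : 0 ≤ K := Finset.sum_nonneg fun j _ => by have := hHT.mu_pos j; positivity
  have evK : ∀ᶠ r in atTop, ∀ j, muR r j ≤ K := eventually_all.2 fun j => by
    have h0 := hHT.mu_pos j
    have h1 : 2 * net.mu j ≤ K := Finset.single_le_sum (f := fun j => 2 * net.mu j)
      (fun l _ => by have := hHT.mu_pos l; positivity) (Finset.mem_univ j)
    filter_upwards [(hHT.tendsto_mu j).eventually_lt_const (show net.mu j < 2 * net.mu j by linarith)]
      with r hr using hr.le.trans h1
  have hLK : 0 ≤ L * K := mul_nonneg hL.le hK0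
  refine ⟨L * K * (∑ j, CP j + ∑ k, CM k), mul_nonneg hLK (add_nonneg
    (Finset.sum_nonneg fun j _ => hCP0 j) (Finset.sum_nonneg fun k _ => hCM0 k)), ?_⟩
  filter_upwards [eventually_all.2 hCP, eventually_all.2 hCM, evK, eventually_gt_atTop 0] with
    r h1 h2 h3 hr n₀ z t ht
  have hmuR := hHT.muR_pos r hr
  set q := net.queueAt ρ (c₁ * r ^ α) (c₂ * r ^ α) n₀ z with hq
  set X := (∑ j, (n₀ j : ℝ)) ^ 2 + (c₂ * r ^ α + 1) ^ 2 + (c₂ * r ^ α + 1) * t with hX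
  have hX0 : 0 ≤ X := by
    have : 0 < r ^ α := Real.rpow_pos_of_pos hr α
    have : 0 < c₂ := hc₁.trans hc₂
    positivity
  have hmeas : ∀ f : (Fin J → ℕ) → ℝ≥0∞, Measurable fun y => ∫⁻ u in Set.Ico 0 t, f (q y u) :=
    fun f => measurable_setLIntegral_queueAt _ _ n₀ z t f
  have hmeas' : ∀ (f : (Fin J → ℕ) → ℝ≥0∞) (y), Measurable fun u => f (q y u) := fun f y =>
    Measurable.of_discrete.comp ((measurable_queueAt _ _ n₀ z).comp measurable_prodMk_left)
  set fP : {j // j ∈ net.primary} → (Fin J → ℕ) → ℝ := fun j q =>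
    ⨅ _ : Unit, poolWork (muR r) {j.1} q with hfP
  set fM : Fin m → (Fin J → ℕ) → ℝ := fun k q => ⨅ i : {i // i ∈ net.N (ρ k)},
        poolWork (muR r) {j | j ∈ net.zeta ρ i.1 k} q with hfM
  have hfP0 : ∀ j q, 0 ≤ fP j q := fun j q => Real.iInf_nonneg fun _ => poolWork_nonneg hmuR _ _
  have hfM0 : ∀ k q, 0 ≤ fM k q := fun j q => Real.iInf_nonneg fun _ => poolWork_nonneg hmuR _ _
  have hpt : ∀ n : Fin J → ℕ, ENNReal.ofReal (net.costGap fun j => (n j : ℝ))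
      ≤ ENNReal.ofReal (L * K) * (∑ j, ENNReal.ofReal (fP j n) + ∑ k, ENNReal.ofReal (fM k n)) := by
    intro n
    rw [← ENNReal.ofReal_sum_of_nonneg fun j _ => hfP0 j n,
      ← ENNReal.ofReal_sum_of_nonneg fun j _ => hfM0 j n,
      ← ENNReal.ofReal_add (Finset.sum_nonneg fun j _ => hfP0 j n)
        (Finset.sum_nonneg fun j _ => hfM0 j n), ← ENNReal.ofReal_mul hLK]
    exact ENNReal.ofReal_le_ofReal (hgap (muR r) K hK0 (fun j => ⟨hmuR j, h3 j⟩) n)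
  calc ∫⁻ y, (∫⁻ u in Set.Ico 0 t, ENNReal.ofReal (net.costGap fun j => (q y u j : ℝ)))
        ∂clockLaw (Sum.elim (lamR r) (muR r))
      ≤ ∫⁻ y, (∫⁻ u in Set.Ico 0 t, ENNReal.ofReal (L * K) *
          (∑ j, ENNReal.ofReal (fP j (q y u)) + ∑ k, ENNReal.ofReal (fM k (q y u))))
        ∂clockLaw (Sum.elim (lamR r) (muR r)) :=
        lintegral_mono fun y => lintegral_mono fun u => hpt (q y u)
    _ = ENNReal.ofReal (L * K) *
        (∑ j, ∫⁻ y, (∫⁻ u in Set.Ico 0 t, ENNReal.ofReal (fP j (q y u)))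
            ∂clockLaw (Sum.elim (lamR r) (muR r))
          + ∑ k, ∫⁻ y, (∫⁻ u in Set.Ico 0 t, ENNReal.ofReal (fM k (q y u)))
            ∂clockLaw (Sum.elim (lamR r) (muR r))) := by
        have e1 : ∀ y, ∫⁻ u in Set.Ico 0 t, ENNReal.ofReal (L * K) *
            (∑ j, ENNReal.ofReal (fP j (q y u)) + ∑ k, ENNReal.ofReal (fM k (q y u)))
            = ENNReal.ofReal (L * K) * (∑ j, (∫⁻ u in Set.Ico 0 t, ENNReal.ofReal (fP j (q y u)))
              + ∑ k, ∫⁻ u in Set.Ico 0 t, ENNReal.ofReal (fM k (q y u))) := by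
          intro y
          rw [lintegral_const_mul' _ _ ENNReal.ofReal_ne_top, lintegral_add_left
            (Finset.measurable_sum _ fun j _ => hmeas' (fun n => ENNReal.ofReal (fP j n)) y),
            lintegral_finsetSum _ fun j _ => hmeas' (fun n => ENNReal.ofReal (fP j n)) y,
            lintegral_finsetSum _ fun j _ => hmeas' (fun n => ENNReal.ofReal (fM j n)) y]
        simp only [e1]
        rw [lintegral_const_mul' _ _ ENNReal.ofReal_ne_top, lintegral_add_left
            (Finset.measurable_sum _ fun j _ => hmeas (fun n => ENNReal.ofReal (fP j n))),
            lintegral_finsetSum _ fun j _ => hmeas (fun n => ENNReal.ofReal (fP j n)),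
            lintegral_finsetSum _ fun j _ => hmeas (fun n => ENNReal.ofReal (fM j n))]
    _ ≤ ENNReal.ofReal (L * K) * (∑ j, ENNReal.ofReal (CP j * X) + ∑ k, ENNReal.ofReal (CM k * X)) := by
        gcongr with j _ k _
        · exact h1 j n₀ z t ht
        · exact h2 k n₀ z t ht
    _ = ENNReal.ofReal (L * K * (∑ j, CP j + ∑ k, CM k) * X) := by
        rw [← ENNReal.ofReal_sum_of_nonneg fun j _ => mul_nonneg (hCP0 j) hX0,
          ← ENNReal.ofReal_sum_of_nonneg fun j _ => mul_nonneg (hCM0 j) hX0,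
          ← ENNReal.ofReal_add (Finset.sum_nonneg fun j _ => mul_nonneg (hCP0 j) hX0)
          (Finset.sum_nonneg fun j _ => mul_nonneg (hCM0 j) hX0), ← ENNReal.ofReal_mul hLK,
          ← Finset.sum_mul, ← Finset.sum_mul, ← add_mul, mul_assoc (L * K)]

end Network

/-! ### From time integrals to discounted and average costs -/

section Costs

lemma setLIntegral_Ioi_exp_mul_affine {θ c d a : ℝ} (hθ : 0 < θ) (hc : 0 ≤ c) (hd : 0 ≤ d)
    (ha : 0 ≤ a) :
    ∫⁻ t in Set.Ioi a, ENNReal.ofReal (θ * Real.exp (-θ * t) * (c + d * t))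
      = ENNReal.ofReal (Real.exp (-θ * a) * (c + d / θ + d * a)) := by
  set F : ℝ → ℝ := fun t => -(Real.exp (-θ * t) * (c + d / θ + d * t)) with hF
  have hderiv : ∀ t ∈ Set.Ici a, HasDerivAt F (θ * Real.exp (-θ * t) * (c + d * t)) t := by
    intro t _
    have h1 : HasDerivAt (fun t => Real.exp (-θ * t)) (Real.exp (-θ * t) * (-θ)) t := by
      have := ((hasDerivAt_id t).const_mul (-θ)).exp
      simpa using this
    have h2 : HasDerivAt (fun t => c + d / θ + d * t) d t := by
      have := ((hasDerivAt_id t).const_mul d).const_add (c + d / θ)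
      simpa using this
    convert! (h1.mul h2).neg using 1
    field_simp
    ring
  have hpos : ∀ t ∈ Set.Ioi a, 0 ≤ θ * Real.exp (-θ * t) * (c + d * t) := by
    intro t ht
    have : 0 ≤ t := ha.trans (le_of_lt ht)
    positivity
  have hlim : Tendsto F atTop (𝓝 0) := by
    have h0 := tendsto_rpow_mul_exp_neg_mul_atTop_nhds_zero 0 θ hθ
    have h1 := tendsto_rpow_mul_exp_neg_mul_atTop_nhds_zero 1 θ hθ
    have := ((h0.const_mul (c + d / θ)).add (h1.const_mul d)).neg
    simp only [Real.rpow_one, Real.rpow_zero, mul_zero, add_zero, neg_zero] at this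
    refine this.congr fun t => ?_
    simp only [hF]
    ring
  rw [← ofReal_integral_eq_lintegral_ofReal
    (integrableOn_Ioi_deriv_of_nonneg' hderiv hpos hlim)
    ((ae_restrict_iff' measurableSet_Ioi).2 (Eventually.of_forall hpos)),
    integral_Ioi_of_hasDerivAt_of_nonneg' hderiv hpos hlim]
  congr 1
  simp only [hF]
  ring

/-- The discount factor is a mixture of indicators: `exp (-θ t)` is the integral of `θ exp (-θ T)`
over `T > t`. By Tonelli's theorem the bounds on `[0, T)` are averaged over `T`. -/
lemma setLIntegral_exp_mul_le {θ c d : ℝ} (hθ : 0 < θ) (hc : 0 ≤ c) (hd : 0 ≤ d) {φ : ℝ → ℝ≥0∞}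
    (hφ : Measurable φ)
    (h : ∀ T, 0 ≤ T → ∫⁻ t in Set.Ico 0 T, φ t ≤ ENNReal.ofReal (c + d * T)) :
    ∫⁻ t in Set.Ioi 0, ENNReal.ofReal (Real.exp (-θ * t)) * φ t ≤ ENNReal.ofReal (c + d / θ) := by
  set w : ℝ → ℝ≥0∞ := fun T => ENNReal.ofReal (θ * Real.exp (-θ * T)) with hw
  have hwm : Measurable w := by fun_prop
  have h1 : ∀ t ∈ Set.Ioi (0 : ℝ), ENNReal.ofReal (Real.exp (-θ * t)) * φ t
      = ∫⁻ T in Set.Ioi 0, (Set.Ioi t).indicator w T * φ t := by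
    intro t ht
    rw [lintegral_mul_const _ (hwm.indicator measurableSet_Ioi),
      setLIntegral_indicator measurableSet_Ioi, Set.inter_eq_left.2 (Set.Ioi_subset_Ioi ht.le)]
    have := setLIntegral_Ioi_exp_mul_affine (c := 1) (d := 0) (a := t) hθ zero_le_one le_rfl ht.le
    simp only [zero_mul, add_zero, mul_one, zero_div] at this
    rw [this]
  have h2 : Measurable (Function.uncurry fun t T : ℝ => (Set.Ioi t).indicator w T * φ t) := by
    refine Measurable.mul ?_ (hφ.comp measurable_fst)
    have : (fun p : ℝ × ℝ => (Set.Ioi p.1).indicator w p.2)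
        = {p : ℝ × ℝ | p.1 < p.2}.indicator fun p => w p.2 := by
      ext p
      simp only [Set.indicator, Set.mem_Ioi, Set.mem_ofPred_eq]
    rw [this]
    exact (hwm.comp measurable_snd).indicator (measurableSet_lt measurable_fst measurable_snd)
  rw [setLIntegral_congr_fun measurableSet_Ioi h1, lintegral_lintegral_swap h2.aemeasurable]
  have h3 : ∀ T ∈ Set.Ioi (0 : ℝ), ∫⁻ t in Set.Ioi 0, (Set.Ioi t).indicator w T * φ t
      ≤ ENNReal.ofReal (θ * Real.exp (-θ * T) * (c + d * T)) := by
    intro T hT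
    have e : ∀ t, (Set.Ioi t).indicator w T * φ t = w T * (Set.Iio T).indicator φ t := by
      intro t
      by_cases htT : t < T
      · rw [Set.indicator_of_mem (Set.mem_Ioi.2 htT), Set.indicator_of_mem (Set.mem_Iio.2 htT)]
      · rw [Set.indicator_of_notMem (by simpa using htT),
          Set.indicator_of_notMem (by simpa using htT), zero_mul, mul_zero]
    simp only [e]
    rw [lintegral_const_mul' _ _ ENNReal.ofReal_ne_top, setLIntegral_indicator measurableSet_Iio,
      show ENNReal.ofReal (θ * Real.exp (-θ * T) * (c + d * T)) = w T * ENNReal.ofReal (c + d * T)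
        from ENNReal.ofReal_mul (by positivity)]
    refine mul_le_mul_right (le_trans ?_ (h T (le_of_lt hT))) _
    exact lintegral_mono_set fun t ht => ⟨le_of_lt ht.2, ht.1⟩
  refine (setLIntegral_mono' measurableSet_Ioi h3).trans ?_
  rw [setLIntegral_Ioi_exp_mul_affine hθ hc hd le_rfl]
  simp

variable {Ω : Type*} [MeasurableSpace Ω] {P : Measure Ω} [IsProbabilityMeasure P]
  {u v : Ω × ℝ → ℝ}

/-- The difference of the integrals of two functions, one of which dominates the other, with respect
to a weight on the second factor. -/
lemma abs_integral_sub_integral_le {s : Set ℝ} {g : ℝ → ℝ}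
    (hg : Measurable g) (hg0 : ∀ t, 0 ≤ g t) (hu : Measurable u) (hv : Measurable v)
    (hv0 : ∀ p, 0 ≤ v p) (huv : ∀ p, v p ≤ u p)
    (hfin : ∫⁻ t in s, (∫⁻ ω, ENNReal.ofReal (g t * u (ω, t)) ∂P) < ∞) {K : ℝ} (hK : 0 ≤ K)
    (hgap : ∫⁻ t in s, (∫⁻ ω, ENNReal.ofReal (g t * (u (ω, t) - v (ω, t))) ∂P)
      ≤ ENNReal.ofReal K) :
    Integrable (fun p : Ω × ℝ => g p.2 * u p) (P.prod (volume.restrict s)) ∧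
    Integrable (fun p : Ω × ℝ => g p.2 * v p) (P.prod (volume.restrict s)) ∧
    |(∫ ω, (∫ t in s, g t * u (ω, t)) ∂P) - ∫ ω, (∫ t in s, g t * v (ω, t)) ∂P| ≤ K := by
  have hgu : Measurable fun p : Ω × ℝ => g p.2 * u p := (hg.comp measurable_snd).mul hu
  have hgv : Measurable fun p : Ω × ℝ => g p.2 * v p := (hg.comp measurable_snd).mul hv
  have hu0 : ∀ p, 0 ≤ u p := fun p => (hv0 p).trans (huv p)
  have hiu : Integrable (fun p : Ω × ℝ => g p.2 * u p) (P.prod (volume.restrict s)) := by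
    refine ⟨hgu.aestronglyMeasurable, ?_⟩
    rw [hasFiniteIntegral_iff_ofReal (Eventually.of_forall fun p => mul_nonneg (hg0 _) (hu0 p)),
      lintegral_prod_symm' _ hgu.ennreal_ofReal]
    exact hfin
  have hiv : Integrable (fun p : Ω × ℝ => g p.2 * v p) (P.prod (volume.restrict s)) :=
    hiu.mono' hgv.aestronglyMeasurable (Eventually.of_forall fun p => by
      rw [Real.norm_of_nonneg (mul_nonneg (hg0 _) (hv0 p))]
      exact mul_le_mul_of_nonneg_left (huv p) (hg0 _))
  refine ⟨hiu, hiv, ?_⟩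
  have e1 := integral_prod _ hiu
  have e2 := integral_prod _ hiv
  simp only at e1 e2
  rw [← e1, ← e2, ← integral_sub hiu hiv]
  have hnn : ∀ p : Ω × ℝ, 0 ≤ g p.2 * u p - g p.2 * v p := fun p =>
    sub_nonneg.2 (mul_le_mul_of_nonneg_left (huv p) (hg0 _))
  have hm : Measurable fun p : Ω × ℝ => g p.2 * u p - g p.2 * v p := hgu.sub hgv
  rw [abs_of_nonneg (integral_nonneg hnn), integral_eq_lintegral_of_nonneg_ae
    (Eventually.of_forall hnn) hm.aestronglyMeasurable, lintegral_prod_symm' _ hm.ennreal_ofReal]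
  refine ENNReal.toReal_le_of_le_ofReal hK ?_
  simpa only [mul_sub] using hgap

/-- Discounted costs. -/
lemma abs_discounted_sub_le (hu : Measurable u) (hv : Measurable v)
    (hv0 : ∀ p, 0 ≤ v p) (huv : ∀ p, v p ≤ u p) {c c' d d' θ : ℝ} (hc : 0 ≤ c) (hc' : 0 ≤ c')
    (hd : 0 ≤ d) (hd' : 0 ≤ d') (hθ : 0 < θ)
    (hlin : ∀ t, 0 ≤ t → ∫⁻ ω, ENNReal.ofReal (u (ω, t)) ∂P ≤ ENNReal.ofReal (c + c' * t))
    (hgap : ∀ T, 0 ≤ T → ∫⁻ ω, (∫⁻ t in Set.Ico 0 T, ENNReal.ofReal (u (ω, t) - v (ω, t))) ∂P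
      ≤ ENNReal.ofReal (d + d' * T)) :
    Integrable (fun p : Ω × ℝ => Real.exp (-θ * p.2) * u p)
      (P.prod (volume.restrict (Set.Ioi 0))) ∧
    Integrable (fun p : Ω × ℝ => Real.exp (-θ * p.2) * v p)
      (P.prod (volume.restrict (Set.Ioi 0))) ∧
    |(∫ ω, (∫ t in Set.Ioi 0, Real.exp (-θ * t) * u (ω, t)) ∂P)
      - ∫ ω, (∫ t in Set.Ioi 0, Real.exp (-θ * t) * v (ω, t)) ∂P| ≤ d + d' / θ := by
  refine abs_integral_sub_integral_le (g := fun t => Real.exp (-θ * t))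
    (by fun_prop) (fun t => (Real.exp_pos _).le) hu hv hv0 huv ?_ (by positivity) ?_
  -- The linear growth of the expected costs only secures integrability; it does not enter the final
  -- bound.
  · have h1 : ∀ t ∈ Set.Ioi (0 : ℝ), ∫⁻ ω, ENNReal.ofReal (Real.exp (-θ * t) * u (ω, t)) ∂P
        ≤ ENNReal.ofReal (1 / θ) * ENNReal.ofReal (θ * Real.exp (-θ * t) * (c + c' * t)) := by
      intro t ht
      simp only [ENNReal.ofReal_mul (Real.exp_pos (-θ * t)).le]
      rw [lintegral_const_mul' _ _ ENNReal.ofReal_ne_top, ← ENNReal.ofReal_mul (by positivity)]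
      refine (mul_le_mul_right (hlin t (le_of_lt ht)) _).trans_eq ?_
      rw [← ENNReal.ofReal_mul (Real.exp_pos _).le]
      congr 1
      field_simp
    refine (setLIntegral_mono' measurableSet_Ioi h1).trans_lt ?_
    rw [lintegral_const_mul' _ _ ENNReal.ofReal_ne_top,
      setLIntegral_Ioi_exp_mul_affine hθ hc hc' le_rfl]
    exact ENNReal.mul_lt_top ENNReal.ofReal_lt_top ENNReal.ofReal_lt_top
  · have hm : Measurable fun p : Ω × ℝ => ENNReal.ofReal (u p - v p) := (hu.sub hv).ennreal_ofReal
    have h1 := setLIntegral_exp_mul_le hθ hd hd'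
      (φ := fun t => ∫⁻ ω, ENNReal.ofReal (u (ω, t) - v (ω, t)) ∂P) hm.lintegral_prod_left'
      fun T hT => by
        rw [← lintegral_lintegral_swap hm.aemeasurable]
        exact hgap T hT
    refine le_trans (le_of_eq ?_) h1
    refine lintegral_congr fun t => ?_
    simp only [ENNReal.ofReal_mul (Real.exp_pos (-θ * t)).le]
    rw [lintegral_const_mul' _ _ ENNReal.ofReal_ne_top]

/-- Average costs. -/
lemma abs_average_sub_le (hu : Measurable u) (hv : Measurable v)
    (hv0 : ∀ p, 0 ≤ v p) (huv : ∀ p, v p ≤ u p) {c c' d d' T : ℝ} (hc' : 0 ≤ c')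
    (hd : 0 ≤ d) (hd' : 0 ≤ d') (hT : 1 ≤ T)
    (hlin : ∀ t, 0 ≤ t → ∫⁻ ω, ENNReal.ofReal (u (ω, t)) ∂P ≤ ENNReal.ofReal (c + c' * t))
    (hgap : ∀ T, 0 ≤ T → ∫⁻ ω, (∫⁻ t in Set.Ico 0 T, ENNReal.ofReal (u (ω, t) - v (ω, t))) ∂P
      ≤ ENNReal.ofReal (d + d' * T)) :
    Integrable u (P.prod (volume.restrict (Set.Ioc 0 T))) ∧
    Integrable v (P.prod (volume.restrict (Set.Ioc 0 T))) ∧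
    |(∫ ω, (1 / T * ∫ t in (0 : ℝ)..T, u (ω, t)) ∂P)
      - ∫ ω, (1 / T * ∫ t in (0 : ℝ)..T, v (ω, t)) ∂P| ≤ d + d' := by
  have hT0 : 0 < T := by linarith
  have hm : Measurable fun p : Ω × ℝ => ENNReal.ofReal (u p - v p) := (hu.sub hv).ennreal_ofReal
  have hfin : ∫⁻ t in Set.Ioc 0 T, (∫⁻ ω, ENNReal.ofReal (1 * u (ω, t)) ∂P) < ∞ := by
    simp only [one_mul]
    have h1 : ∀ t ∈ Set.Ioc 0 T, ∫⁻ ω, ENNReal.ofReal (u (ω, t)) ∂P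
        ≤ ENNReal.ofReal (c + c' * T) := fun t ht =>
      (hlin t ht.1.le).trans (ENNReal.ofReal_le_ofReal (by nlinarith [ht.2]))
    refine (setLIntegral_mono' measurableSet_Ioc h1).trans_lt ?_
    rw [setLIntegral_const]
    exact ENNReal.mul_lt_top ENNReal.ofReal_lt_top (by simp)
  have hgap' : ∫⁻ t in Set.Ioc 0 T, (∫⁻ ω, ENNReal.ofReal (1 * (u (ω, t) - v (ω, t))) ∂P)
      ≤ ENNReal.ofReal (d + d' * T) := by
    simp only [one_mul]
    rw [← lintegral_lintegral_swap hm.aemeasurable]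
    refine le_trans (le_of_eq ?_) (hgap T hT0.le)
    refine lintegral_congr fun ω => setLIntegral_congr ?_
    exact Ioc_ae_eq_Icc.trans Ico_ae_eq_Icc.symm
  obtain ⟨h1, h2, h3⟩ := abs_integral_sub_integral_le (g := fun _ => 1) measurable_const
    (fun _ => zero_le_one) hu hv hv0 huv hfin (by positivity) hgap'
  simp only [one_mul] at h1 h2 h3
  refine ⟨h1, h2, ?_⟩
  simp only [intervalIntegral.integral_of_le hT0.le]
  rw [integral_const_mul, integral_const_mul, ← mul_sub, abs_mul, abs_of_pos (by positivity),
    one_div_mul_eq_div, div_le_iff₀ hT0]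
  nlinarith

end Costs

/-! ### Diffusion scaling -/

lemma setLIntegral_Ico_comp_mul {a T : ℝ} (ha : 0 < a) {g : ℝ → ℝ≥0∞} (hg : Measurable g) :
    ∫⁻ t in Set.Ico 0 T, g (a * t)
      = ENNReal.ofReal a⁻¹ * ∫⁻ t in Set.Ico 0 (a * T), g t := by
  have h1 : ∀ t, (Set.Ico 0 T).indicator (fun t => g (a * t)) t
      = (Set.Ico 0 (a * T)).indicator g (a * t) := by
    intro t
    have : t ∈ Set.Ico 0 T ↔ a * t ∈ Set.Ico 0 (a * T) := by
      simp [Set.mem_Ico, ha, mul_nonneg_iff_of_pos_left]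
    by_cases h : t ∈ Set.Ico 0 T
    · rw [Set.indicator_of_mem h, Set.indicator_of_mem (this.1 h)]
    · rw [Set.indicator_of_notMem h, Set.indicator_of_notMem fun h' => h (this.2 h')]
  rw [← lintegral_indicator measurableSet_Ico, ← lintegral_indicator measurableSet_Ico]
  simp only [h1]
  rw [← lintegral_map (g := fun t => a * t) (hg.indicator measurableSet_Ico)
    (measurable_const_mul a), Real.map_volume_mul_left ha.ne', lintegral_smul_measure,
    abs_of_pos (inv_pos.2 ha), smul_eq_mul]

namespace Network

variable {I J m : ℕ} {net : Network I J} {ρ : Fin m → Fin J}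

lemma cost_div (hmu : ∀ j, 0 < net.mu j) (q : Fin J → ℝ) :
    net.cost (fun j => q j / net.mu j) = net.h ⬝ᵥ q := by
  rw [cost, dotProduct]
  refine Finset.sum_congr rfl fun j _ => ?_
  have := (hmu j).ne'
  field_simp

lemma costGap_nonneg (hmu : ∀ j, 0 < net.mu j) (hh : ∀ j, 0 < net.h j) {q : Fin J → ℝ}
    (hq : 0 ≤ q) : 0 ≤ net.costGap q := by
  rw [costGap, sub_nonneg, G_mulVec, ← cost_div hmu]
  exact workloadCost_le hmu hh fun j => div_nonneg (hq j) (hmu j).le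

/-- The workload cost is positively homogeneous. One half of this suffices: a producer of the scaled
workload, multiplied by `c⁻¹`, produces the original one. -/
lemma costGap_smul_le (hmu : ∀ j, 0 < net.mu j) (hh : ∀ j, 0 < net.h j) {q : Fin J → ℝ}
    (hq : 0 ≤ q) {c : ℝ} (hc : 0 < c) : net.costGap (c • q) ≤ c * net.costGap q := by
  have h1 : c * net.workloadCost (net.G *ᵥ q) ≤ net.workloadCost (net.G *ᵥ (c • q)) := by
    conv_rhs => rw [workloadCost, image_queuesOf hmu]
    refine le_csInf ⟨_, _, ⟨?_, (G_mulVec net (c • q)).symm⟩, rfl⟩ ?_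
    · exact fun j => div_nonneg (mul_nonneg hc.le (hq j)) (hmu j).le
    rintro _ ⟨p, ⟨hp, hpK⟩, rfl⟩
    have h2 := workloadCost_le hmu hh (smul_nonneg (inv_pos.2 hc).le hp)
    rw [Matrix.mulVec_smul, hpK, Matrix.mulVec_smul, inv_smul_smul₀ hc.ne', cost_smul] at h2
    calc c * net.workloadCost (net.G *ᵥ q) ≤ c * (c⁻¹ * net.cost p) :=
          mul_le_mul_of_nonneg_left h2 hc.le
      _ = net.cost p := by field_simp
  rw [costGap, costGap, dotProduct_smul, smul_eq_mul]
  linarith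

/-- The factor `r⁻¹` comes from space and `(r ^ 2)⁻¹` from time. The three terms are of the orders
`r⁻¹ s`, `r ^ (2 α - 3)` and `r ^ (α - 1) T`, and all these exponents are at most `α - 1 / 2`. -/
lemma rpow_scaling_le {α c₂ C r S s T N : ℝ} (hα' : α < 1 / 2) (hc₂ : 0 ≤ c₂)
    (hC : 0 ≤ C) (hr : 1 ≤ r) (hs : 0 ≤ s) (hN : 0 ≤ N) (hS : S ^ 2 ≤ r ^ 2 * (N * s)) (hT : 0 ≤ T)
    (hα : 0 < α) :
    r⁻¹ * ((r ^ 2)⁻¹ * (C * (S ^ 2 + (c₂ * r ^ α + 1) ^ 2 + (c₂ * r ^ α + 1) * (r ^ 2 * T))))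
      ≤ C * (N + (c₂ + 1) ^ 2) * r ^ (α - 1 / 2) * (1 + s)
        + C * (N + (c₂ + 1) ^ 2) * r ^ (α - 1 / 2) * T := by
  have hr0 : 0 < r := by linarith
  set ε := r ^ (α - 1 / 2) with hε
  set X := r ^ α with hX
  have hε0 : 0 < ε := Real.rpow_pos_of_pos hr0 _
  have hX1 : 1 ≤ X := Real.one_le_rpow hr hα.le
  have h1 : r⁻¹ ≤ ε := by
    rw [← Real.rpow_neg_one]
    exact Real.rpow_le_rpow_of_exponent_le hr (by linarith)
  have h2 : r⁻¹ * X ≤ ε := by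
    rw [← Real.rpow_neg_one, hX, ← Real.rpow_add hr0]
    exact Real.rpow_le_rpow_of_exponent_le hr (by linarith)
  have h3 : X ^ 2 ≤ r := by
    rw [hX, ← Real.rpow_natCast, ← Real.rpow_mul hr0.le]
    calc r ^ (α * (2 : ℕ)) ≤ r ^ (1 : ℝ) :=
          Real.rpow_le_rpow_of_exponent_le hr (by push_cast; linarith)
      _ = r := Real.rpow_one r
  have h4 : c₂ * X + 1 ≤ (c₂ + 1) * X := by linarith
  have h40 : 0 ≤ c₂ * X + 1 := by positivity
  have hri : 0 ≤ r⁻¹ := by positivity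
  have hrr : r⁻¹ ≤ 1 := inv_le_one_of_one_le₀ hr
  have a1 : r⁻¹ * ((r ^ 2)⁻¹ * S ^ 2) ≤ ε * (N * s) := by
    have : (r ^ 2)⁻¹ * S ^ 2 ≤ N * s := by
      rw [inv_mul_le_iff₀ (by positivity)]; exact hS
    exact mul_le_mul h1 this (by positivity) hε0.le
  have a2 : r⁻¹ * ((r ^ 2)⁻¹ * (c₂ * X + 1) ^ 2) ≤ ε * (c₂ + 1) ^ 2 := by
    refine mul_le_mul h1 ?_ (by positivity) hε0.le
    rw [inv_mul_le_iff₀ (by positivity)]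
    have b1 : (c₂ * X + 1) ^ 2 ≤ ((c₂ + 1) * X) ^ 2 := pow_le_pow_left₀ h40 h4 2
    have b2 : X ^ 2 ≤ r ^ 2 := h3.trans (by nlinarith)
    calc (c₂ * X + 1) ^ 2 ≤ (c₂ + 1) ^ 2 * X ^ 2 := by rw [← mul_pow]; exact b1
      _ ≤ (c₂ + 1) ^ 2 * r ^ 2 := mul_le_mul_of_nonneg_left b2 (by positivity)
      _ = r ^ 2 * (c₂ + 1) ^ 2 := mul_comm _ _
  have a3 : r⁻¹ * ((r ^ 2)⁻¹ * ((c₂ * X + 1) * (r ^ 2 * T))) ≤ ε * (c₂ + 1) ^ 2 * T := by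
    have e : r⁻¹ * ((r ^ 2)⁻¹ * ((c₂ * X + 1) * (r ^ 2 * T))) = r⁻¹ * (c₂ * X + 1) * T := by
      field_simp
    rw [e]
    refine mul_le_mul_of_nonneg_right ?_ hT
    calc r⁻¹ * (c₂ * X + 1) ≤ r⁻¹ * ((c₂ + 1) * X) := mul_le_mul_of_nonneg_left h4 hri
      _ = (c₂ + 1) * (r⁻¹ * X) := by ring
      _ ≤ (c₂ + 1) * ε := mul_le_mul_of_nonneg_left h2 (by positivity)
      _ ≤ (c₂ + 1) ^ 2 * ε := mul_le_mul_of_nonneg_right (by nlinarith) hε0.le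
      _ = ε * (c₂ + 1) ^ 2 := mul_comm _ _
  have p1 : 0 ≤ ε * N * T := by positivity
  have p2 : 0 ≤ ε * N := by positivity
  have p3 : 0 ≤ ε * (c₂ + 1) ^ 2 * s := by positivity
  have key : r⁻¹ * ((r ^ 2)⁻¹ * (S ^ 2 + (c₂ * X + 1) ^ 2 + (c₂ * X + 1) * (r ^ 2 * T)))
      ≤ (N + (c₂ + 1) ^ 2) * ε * (1 + s) + (N + (c₂ + 1) ^ 2) * ε * T := by linarith
  have := mul_le_mul_of_nonneg_left key hC
  linarith

/-- The queue lengths in diffusion scaling, computed from the jump chain. -/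
noncomputable def scaledChain {Ω : Type*} (net : Network I J) (ρ : Fin m → Fin J) (a b : ℝ) (n₀ : Fin J → ℕ)
    (z : Fin J → Bool) (η Δ : Fin J → ℕ → Ω → ℝ) (r : ℝ) (p : Ω × ℝ) : Fin J → ℝ :=
  r⁻¹ • fun j => (net.queueAt ρ a b n₀ z (allClocks η Δ p.1) (r ^ 2 * p.2) j : ℝ)

lemma scaledChain_nonneg {Ω : Type*} {η Δ : Fin J → ℕ → Ω → ℝ} (a b : ℝ) (n₀ : Fin J → ℕ) (z : Fin J → Bool) {r : ℝ} (hr : 0 ≤ r)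
    (p : Ω × ℝ) : 0 ≤ net.scaledChain ρ a b n₀ z η Δ r p :=
  smul_nonneg (inv_nonneg.2 hr) fun _ => Nat.cast_nonneg _

section FixedScale

variable {Ω : Type*} [MeasurableSpace Ω] {P : Measure Ω} {η Δ : Fin J → ℕ → Ω → ℝ}

lemma measurable_comp_scaledChain {lam mu : Fin J → ℝ} (h : IsPrimitiveData P lam mu η Δ)
    (a b : ℝ) (n₀ : Fin J → ℕ) (z : Fin J → Bool) (r : ℝ) (f : (Fin J → ℝ) → ℝ) :
    Measurable fun p => f (net.scaledChain ρ a b n₀ z η Δ r p) := by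
  have h1 : Measurable fun p : Ω × ℝ => (allClocks η Δ p.1, r ^ 2 * p.2) :=
    (h.measurable_allClocks.comp measurable_fst).prodMk (measurable_snd.const_mul _)
  exact (Measurable.of_discrete (f := fun n : Fin J → ℕ => f (r⁻¹ • fun j => (n j : ℝ)))).comp
    ((measurable_queueAt a b n₀ z).comp h1)

lemma lintegral_cost_scaledChain_le (hnet : net.IsLocalTraffic) (hl : ∀ j, 0 < net.load j)
    (hcap : net.C = net.K *ᵥ net.load) (hρ : net.IsViableRanking ρ) (a b : ℝ)
    {lam mu : Fin J → ℝ} (hlam : ∀ j, 0 < lam j) (hmu : ∀ j, 0 < mu j)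
    (h : IsPrimitiveData P lam mu η Δ) (n₀ : Fin J → ℕ) (z : Fin J → Bool) {r : ℝ} (hr : 0 < r)
    {t : ℝ} (ht : 0 ≤ t) :
    ∫⁻ ω, ENNReal.ofReal (net.h ⬝ᵥ net.scaledChain ρ a b n₀ z η Δ r (ω, t)) ∂P
      ≤ ENNReal.ofReal (∑ j, net.h j * r⁻¹ * n₀ j + (∑ j, net.h j * r⁻¹ * lam j * r ^ 2) * t) := by
  have hw : ∀ j, 0 ≤ net.h j * r⁻¹ := fun j => mul_nonneg (hnet.cost_pos j).le (inv_pos.2 hr).le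
  have e : ∀ ω, ENNReal.ofReal (net.h ⬝ᵥ net.scaledChain ρ a b n₀ z η Δ r (ω, t))
      = ∑ j, ENNReal.ofReal (net.h j * r⁻¹) * ENNReal.ofReal
        (net.queueAt ρ a b n₀ z (allClocks η Δ ω) (r ^ 2 * t) j) := by
    intro ω
    simp only [← ENNReal.ofReal_mul (hw _)]
    rw [← ENNReal.ofReal_sum_of_nonneg fun j _ => mul_nonneg (hw j) (Nat.cast_nonneg _)]
    congr 1
    simp only [dotProduct, scaledChain, Pi.smul_apply, smul_eq_mul, mul_assoc]
  have hm : ∀ j, Measurable fun y => ENNReal.ofReal (net.queueAt ρ a b n₀ z y (r ^ 2 * t) j) :=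
    fun j => (Measurable.of_discrete (f := fun n : Fin J → ℕ => ENNReal.ofReal (n j))).comp
      ((measurable_queueAt a b n₀ z).comp measurable_prodMk_right)
  have hm' : ∀ j, Measurable fun ω => ENNReal.ofReal (net.h j * r⁻¹) * ENNReal.ofReal
      (net.queueAt ρ a b n₀ z (allClocks η Δ ω) (r ^ 2 * t) j) := fun j =>
    ((hm j).comp h.measurable_allClocks).const_mul _
  simp only [e]
  rw [lintegral_finsetSum _ fun j _ => hm' j,
    Finset.sum_mul, ← Finset.sum_add_distrib, ENNReal.ofReal_sum_of_nonneg fun j _ => ?_]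
  · refine Finset.sum_le_sum fun j _ => ?_
    rw [lintegral_const_mul' _ _ ENNReal.ofReal_ne_top,
      ← lintegral_map (hm j) h.measurable_allClocks, h.map_allClocks hlam hmu]
    refine (mul_le_mul_right (lintegral_queueAt_le hnet hl hcap hρ a b hlam hmu n₀ z j
      (by positivity)) _).trans_eq ?_
    rw [← ENNReal.ofReal_mul (hw j)]
    congr 1
    ring
  · have := hw j
    have := hlam j
    positivity

lemma lintegral_costGap_scaledChain_le (hnet : net.IsLocalTraffic) (hmu0 : ∀ j, 0 < net.mu j)
    (a b : ℝ) {lam mu : Fin J → ℝ} (hlam : ∀ j, 0 < lam j) (hmu : ∀ j, 0 < mu j)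
    (h : IsPrimitiveData P lam mu η Δ) (n₀ : Fin J → ℕ) (z : Fin J → Bool) {r : ℝ} (hr : 0 < r)
    {K : ℝ} {T : ℝ}
    (hgap : ∫⁻ y, (∫⁻ u in Set.Ico 0 (r ^ 2 * T), ENNReal.ofReal (net.costGap fun j =>
        (net.queueAt ρ a b n₀ z y u j : ℝ))) ∂clockLaw (Sum.elim lam mu) ≤ ENNReal.ofReal K) :
    ∫⁻ ω, (∫⁻ t in Set.Ico 0 T, ENNReal.ofReal
        (net.costGap (net.scaledChain ρ a b n₀ z η Δ r (ω, t)))) ∂P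
      ≤ ENNReal.ofReal (r⁻¹ * ((r ^ 2)⁻¹ * K)) := by
  have hri : 0 < r⁻¹ := inv_pos.2 hr
  have hr2 : 0 < r ^ 2 := by positivity
  have h1 : ∀ ω, ∫⁻ t in Set.Ico 0 T, ENNReal.ofReal
        (net.costGap (net.scaledChain ρ a b n₀ z η Δ r (ω, t)))
      ≤ ENNReal.ofReal r⁻¹ * (ENNReal.ofReal (r ^ 2)⁻¹ * ∫⁻ u in Set.Ico 0 (r ^ 2 * T),
        ENNReal.ofReal (net.costGap fun j =>
          (net.queueAt ρ a b n₀ z (allClocks η Δ ω) u j : ℝ))) := by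
    intro ω
    have hg : Measurable fun u => ENNReal.ofReal (net.costGap fun j =>
        (net.queueAt ρ a b n₀ z (allClocks η Δ ω) u j : ℝ)) :=
      (Measurable.of_discrete (f := fun n : Fin J → ℕ =>
        ENNReal.ofReal (net.costGap fun j => (n j : ℝ)))).comp
        ((measurable_queueAt a b n₀ z).comp measurable_prodMk_left)
    rw [← setLIntegral_Ico_comp_mul hr2 hg, ← lintegral_const_mul' _ _ ENNReal.ofReal_ne_top]
    refine lintegral_mono fun t => ?_
    rw [← ENNReal.ofReal_mul hri.le]
    exact ENNReal.ofReal_le_ofReal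
      (costGap_smul_le hmu0 hnet.cost_pos (fun _ => Nat.cast_nonneg _) hri)
  refine (lintegral_mono h1).trans ?_
  rw [lintegral_const_mul' _ _ ENNReal.ofReal_ne_top,
    lintegral_const_mul' _ _ ENNReal.ofReal_ne_top,
    ← lintegral_map (measurable_setLIntegral_queueAt a b n₀ z _ fun n =>
      ENNReal.ofReal (net.costGap fun j => (n j : ℝ))) h.measurable_allClocks,
    h.map_allClocks hlam hmu, ENNReal.ofReal_mul hri.le,
    ENNReal.ofReal_mul (inv_pos.2 hr2).le]
  exact mul_le_mul_right (mul_le_mul_right hgap _) _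

end FixedScale

end Network

/-! ### Comparison of holding costs and workload costs -/

theorem mainTheorem3 {I J m : ℕ} (net : Network I J) (hnet : net.IsLocalTraffic)
    (lamR muR : ℝ → Fin J → ℝ) (β : Fin J → ℝ) (hHT : net.IsHeavyTraffic lamR muR β)
    (ρ : Fin m → Fin J) (hρ : net.IsViableRanking ρ)
    (α c₁ c₂ : ℝ) (hα : 0 < α) (hα' : α < 1 / 2) (hc₁ : 0 < c₁) (hc₂ : c₁ < c₂) :
    ∃ B R : ℝ, 0 < B ∧ 0 < R ∧
      ∀ r ≥ R, ∀ x ∈ stateSpace J r,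
      ∀ (Ω : Type*) [MeasurableSpace Ω] (P : Measure Ω) [IsProbabilityMeasure P]
        (η Δ : Fin J → ℕ → Ω → ℝ) (Q : ℝ → Ω → Fin J → ℝ),
        IsPrimitiveData P (lamR r) (muR r) η Δ →
        IsQueueProcess net ρ (c₁ * r ^ α) (c₂ * r ^ α) (fun j => r * x.1 j) x.2 P η Δ Q →
        (∀ θ > 0,
          Integrable (fun p : Ω × ℝ =>
              Real.exp (-θ * p.2) * (net.h ⬝ᵥ scaledQueue r Q p.2 p.1))
            (P.prod (volume.restrict (Set.Ioi 0))) ∧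
          Integrable (fun p : Ω × ℝ =>
              Real.exp (-θ * p.2) * net.workloadCost (net.G *ᵥ scaledQueue r Q p.2 p.1))
            (P.prod (volume.restrict (Set.Ioi 0))) ∧
          |(∫ ω, (∫ t in Set.Ioi (0 : ℝ),
                Real.exp (-θ * t) * (net.h ⬝ᵥ scaledQueue r Q t ω)) ∂P) -
            (∫ ω, (∫ t in Set.Ioi (0 : ℝ),
                Real.exp (-θ * t) * net.workloadCost (net.G *ᵥ scaledQueue r Q t ω)) ∂P)|
            ≤ B * r ^ (α - 1 / 2) * ((1 + ∑ j, x.1 j ^ 2) / (1 - Real.exp (-θ)))) ∧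
        (∀ T ≥ 1,
          Integrable (fun p : Ω × ℝ => net.h ⬝ᵥ scaledQueue r Q p.2 p.1)
            (P.prod (volume.restrict (Set.Ioc 0 T))) ∧
          Integrable (fun p : Ω × ℝ => net.workloadCost (net.G *ᵥ scaledQueue r Q p.2 p.1))
            (P.prod (volume.restrict (Set.Ioc 0 T))) ∧
          |(∫ ω, (1 / T * ∫ t in (0 : ℝ)..T, net.h ⬝ᵥ scaledQueue r Q t ω) ∂P) -
            (∫ ω, (1 / T * ∫ t in (0 : ℝ)..T,
                net.workloadCost (net.G *ᵥ scaledQueue r Q t ω)) ∂P)|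
            ≤ B * r ^ (α - 1 / 2) * (1 + ∑ j, x.1 j ^ 2)) := by
  have hmu0 := hHT.mu_pos
  have hh := hnet.cost_pos
  have hc₂0 : 0 < c₂ := hc₁.trans hc₂
  -- Without job types there are no clocks, and all costs vanish.
  rcases Nat.eq_zero_or_pos J with rfl | hJ
  · have hv : ∀ q : Fin 0 → ℝ, net.workloadCost (net.G *ᵥ q) = 0 := fun q =>
      le_antisymm (by simpa [Network.costGap] using
          Network.costGap_nonneg (net := net) hmu0 hh (q := q) fun j => j.elim0)
        (Network.workloadCost_nonneg hmu0 hh _)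
    refine ⟨1, 1, one_pos, one_pos, fun r hr x _ Ω _ P _ η Δ Q _ _ => ⟨fun θ hθ => ?_, fun T _ => ?_⟩⟩
    · have : 0 < 1 - Real.exp (-θ) := by simpa using hθ
      have hr0 : 0 ≤ r ^ (α - 1 / 2) := Real.rpow_nonneg (by linarith) _
      simp only [hv, dotProduct, Finset.univ_eq_empty, Finset.sum_empty, mul_zero, integral_zero,
        sub_zero, abs_zero]
      exact ⟨integrable_zero _ _ _, integrable_zero _ _ _, by positivity⟩
    · have hr0 : 0 ≤ r ^ (α - 1 / 2) := Real.rpow_nonneg (by linarith) _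
      simp only [hv, dotProduct, Finset.univ_eq_empty, Finset.sum_empty,
        intervalIntegral.integral_zero, mul_zero, integral_zero, sub_zero, abs_zero]
      exact ⟨integrable_zero _ _ _, integrable_zero _ _ _, by positivity⟩
  obtain ⟨C, hC, hev⟩ := Network.exists_lintegral_costGap_le hnet hHT hρ hα hc₁ hc₂ ⟨0, hJ⟩
  obtain ⟨R, hR⟩ := eventually_atTop.1 hev
  set B := C * (J + (c₂ + 1) ^ 2) with hB
  have hB0 : 0 ≤ B := by positivity
  refine ⟨2 * B + 1, max R 1, by positivity, by positivity,
    fun r hr x hx Ω _ P _ η Δ Q hD hQ => ?_⟩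
  have hr1 : 1 ≤ r := (le_max_right _ _).trans hr
  have hr0 : 0 < r := by linarith
  choose n₀ hn₀ using hx
  have hxn : (fun j => r * x.1 j) = fun j => (n₀ j : ℝ) := by
    funext j
    rw [hn₀ j]
    field_simp
  rw [hxn] at hQ
  have hlam := hHT.lamR_pos r hr0
  have hmu := hHT.muR_pos r hr0
  have hrα : 0 < r ^ α := Real.rpow_pos_of_pos hr0 α
  have hl := hHT.load_pos
  -- The exceptional null set does not depend on `t`, so the chain may replace `Q` inside the time
  -- integrals.
  have hsc : ∀ᵐ ω ∂P, ∀ t, 0 ≤ t → scaledQueue r Q t ω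
      = net.scaledChain ρ (c₁ * r ^ α) (c₂ * r ^ α) n₀ x.2 η Δ r (ω, t) := by
    filter_upwards [Network.ae_eq_chainPath hnet hl hHT.capacity_eq hρ (mul_pos hc₁ hrα)
      (mul_lt_mul_of_pos_right hc₂ hrα) ⟨0, hJ⟩ hlam hmu hD hQ] with ω hω t ht
    funext j
    rw [scaledQueue, hω _ (by positivity), div_eq_inv_mul]
    rfl
  set X := net.scaledChain ρ (c₁ * r ^ α) (c₂ * r ^ α) n₀ x.2 η Δ r with hX
  have hX0 : ∀ p, 0 ≤ X p := Network.scaledChain_nonneg _ _ n₀ x.2 hr0.le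
  have hum : Measurable fun p => net.h ⬝ᵥ X p :=
    Network.measurable_comp_scaledChain hD _ _ n₀ x.2 r fun q => net.h ⬝ᵥ q
  have hvm : Measurable fun p => net.workloadCost (net.G *ᵥ X p) :=
    Network.measurable_comp_scaledChain hD _ _ n₀ x.2 r fun q => net.workloadCost (net.G *ᵥ q)
  have hv0 : ∀ p, 0 ≤ net.workloadCost (net.G *ᵥ X p) := fun p =>
    Network.workloadCost_nonneg hmu0 hh _
  have huv : ∀ p, net.workloadCost (net.G *ᵥ X p) ≤ net.h ⬝ᵥ X p := fun p =>
    sub_nonneg.1 (Network.costGap_nonneg hmu0 hh (hX0 p))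
  set ε := r ^ (α - 1 / 2) with hε
  have hε0 : 0 < ε := Real.rpow_pos_of_pos hr0 _
  set s := ∑ j, x.1 j ^ 2 with hs
  have hs0 : 0 ≤ s := Finset.sum_nonneg fun j _ => sq_nonneg _
  have hlin := fun t (ht : (0 : ℝ) ≤ t) => Network.lintegral_cost_scaledChain_le hnet hl
    hHT.capacity_eq hρ (c₁ * r ^ α) (c₂ * r ^ α) hlam hmu hD n₀ x.2 hr0 ht
  have hc : 0 ≤ ∑ j, net.h j * r⁻¹ * (n₀ j : ℝ) := Finset.sum_nonneg fun j _ => by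
    have := hh j
    positivity
  have hc' : 0 ≤ ∑ j, net.h j * r⁻¹ * lamR r j * r ^ 2 := Finset.sum_nonneg fun j _ => by
    have := hh j
    have := hlam j
    positivity
  have hS : (∑ j, (n₀ j : ℝ)) ^ 2 ≤ r ^ 2 * (J * s) := by
    have h1 : ∑ j, (n₀ j : ℝ) = r * ∑ j, x.1 j := by
      rw [Finset.mul_sum]
      exact Finset.sum_congr rfl fun j _ => (congrFun hxn j).symm
    have h2 := sq_sum_le_card_mul_sum_sq (s := Finset.univ) (f := x.1)
    rw [Finset.card_univ, Fintype.card_fin] at h2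
    rw [h1, mul_pow]
    exact mul_le_mul_of_nonneg_left h2 (by positivity)
  have hgap : ∀ T, 0 ≤ T → ∫⁻ ω, (∫⁻ t in Set.Ico 0 T, ENNReal.ofReal
      (net.h ⬝ᵥ X (ω, t) - net.workloadCost (net.G *ᵥ X (ω, t)))) ∂P
      ≤ ENNReal.ofReal (B * ε * (1 + s) + B * ε * T) := fun T hT =>
    (Network.lintegral_costGap_scaledChain_le hnet hmu0 _ _ hlam hmu hD n₀ x.2 hr0
      (hR r ((le_max_left _ _).trans hr) n₀ x.2 (r ^ 2 * T) (by positivity))).trans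
      (ENNReal.ofReal_le_ofReal (Network.rpow_scaling_le hα' hc₂0.le hC hr1 hs0
        (Nat.cast_nonneg J) hS hT hα))
  -- Joint measurability is available for the chain; `Q` agrees with it off a null set of the
  -- product and so inherits integrability.
  have hprod : ∀ I : Set ℝ, MeasurableSet I → I ⊆ Set.Ici 0 →
      ∀ᵐ p ∂P.prod (volume.restrict I), scaledQueue r Q p.2 p.1 = X p := by
    intro I hI hI0
    filter_upwards [Measure.quasiMeasurePreserving_fst.ae hsc,
      Measure.quasiMeasurePreserving_snd.ae (ae_restrict_mem hI)] with p h1 h2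
    exact h1 p.2 (hI0 h2)
  have hBε : 0 ≤ B * ε := by positivity
  have hd : 0 ≤ B * ε * (1 + s) := by positivity
  refine ⟨fun θ hθ => ?_, fun T hT => ?_⟩
  · obtain ⟨h1, h2, h3⟩ := abs_discounted_sub_le hum hvm hv0 huv hc hc' hd hBε hθ hlin hgap
    have hae := hprod (Set.Ioi 0) measurableSet_Ioi Set.Ioi_subset_Ici_self
    refine ⟨h1.congr (hae.mono fun p hp => ?_), h2.congr (hae.mono fun p hp => ?_), ?_⟩
    · simp only [hp]
    · simp only [hp]
    have e1 : ∫ ω, (∫ t in Set.Ioi (0 : ℝ),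
        Real.exp (-θ * t) * (net.h ⬝ᵥ scaledQueue r Q t ω)) ∂P
        = ∫ ω, (∫ t in Set.Ioi (0 : ℝ), Real.exp (-θ * t) * (net.h ⬝ᵥ X (ω, t))) ∂P :=
      integral_congr_ae (hsc.mono fun ω hω => setIntegral_congr_fun measurableSet_Ioi fun t ht => by
        simp only [hω t (le_of_lt ht)])
    have e2 : ∫ ω, (∫ t in Set.Ioi (0 : ℝ),
        Real.exp (-θ * t) * net.workloadCost (net.G *ᵥ scaledQueue r Q t ω)) ∂P
        = ∫ ω, (∫ t in Set.Ioi (0 : ℝ),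
          Real.exp (-θ * t) * net.workloadCost (net.G *ᵥ X (ω, t))) ∂P :=
      integral_congr_ae (hsc.mono fun ω hω => setIntegral_congr_fun measurableSet_Ioi fun t ht => by
        simp only [hω t (le_of_lt ht)])
    rw [e1, e2]
    refine h3.trans ?_
    have hexp : 0 < 1 - Real.exp (-θ) := by simpa using hθ
    -- The denominator `1 - exp (-θ)` is at most `1` and at most `θ`, so it absorbs both the initial
    -- term and the term with `1 / θ`.
    have hexp1 : 1 - Real.exp (-θ) ≤ 1 := by linarith [Real.exp_pos (-θ)]
    have hexpθ : 1 - Real.exp (-θ) ≤ θ := by linarith [Real.add_one_le_exp (-θ)]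
    have k1 : B * ε * (1 + s) ≤ B * ε * (1 + s) / (1 - Real.exp (-θ)) :=
      le_div_self hd hexp hexp1
    have k2 : B * ε / θ ≤ B * ε * (1 + s) / (1 - Real.exp (-θ)) :=
      div_le_div₀ hd (le_mul_of_one_le_right hBε (by linarith)) hexp hexpθ
    have k3 : 0 ≤ ε * (1 + s) / (1 - Real.exp (-θ)) := by positivity
    calc B * ε * (1 + s) + B * ε / θ
        ≤ 2 * (B * ε * (1 + s) / (1 - Real.exp (-θ))) + ε * (1 + s) / (1 - Real.exp (-θ)) := by
          linarith
      _ = (2 * B + 1) * ε * ((1 + s) / (1 - Real.exp (-θ))) := by ring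
  · obtain ⟨h1, h2, h3⟩ := abs_average_sub_le hum hvm hv0 huv hc' hd hBε hT hlin hgap
    have hae := hprod (Set.Ioc 0 T) measurableSet_Ioc fun t ht => le_of_lt ht.1
    refine ⟨h1.congr (hae.mono fun p hp => ?_), h2.congr (hae.mono fun p hp => ?_), ?_⟩
    · simp only [hp]
    · simp only [hp]
    have hT0 : (0 : ℝ) ≤ T := by linarith
    have e1 : ∫ ω, (1 / T * ∫ t in (0 : ℝ)..T, net.h ⬝ᵥ scaledQueue r Q t ω) ∂P
        = ∫ ω, (1 / T * ∫ t in (0 : ℝ)..T, net.h ⬝ᵥ X (ω, t)) ∂P :=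
      integral_congr_ae (hsc.mono fun ω hω => congrArg (1 / T * ·)
        (intervalIntegral.integral_congr fun t ht => by
          rw [Set.uIcc_of_le hT0] at ht
          simp only [hω t ht.1]))
    have e2 : ∫ ω, (1 / T * ∫ t in (0 : ℝ)..T,
          net.workloadCost (net.G *ᵥ scaledQueue r Q t ω)) ∂P
        = ∫ ω, (1 / T * ∫ t in (0 : ℝ)..T, net.workloadCost (net.G *ᵥ X (ω, t))) ∂P :=
      integral_congr_ae (hsc.mono fun ω hω => congrArg (1 / T * ·)
        (intervalIntegral.integral_congr fun t ht => by
          rw [Set.uIcc_of_le hT0] at ht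
          simp only [hω t ht.1]))
    rw [e1, e2]
    refine h3.trans ?_
    have k1 : B * ε ≤ B * ε * (1 + s) := le_mul_of_one_le_right hBε (by linarith)
    have k2 : 0 ≤ ε * (1 + s) := by positivity
    linarith
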